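/- **Setup.** Let $\mathbb S=\mathbb Z[[a_i\mid i\in\mathbb Z]]$ and let $R(a)=\mathbb Z[(1-a_i)^{\pm1}\mid i\in\mathbb Z]\subset\mathbb S$. Let $e_k(x/a)$ $(k\ge 1)$ be the coefficient of $t^k$ in $\prod_{i\le 0}\frac{1+x_it}{1+a_it}$, and let $\hat\Lambda(x\|a)$ be the $\mathbb S$-algebra of formal power series in $e_1(x/a),e_2(x/a),\dots$ with coefficients in $\mathbb S$. It is a (completed) bialgebra over $\mathbb S$: the power sums $p_k(x\|a)=\sum_{i\le 0}x_i^k-\sum_{i\le 0}a_i^k$ are primitive (equivalently $\Delta(e_k)=\sum_{i+j=k}e_i\otimes e_j$, $e_0=1$), and the counit $\epsilon$ sends every $p_k(x\|a)$, $k\ge1$, to $0$. Its coproduct takes values in $\hat\Lambda(x\|a)\mathbin{\hat\otimes}_{\mathbb S}\hat\Lambda(x\|a)$, the ring of formal power series over $\mathbb S$ in the elements $e_k\otimes1$ and $1\otimes e_k$. Put $x\ominus a=(x-a)/(1-a)$. Let $s_i$ be the transposition of $i$ and $i+1$, and let $S_n$ be generated by $s_1,\dots,s_{n-1}$, with longest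 element $w_0$. For $w\in S_n$ the double Grothendieck polynomial $\mathfrak G_w(x;a)$ is defined by $\mathfrak G_{w_0}(x;a)=\prod_{i+j\le n}(x_i\ominus a_j)$, with $i,j\geq 1$, and $\mathfrak G_w=\tilde\pi_i\,\mathfrak G_{ws_i}$ whenever $ws_i>w$, where $\tilde\pi_i=(x_i-x_{i+1})^{-1}(1-s_i)(1-x_{i+1})$ acts on the $x$ variables. For a permutation $w$ of $\mathbb Z$ moving only finitely many integers, let $\overleftarrow{\mathfrak G}_w(x;a)$ be the limit, for $p\to-\infty$, of the polynomials obtained by computing the double Grothendieck polynomial of $w$ with the variables $x_p,x_{p+1},\dots$ and $a_p,a_{p+1},\dots$ in place of $x_1,x_2,\dots$ and $a_1,a_2,\dots$. It is an element of $\hat\Lambda(x\|a)\otimes_{R(a)}R(x;a)$, where $R(x;a)=R(a)[(1-x_i)^{\pm1}\mid i\in\mathbb Z]$. Let $\eta_a:\hat\Lambda(x\|a)\otimes_{R(a)}R(x;a)\to\hat\Lambda(x\|a)$ be the $\mathbb S$-algebra map which is the identity on $\hat\Lambda(x\|a)$ and sends $x_i\mapsto a_i$. For a partition $\lambda$ let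 $w_\lambda$ be the permutation obtained by placing $s_{j-i}$ in the box $(i,j)$ of the Young diagram of $\lambda$ and multiplying these reflections, the rows being taken from bottom to top and each row being read from right to left. The Grassmannian double $K$-Stanley function is $G_\lambda(x\|a)=\eta_a\bigl(\overleftarrow{\mathfrak G}_{w_\lambda}(x;a)\bigr)\in\hat\Lambda(x\|a)$. Let $\Gamma(x\|a)$ be the $R(a)$-submodule of $\hat\Lambda(x\|a)$ spanned by all $G_\lambda(x\|a)$. **Theorem.** The elements $G_\lambda(x\|a)$ are well defined and form an $R(a)$-basis of $\Gamma(x\|a)$, and $\Gamma(x\|a)$ is an $R(a)$-bialgebra with the structure inherited from $\hat\Lambda(x\|a)$. That is, $\Gamma(x\|a)$ is an $R(a)$-subalgebra of $\hat\Lambda(x\|a)$; the natural map $\Gamma(x\|a)\otimes_{R(a)}\Gamma(x\|a)\to\hat\Lambda(x\|a)\mathbin{\hat\otimes}_{\mathbb S}\hat\Lambda(x\|a)$ is injective; and the coproduct and counit of $\hat\Lambda(x\|a)$ restrict to $R(a)$-algebra homomorphisms $\Gamma(x\|a)\to\Gamma(x\|a)\otimes_{R(a)}\Gamma(x\|a)$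 and $\Gamma(x\|a)\to R(a)$ which are coassociative and counital. -/

import Mathlib

open scoped TensorProduct

noncomputable section

namespace DoubleKStanley

/-! ### Coefficient rings -/

/-- The ring `𝕊 = ℤ[[a_i ∣ i ∈ ℤ]]`. -/
abbrev SS : Type := MvPowerSeries ℤ ℤ

/-- The Laurent polynomial ring `R(a) = ℤ[(1 - a_i)^{±1} ∣ i ∈ ℤ]` in the variables `1 - a_i`,
as a subring of `𝕊`. -/
def Ra : Subalgebra ℤ SS :=
  Algebra.adjoin ℤ {f | ∃ i : ℤ, f = 1 - MvPowerSeries.X i ∨ f * (1 - MvPowerSeries.X i) = 1}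

/-- The ring `ℤ[[x_i, a_i ∣ i ∈ ℤ]]` of formal power series in both sets of variables. -/
abbrev XA : Type := MvPowerSeries (ℤ ⊕ ℤ) ℤ

/-- The inclusion `𝕊 → ℤ[[x, a]]`. -/
def inclA : SS →ₐ[ℤ] XA := MvPowerSeries.rename (Function.Embedding.inr : ℤ ↪ ℤ ⊕ ℤ)

instance : Algebra SS XA := inclA.toRingHom.toAlgebra

/-- The variable `x_i`. -/
def xVar (i : ℤ) : XA := MvPowerSeries.X (Sum.inl i)

/-- The variable `a_i`. -/
def aVar (i : ℤ) : XA := MvPowerSeries.X (Sum.inr i)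

/-- The ring `R(x;a) = R(a)[(1 - x_i)^{±1} ∣ i ∈ ℤ]`, as an `R(a)`-subalgebra of `ℤ[[x, a]]`. -/
def Rxa : Subalgebra Ra XA :=
  Algebra.adjoin Ra {f | ∃ i : ℤ, f = 1 - xVar i ∨ f * (1 - xVar i) = 1}

/-- The multiplicative formal group difference `f ⊖ g = (f - g) / (1 - g)`, for power series `g`
without constant term. -/
def ominus (f g : XA) : XA := (f - g) * MvPowerSeries.invOfUnit (1 - g) 1

/-! ### Permutations -/

/-- The simple reflection `s_i` of `S_ℤ`, exchanging `i` and `i + 1`. -/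
def simpleRefl (i : ℤ) : Equiv.Perm ℤ := Equiv.swap i (i + 1)

/-- The longest element `w₀` of `S_n`, viewed as a permutation of `ℤ`: it sends `i` to `n + 1 - i`
for `1 ≤ i ≤ n` and fixes all other integers. -/
def longest (n : ℕ) : Equiv.Perm ℤ :=
  Function.Involutive.toPerm (fun i : ℤ => if 1 ≤ i ∧ i ≤ n then n + 1 - i else i) (by
    intro i
    dsimp only
    split_ifs <;> omega)

/-- The power `γ^m` of the shift automorphism of `S_ℤ`, where `γ(s_i) = s_{i+1}`:
`γ^m(w)(i) = w(i - m) + m`. -/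
def shiftPerm (m : ℤ) (w : Equiv.Perm ℤ) : Equiv.Perm ℤ :=
  Equiv.addRight m * w * (Equiv.addRight m)⁻¹

/-- The Grassmannian permutation `w_λ`: the product of the reflections `s_{j-i}` placed in the
boxes `(i, j)` of the Young diagram, where rows are taken from bottom to top and each row is read
from right to left. For `λ = (3,2)` this is `s₀ s₋₁ s₂ s₁ s₀`. -/
def grassmannianPerm (μ : YoungDiagram) : Equiv.Perm ℤ :=
  ((List.range (μ.colLen 0)).reverse.map fun i =>
    ((List.range (μ.rowLen i)).reverse.map fun j => simpleRefl ((j : ℤ) - (i : ℤ))).prod).prod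

/-! ### Double Grothendieck polynomials -/

/-- The action of the permutation `w` on the `x` variables. -/
def permX (w : Equiv.Perm ℤ) : XA →ₐ[ℤ] XA :=
  MvPowerSeries.rename (Equiv.sumCongr w (Equiv.refl ℤ))

/-- The power `γ^m` of the shift automorphism: `x_i ↦ x_{i+m}` and `a_i ↦ a_{i+m}`. -/
def shift (m : ℤ) : XA →ₐ[ℤ] XA :=
  MvPowerSeries.rename (Equiv.sumCongr (Equiv.addRight m) (Equiv.addRight m))

/-- `g = π_i f` for the isobaric divided difference operator
`π_i = (x_i - x_{i+1})⁻¹ (1 - s_i) (1 - x_{i+1})` in the `x` variables. -/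
def IsDemazure (i : ℤ) (f g : XA) : Prop :=
  (xVar i - xVar (i + 1)) * g =
    (1 - xVar (i + 1)) * f - permX (simpleRefl i) ((1 - xVar (i + 1)) * f)

/-- `IsDoubleGroth n w g` says that `g` is obtained as the double Grothendieck polynomial
`𝔊_w(x;a)` of `w ∈ S_n` by the defining recursion: start with
`𝔊_{w₀}(x;a) = ∏_{i+j≤n} (x_i ⊖ a_j)` and put `𝔊_w(x;a) = π_i 𝔊_{w s_i}(x;a)` whenever
`w s_i > w`, that is, whenever `w(i) < w(i+1)`. -/
inductive IsDoubleGroth (n : ℕ) : Equiv.Perm ℤ → XA → Prop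
  | top : IsDoubleGroth n (longest n)
      (∏ i ∈ Finset.Icc (1 : ℤ) n, ∏ j ∈ Finset.Icc (1 : ℤ) (n - i), ominus (xVar i) (aVar j))
  | step (w : Equiv.Perm ℤ) (i : ℤ) (f g : XA) (h1 : 1 ≤ i) (hn : i < n) (hw : w i < w (i + 1))
      (hf : IsDoubleGroth n (w * simpleRefl i) f) (hg : IsDemazure i f g) : IsDoubleGroth n w g

/-- The double Grothendieck polynomial `𝔊_w(x;a)` of `w ∈ S_+ = ⋃ S_n`. -/
def doubleGroth (w : Equiv.Perm ℤ) : XA :=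
  Classical.epsilon fun g => ∃ n, IsDoubleGroth n w g

/-- The polynomial `𝔊_w^{[p,q]}(x;a) = γ^{p-1}(𝔊_{γ^{1-p}(w)}(x;a))` (it does not depend on `q`),
for `w` that moves only integers in `[p,q]`. -/
def intervalGroth (p : ℤ) (w : Equiv.Perm ℤ) : XA :=
  shift (p - 1) (doubleGroth (shiftPerm (1 - p) w))

/-! ### The ring `Λ̂(x‖a)` and its Hopf structure over `𝕊` -/

/-- The `𝕊`-algebra `Λ̂(x‖a)` of formal power series in `e_1(x/a), e_2(x/a), …` with coefficients
in `𝕊`. The variable with index `k : ℕ` is `e_{k+1}(x/a)`. -/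
abbrev Lam : Type := MvPowerSeries ℕ SS

/-- The completed tensor product `Λ̂(x‖a) ⊗̂_𝕊 Λ̂(x‖a)`: formal power series in the elements
`e_k(x/a) ⊗ 1` (index `Sum.inl`) and `1 ⊗ e_k(x/a)` (index `Sum.inr`). -/
abbrev LamLam : Type := MvPowerSeries (ℕ ⊕ ℕ) SS

/-- The element `e_k(x/a)`, with `e_0 = 1`. -/
def elemSym : ℕ → Lam
  | 0 => 1
  | k + 1 => MvPowerSeries.X k

/-- `f ↦ f ⊗ 1`. -/
def inclLeft : Lam →ₐ[SS] LamLam := MvPowerSeries.rename (Function.Embedding.inl : ℕ ↪ ℕ ⊕ ℕ)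

/-- `f ↦ 1 ⊗ f`. -/
def inclRight : Lam →ₐ[SS] LamLam := MvPowerSeries.rename (Function.Embedding.inr : ℕ ↪ ℕ ⊕ ℕ)

/-- `Δ(e_k) = ∑_{i+j=k} e_i ⊗ e_j`. -/
def deltaE (k : ℕ) : LamLam :=
  ∑ ij ∈ Finset.HasAntidiagonal.antidiagonal k, inclLeft (elemSym ij.1) * inclRight (elemSym ij.2)

lemma coeff_inclLeft_elemSym (i : ℕ) (d : ℕ ⊕ ℕ →₀ ℕ)
    (h : MvPowerSeries.coeff d (inclLeft (elemSym i)) ≠ 0) :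
    d.sum (fun t m => m * (Sum.elim id id t + 1)) = i := by
  classical
  cases i with
  | zero =>
    simp only [elemSym, map_one, MvPowerSeries.coeff_one] at h
    have : d = 0 := by by_contra h'; simp [h'] at h
    simp [this]
  | succ i =>
    simp only [elemSym, inclLeft, MvPowerSeries.rename_X, MvPowerSeries.coeff_X,
      Function.Embedding.inl_apply] at h
    have : d = Finsupp.single (Sum.inl i) 1 := by by_contra h'; simp [h'] at h
    simp [this]

lemma coeff_inclRight_elemSym (i : ℕ) (d : ℕ ⊕ ℕ →₀ ℕ)
    (h : MvPowerSeries.coeff d (inclRight (elemSym i)) ≠ 0) :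
    d.sum (fun t m => m * (Sum.elim id id t + 1)) = i := by
  classical
  cases i with
  | zero =>
    simp only [elemSym, map_one, MvPowerSeries.coeff_one] at h
    have : d = 0 := by by_contra h'; simp [h'] at h
    simp [this]
  | succ i =>
    simp only [elemSym, inclRight, MvPowerSeries.rename_X, MvPowerSeries.coeff_X,
      Function.Embedding.inr_apply] at h
    have : d = Finsupp.single (Sum.inr i) 1 := by by_contra h'; simp [h'] at h
    simp [this]

lemma coeff_deltaE (k : ℕ) (d : ℕ ⊕ ℕ →₀ ℕ) (h : MvPowerSeries.coeff d (deltaE k) ≠ 0) :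
    d.sum (fun t m => m * (Sum.elim id id t + 1)) = k := by
  classical
  rw [deltaE, map_sum] at h
  obtain ⟨ij, hij, h⟩ := Finset.exists_ne_zero_of_sum_ne_zero h
  rw [MvPowerSeries.coeff_mul] at h
  obtain ⟨uv, huv, h⟩ := Finset.exists_ne_zero_of_sum_ne_zero h
  have h1 := coeff_inclLeft_elemSym _ _ (left_ne_zero_of_mul h)
  have h2 := coeff_inclRight_elemSym _ _ (right_ne_zero_of_mul h)
  rw [Finset.HasAntidiagonal.mem_antidiagonal] at hij huv
  rw [← huv, Finsupp.sum_add_index' (by simp) (by intros; ring), h1, h2, hij]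

lemma hasSubst_deltaE : MvPowerSeries.HasSubst (fun k : ℕ => deltaE (k + 1)) where
  const_coeff k := by
    have : MvPowerSeries.constantCoeff (deltaE (k + 1)) = 0 := by
      by_contra h
      have := coeff_deltaE (k + 1) 0 (by simpa using h)
      simp at this
    simp [this]
  coeff_zero d := by
    refine (Set.finite_le_nat (d.sum fun t m => m * (Sum.elim id id t + 1))).subset ?_
    intro k hk
    have := coeff_deltaE (k + 1) d hk
    simp only [Set.mem_ofPred_eq]
    omega

/-- The comultiplication `Δ` of `Λ̂(x‖a)` over `𝕊`: the (continuous) `𝕊`-algebra homomorphism with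
`Δ(e_k) = ∑_{i+j=k} e_i ⊗ e_j`; equivalently, all power sums `p_k(x‖a)` are primitive. -/
def Delta : Lam →ₐ[SS] LamLam := MvPowerSeries.substAlgHom hasSubst_deltaE

/-- The power sums `p_k(x‖a)`, `k ≥ 1`, defined from the `e_k` by Newton's identities
`∑_{k≥1} (-1)^{k-1} p_k t^k = t E'(t) / E(t)` with `E(t) = ∑_k e_k t^k`. -/
def powerSum (k : ℕ) : Lam :=
  (-1) ^ (k + 1) * PowerSeries.coeff k (PowerSeries.X *
    PowerSeries.derivative Lam (PowerSeries.mk elemSym) *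
      PowerSeries.invOfUnit (PowerSeries.mk elemSym) 1)

/-- The power sums are primitive for `Delta`. -/
lemma Delta_powerSum (k : ℕ) :
    Delta (powerSum k) = inclLeft (powerSum k) + inclRight (powerSum k) := by
  set E : PowerSeries Lam := PowerSeries.mk elemSym with hE
  set P : PowerSeries Lam := PowerSeries.X * PowerSeries.derivative Lam E * PowerSeries.invOfUnit E 1 with hP
  have hEu : E * PowerSeries.invOfUnit E 1 = 1 := by
    apply PowerSeries.mul_invOfUnit
    simp [hE, ← PowerSeries.coeff_zero_eq_constantCoeff_apply, elemSym]
  have hEP : E * P = PowerSeries.X * PowerSeries.derivative Lam E := by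
    rw [hP, mul_left_comm, hEu, mul_one]
  have hmap : ∀ φ : Lam →+* LamLam, PowerSeries.map φ E * PowerSeries.map φ P =
      PowerSeries.X * PowerSeries.derivative LamLam (PowerSeries.map φ E) := by
    intro φ
    rw [← map_mul, hEP, map_mul, PowerSeries.map_X]
    congr 1
    ext1 n
    simp only [PowerSeries.coeff_map, PowerSeries.coeff_derivative, map_mul, map_add, map_natCast,
      map_one]
  have hD : PowerSeries.map (Delta : Lam →+* LamLam) E =
      PowerSeries.map (inclLeft : Lam →+* LamLam) E *
        PowerSeries.map (inclRight : Lam →+* LamLam) E := by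
    ext1 n
    rw [PowerSeries.coeff_mul]
    simp only [PowerSeries.coeff_map, hE, PowerSeries.coeff_mk]
    cases n with
    | zero => simp [elemSym]
    | succ n =>
      change Delta (MvPowerSeries.X n) = deltaE (n + 1)
      rw [Delta, MvPowerSeries.substAlgHom_X]
  have h1 := hmap (Delta : Lam →+* LamLam)
  have h2 := hmap (inclLeft : Lam →+* LamLam)
  have h3 := hmap (inclRight : Lam →+* LamLam)
  have hu : IsUnit (PowerSeries.map (Delta : Lam →+* LamLam) E) :=
    (IsUnit.of_mul_eq_one _ hEu).map _
  have key : PowerSeries.map (Delta : Lam →+* LamLam) P =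
      PowerSeries.map (inclLeft : Lam →+* LamLam) P +
        PowerSeries.map (inclRight : Lam →+* LamLam) P := by
    apply hu.mul_left_cancel
    rw [h1, hD, Derivation.leibniz, smul_eq_mul, smul_eq_mul]
    linear_combination (-PowerSeries.map (inclRight : Lam →+* LamLam) E) * h2 -
      PowerSeries.map (inclLeft : Lam →+* LamLam) E * h3
  have := congrArg (PowerSeries.coeff k) key
  simp only [PowerSeries.coeff_map, map_add] at this
  simp only [powerSum, map_mul, map_pow, map_neg, map_one, ← hE, ← hP, ← mul_add]
  exact congrArg _ this

/-- The counit `ε_a` of `Λ̂(x‖a)` over `𝕊`, which sends all `e_k` (equivalently, all `p_k(x‖a)`),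
`k ≥ 1`, to `0`. -/
def counit : Lam →+* SS := MvPowerSeries.constantCoeff

/-! ### Realisation of the double back stable ring by power series -/

open Classical in
/-- The elementary symmetric series `e_k(x_-)` in the variables `x_i`, `i ≤ 0`. -/
def eX (k : ℕ) : XA := fun d =>
  if (∀ i : ℤ, d (Sum.inr i) = 0) ∧ (∀ i : ℤ, 0 < i → d (Sum.inl i) = 0) ∧
    (∀ i : ℤ, d (Sum.inl i) ≤ 1) ∧ d.degree = k then 1 else 0

open Classical in
/-- The complete homogeneous symmetric series `h_k(a_-)` in the variables `a_i`, `i ≤ 0`. -/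
def hA (k : ℕ) : XA := fun d =>
  if (∀ i : ℤ, d (Sum.inl i) = 0) ∧ (∀ i : ℤ, 0 < i → d (Sum.inr i) = 0) ∧ d.degree = k
    then 1 else 0

/-- The super elementary symmetric series
`e_k(x/a) = ∑_{i+j=k} (-1)^j e_i(x_-) h_j(a_-)`, i.e. the coefficient of `t^k` in
`∏_{i≤0} (1 + x_i t) / (1 + a_i t)`; this corresponds to `p_k(x/a) = p_k(x_-) - p_k(a_-)`. -/
def superE (k : ℕ) : XA :=
  ∑ ij ∈ Finset.HasAntidiagonal.antidiagonal k, (-1) ^ ij.2 * (eX ij.1 * hA ij.2)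

lemma coeff_superE (k : ℕ) (d : ℤ ⊕ ℤ →₀ ℕ) (h : MvPowerSeries.coeff d (superE k) ≠ 0) :
    d.degree = k := by
  classical
  rw [superE, map_sum] at h
  obtain ⟨ij, hij, h⟩ := Finset.exists_ne_zero_of_sum_ne_zero h
  have h' : MvPowerSeries.coeff d (eX ij.1 * hA ij.2) ≠ 0 := by
    intro h0
    rcases neg_one_pow_eq_or XA ij.2 with h1 | h1 <;> rw [h1] at h <;> simp [h0] at h
  rw [MvPowerSeries.coeff_mul] at h'
  obtain ⟨uv, huv, h'⟩ := Finset.exists_ne_zero_of_sum_ne_zero h'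
  have h1 : eX ij.1 uv.1 ≠ 0 := left_ne_zero_of_mul h'
  have h2 : hA ij.2 uv.2 ≠ 0 := right_ne_zero_of_mul h'
  rw [Finset.HasAntidiagonal.mem_antidiagonal] at hij huv
  have h1' : uv.1.degree = ij.1 := by
    by_contra hc
    exact h1 (if_neg fun hh => hc hh.2.2.2)
  have h2' : uv.2.degree = ij.2 := by
    by_contra hc
    exact h2 (if_neg fun hh => hc hh.2.2)
  rw [← huv, map_add, h1', h2', hij]

section Realisation

open scoped MvPowerSeries.WithPiTopology

lemma hasEval_superE : MvPowerSeries.HasEval (fun k : ℕ => superE (k + 1)) where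
  hpow k := by
    refine MvPowerSeries.WithPiTopology.isTopologicallyNilpotent_of_constantCoeff_zero ?_
    by_contra h
    have := coeff_superE (k + 1) 0 (by simpa using h)
    simp at this
  tendsto_zero := by
    rw [MvPowerSeries.WithPiTopology.tendsto_iff_coeff_tendsto]
    intro d
    refine tendsto_nhds_of_eventually_eq ?_
    refine (Set.finite_le_nat d.degree).subset ?_
    intro k hk
    have hk' : MvPowerSeries.coeff d (superE (k + 1)) ≠ 0 := by simpa using hk
    have := coeff_superE (k + 1) d hk'
    simp only [Set.mem_ofPred_eq]
    omega

lemma continuous_inclA : Continuous (algebraMap SS XA) := by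
  rw [continuous_iff_continuousAt]
  intro f
  unfold ContinuousAt
  rw [MvPowerSeries.WithPiTopology.tendsto_iff_coeff_tendsto]
  intro d
  by_cases hd : ∃ d', d = Finsupp.embDomain Function.Embedding.inr d'
  · obtain ⟨d', rfl⟩ := hd
    have h : ∀ g : SS, MvPowerSeries.coeff (Finsupp.embDomain Function.Embedding.inr d')
        (algebraMap SS XA g) = MvPowerSeries.coeff d' g := fun g =>
      MvPowerSeries.coeff_embDomain_rename (Function.Embedding.inr : ℤ ↪ ℤ ⊕ ℤ) g d'
    simp only [h]
    exact (MvPowerSeries.WithPiTopology.continuous_coeff ℤ d').tendsto f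
  · have h : ∀ g : SS, MvPowerSeries.coeff d (algebraMap SS XA g) = 0 := fun g => by
      refine MvPowerSeries.coeff_rename_eq_zero _ g ?_
      rintro ⟨d', rfl⟩
      exact hd ⟨d', by rw [Finsupp.embDomain_eq_mapDomain]⟩
    simp only [h]
    exact tendsto_const_nhds

/-- The realisation of `Λ̂(x‖a)` in `ℤ[[x, a]]`: the continuous `𝕊`-algebra homomorphism that
sends (the variable) `e_k(x/a)` to the series `e_k(x/a)`. -/
def realizeLam : Lam →ₐ[SS] XA where
  toRingHom := MvPowerSeries.eval₂Hom continuous_inclA hasEval_superE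
  commutes' r := by
    change MvPowerSeries.eval₂Hom continuous_inclA hasEval_superE (MvPowerSeries.C r) = _
    rw [MvPowerSeries.coe_eval₂Hom, MvPowerSeries.eval₂_C]

end Realisation

/-- The double back stable ring `Λ̂(x‖a) ⊗_{R(a)} R(x;a)`. -/
abbrev BackStable : Type := Lam ⊗[Ra] Rxa

/-- The realisation of the double back stable ring by power series in `x` and `a`. -/
def realize : BackStable →ₐ[SS] XA :=
  Algebra.TensorProduct.lift realizeLam Rxa.val fun _ _ => Commute.all _ _

instance : Filter.TendstoCofinite (Sum.elim id id : ℤ ⊕ ℤ → ℤ) := by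
  rw [Filter.tendstoCofinite_iff_finite_preimage_singleton]
  intro b
  refine (Set.toFinite {Sum.inl b, Sum.inr b}).subset ?_
  rintro (i | i) h
  · exact Or.inl (congrArg Sum.inl h)
  · exact Or.inr (congrArg Sum.inr h)

/-- The substitution `x_i ↦ a_i`, `a_i ↦ a_i`. -/
def diag : XA →ₐ[SS] SS where
  toRingHom := (MvPowerSeries.rename (R := ℤ) (Sum.elim id id : ℤ ⊕ ℤ → ℤ)).toRingHom
  commutes' r := by
    change MvPowerSeries.rename _ (MvPowerSeries.rename _ r) = r
    rw [MvPowerSeries.rename_rename]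
    exact MvPowerSeries.rename_id_apply r

/-- The `𝕊`-algebra homomorphism `η_a : Λ̂(x‖a) ⊗ R(x;a) → Λ̂(x‖a)` which is the identity on
`Λ̂(x‖a)` and sends `x_i` to `a_i`. -/
def eta : BackStable →ₐ[SS] Lam :=
  Algebra.TensorProduct.lift (AlgHom.id SS Lam)
    (((Algebra.ofId SS Lam).comp diag).restrictScalars Ra |>.comp Rxa.val)
    fun _ _ => Commute.all _ _

/-- `F` is the back stable double Grothendieck polynomial of `w`, that is, the limit of the
polynomials `𝔊_w^{[p,q]}(x;a)` for `p → -∞` and `q → ∞` (each coefficient is eventually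
constant). -/
def IsBackStableLimit (w : Equiv.Perm ℤ) (F : BackStable) : Prop :=
  ∀ d, ∀ᶠ p in Filter.atBot,
    MvPowerSeries.coeff d (intervalGroth p w) = MvPowerSeries.coeff d (realize F)

/-- The back stable double Grothendieck polynomial of `w`. -/
def backStableGroth (w : Equiv.Perm ℤ) : BackStable :=
  Classical.epsilon (IsBackStableLimit w)

/-- The double `K`-Stanley function `G_w(x‖a) = η_a(𝔊⃖_w(x;a))`. -/
def doubleKStanley (w : Equiv.Perm ℤ) : Lam := eta (backStableGroth w)

/-- The Grassmannian double `K`-Stanley function `G_λ(x‖a) = G_{w_λ}(x‖a)`. -/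
def grassKStanley (μ : YoungDiagram) : Lam := doubleKStanley (grassmannianPerm μ)

/-- `Γ(x‖a)`, the `R(a)`-span of the functions `G_λ(x‖a)` in `Λ̂(x‖a)`. -/
def Gam : Submodule Ra Lam := Submodule.span Ra (Set.range grassKStanley)

/-- For an `R(a)`-subalgebra `A` of `Λ̂(x‖a)`, the natural map
`A ⊗_{R(a)} A → Λ̂(x‖a) ⊗̂_𝕊 Λ̂(x‖a)`, `f ⊗ g ↦ f ⊗ g`. -/
def tensorIncl (A : Subalgebra Ra Lam) : A ⊗[Ra] A →ₐ[Ra] LamLam :=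
  Algebra.TensorProduct.productMap
    ((inclLeft.restrictScalars Ra).comp A.val)
    ((inclRight.restrictScalars Ra).comp A.val)

end DoubleKStanley

end

open DoubleKStanley

noncomputable section
namespace DoubleKStanley

open MvPowerSeries

/-! ### Continuous evaluation of power series over `𝕊` -/

/-! An element f of Λ̂(x‖a) is studied through its values f(E) = `ev E f` at formal alphabets,
encoded by their generating series E(t) = ∑ e_k t^k with e_k of order at least k. These form a group
`Point`, and the coproduct becomes its multiplication: (Δf)(E, E') = f(EE') by `ev₂_Delta`. The
counit is the value at E = 1 (`ev_one`).

Write u = 1 - x. The functions G_λ are shown to be Jacobi–Trudi determinants `partDet λ`, defined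
directly in Λ̂(x‖a). Their entries are built from moments, which at a finite alphabet (x / b, c)
become ψ ∑_l w_l u_l^z for every integer z. They are coefficients of series made from E(-1/(1-t))
and E(-t), and the power sum form is a partial fraction expansion. The bialternant formula
`ev_detLam_mul_det_powers` evaluates determinants of such entries. It gives `ev_superAlph_partDet`:
for every n at least the number of rows of λ, the value of `partDet λ` at (x_1, …, x_n / a_0, …,
a_{1-n}) is a ratio of alternants det(u_l^i ∏_m (x_l ⊖ a_m)) / det(u_l^i).

Membership in the span of the determinants is decided by `mem_span_partDet`. It suffices that f has
a pole of order at most r in each denominator letter y, located at y = 1 and absent at infinity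
(`BoundedPole`), and that the values of f at (x_1, …, x_r / a_0, …, a_{1-r}) are polynomials in the
u_l over R(a). Indeed a symmetric polynomial times the Vandermonde determinant is a combination of
alternants, and `map_mem_of_bracket` rewrites every alternant by those of partitions, because each 1
- a_m is a unit of R(a). Values with r letters determine f (`eq_zero_of_ev`): a polynomial of degree
at most r with more than r zeros vanishes, so more letters may be added; since the a_m tend to 0,
arbitrary finite alphabets are reached as limits; and elementary symmetric polynomials are
algebraically independent.

Both conditions survive products once r is large, so the span is an algebra. For the coproduct
(`Delta_partDet`), one alphabet has denominators a_0, a_{-1}, … and the other a_1, a_2, …; the value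
is then a polynomial symmetric in each set of letters separately, hence a combination of products of
two alternants. Localization at x_l = a_{λ_l - l} is triangular for inclusion of partitions, which
gives linear independence, injectivity of the tensor map, and separation of elements of tensor
powers by values. The bialgebra axioms thereby reduce to the group laws of `Point`.

It remains to see that G_λ = `partDet λ`. Alternating sums weighted by ∏ (1 - x_{l+1})^l are
unchanged by isobaric divided differences (`IsDemazure.altX_eq`), so the polynomial of a
Grassmannian permutation inherits a determinantal formula from a dominant permutation, whose
polynomial is a product (`isDoubleGroth_codeProd`). Hence the polynomial in x_{-m}, …, x_0 is the
value of `partDet λ` at (x_{-m}, …, x_0 / a_{-m}, …, a_0), and `partDet λ ⊗ 1` is a back stable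
limit. The limit is unique by `realize_injective`, and η_a fixes the first tensor factor. -/

/-- The power series without constant term. -/
abbrev MaxId : Type := {x : XA // constantCoeff x = 0}

/-- The `k`-th coefficient has order at least `k`, and the constant term is `1`. -/
def Decays (E : PowerSeries XA) : Prop :=
  PowerSeries.coeff 0 E = 1 ∧ ∀ k : ℕ, (k : ℕ∞) ≤ (PowerSeries.coeff k E).order

lemma Decays.one : Decays 1 := by
  refine ⟨by simp, fun k => ?_⟩
  rw [PowerSeries.coeff_one]
  split_ifs with h
  · simp [h]
  · simp

lemma Decays.mul {E F : PowerSeries XA} (hE : Decays E) (hF : Decays F) : Decays (E * F) := by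
  refine ⟨?_, fun k => ?_⟩
  · have := hE.1; have := hF.1
    simp_all
  · apply le_order
    intro d hd
    rw [PowerSeries.coeff_mul, map_sum]
    refine Finset.sum_eq_zero fun ij hij => ?_
    apply coeff_of_lt_order
    rw [Finset.HasAntidiagonal.mem_antidiagonal] at hij
    have h1 : ((ij.1 + ij.2 : ℕ) : ℕ∞) ≤ (PowerSeries.coeff ij.1 E).order +
        (PowerSeries.coeff ij.2 F).order := by
      push_cast
      exact add_le_add (hE.2 _) (hF.2 _)
    rw [hij] at h1
    exact lt_of_lt_of_le hd (h1.trans le_order_mul)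

/-- The group of points at which elements of `Λ̂(x‖a)` are evaluated: the generating series
`∑ e_k t^k` of formal alphabets. -/
def pointSubgroup : Subgroup (PowerSeries XA)ˣ where
  carrier := {E | Decays E ∧ Decays (E⁻¹ : (PowerSeries XA)ˣ)}
  mul_mem' := by
    rintro E F ⟨h1, h2⟩ ⟨h3, h4⟩
    refine ⟨by simpa using h1.mul h3, by simpa [mul_inv_rev] using h4.mul h2⟩
  one_mem' := ⟨Decays.one, by simpa using Decays.one⟩
  inv_mem' := by
    rintro E ⟨h1, h2⟩
    exact ⟨h2, by simpa using h1⟩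

/-- The type of points at which elements of `Λ̂(x‖a)` are evaluated. -/
def Point : Type := pointSubgroup

instance : CommGroup Point := inferInstanceAs (CommGroup pointSubgroup)

/-- The generating series of a point. -/
def Point.ser (E : Point) : PowerSeries XA := (E.1 : (PowerSeries XA)ˣ)

@[simp] lemma Point.ser_mul (E F : Point) : (E * F).ser = E.ser * F.ser := rfl

@[simp] lemma Point.ser_one : (1 : Point).ser = 1 := rfl

lemma Point.decays (E : Point) : Decays E.ser := E.2.1

@[simp] lemma Point.coeff_zero_ser (E : Point) : PowerSeries.coeff 0 E.ser = 1 := E.decays.1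

lemma one_add_mul_mk (x : XA) :
    (1 + PowerSeries.C x * PowerSeries.X) * PowerSeries.mk (fun k => (-x) ^ k) = 1 := by
  ext1 n
  rw [add_mul, one_mul, mul_assoc, map_add, PowerSeries.coeff_C_mul]
  cases n with
  | zero => simp
  | succ n =>
    rw [PowerSeries.coeff_succ_X_mul, PowerSeries.coeff_mk, PowerSeries.coeff_mk,
      PowerSeries.coeff_one, if_neg (Nat.succ_ne_zero n)]
    ring

/-- The point `1 + x t`. -/
def pt (x : MaxId) : Point :=
  ⟨⟨1 + PowerSeries.C x.1 * PowerSeries.X, PowerSeries.mk (fun k => (-x.1) ^ k),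
    one_add_mul_mk _, by rw [mul_comm, one_add_mul_mk]⟩, by
    have hx : (1 : ℕ∞) ≤ x.1.order := one_le_order_iff_constCoeff_eq_zero.2 x.2
    constructor
    · refine ⟨by simp, fun k => ?_⟩
      simp only [map_add, PowerSeries.coeff_C_mul, PowerSeries.coeff_one, PowerSeries.coeff_X]
      rcases k with _ | _ | k
      · simp
      · simpa using hx
      · simp
    · refine ⟨by simp, fun k => ?_⟩
      simp only [Units.inv_mk, PowerSeries.coeff_mk]
      exact le_order_pow_of_constantCoeff_eq_zero k (by simp [x.2])⟩

@[simp] lemma pt_ser (x : MaxId) : (pt x).ser = 1 + PowerSeries.C x.1 * PowerSeries.X := rfl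

lemma pt_inv_ser (x : MaxId) : ((pt x)⁻¹).ser = PowerSeries.mk fun k => (-x.1) ^ k := rfl

section Evaluation

open scoped MvPowerSeries.WithPiTopology

variable {ι : Type}

/-- The coefficient at a monomial d involves only indices of weight at most the degree of d, and
there are finitely many of these. -/
lemma hasEval_of_order (e : ι → XA) (w : ι → ℕ) (hw : ∀ n, {i | w i ≤ n}.Finite)
    (hpos : ∀ i, 0 < w i) (he : ∀ i, (w i : ℕ∞) ≤ (e i).order) : HasEval e where
  hpow i := by
    refine MvPowerSeries.WithPiTopology.isTopologicallyNilpotent_of_constantCoeff_zero ?_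
    rw [← one_le_order_iff_constCoeff_eq_zero]
    refine le_trans ?_ (he i)
    exact_mod_cast hpos i
  tendsto_zero := by
    rw [MvPowerSeries.WithPiTopology.tendsto_iff_coeff_tendsto]
    intro d
    refine tendsto_nhds_of_eventually_eq ?_
    refine (hw d.degree).subset ?_
    intro i hi
    by_contra hlt
    simp only [Set.mem_ofPred_eq, not_le] at hlt
    apply hi
    simp only [Set.mem_ofPred_eq, map_zero]
    exact coeff_of_lt_order (lt_of_lt_of_le (by exact_mod_cast hlt) (he i))

/-- Evaluation of power series over `𝕊` in `ℤ[[x, a]]`. -/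
def evalSeries (e : ι → XA) (he : HasEval e) : MvPowerSeries ι SS →ₐ[SS] XA where
  toRingHom := MvPowerSeries.eval₂Hom continuous_inclA he
  commutes' r := by
    change MvPowerSeries.eval₂Hom continuous_inclA he (MvPowerSeries.C r) = _
    rw [MvPowerSeries.coe_eval₂Hom, MvPowerSeries.eval₂_C]

lemma coe_evalSeries (e : ι → XA) (he : HasEval e) :
    ⇑(evalSeries e he) = MvPowerSeries.eval₂ (algebraMap SS XA) e := by
  change ⇑(MvPowerSeries.eval₂Hom continuous_inclA he) = _
  rw [MvPowerSeries.coe_eval₂Hom]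

lemma continuous_evalSeries (e : ι → XA) (he : HasEval e) : Continuous (evalSeries e he) := by
  rw [coe_evalSeries]
  exact continuous_eval₂ continuous_inclA he

@[simp] lemma evalSeries_X (e : ι → XA) (he : HasEval e) (i : ι) : evalSeries e he (X i) = e i := by
  rw [coe_evalSeries, eval₂_X]

lemma algHom_coe_eq (φ : MvPowerSeries ι SS →ₐ[SS] XA) (p : MvPolynomial ι SS) :
    φ (p : MvPowerSeries ι SS) = MvPolynomial.aeval (fun i => φ (X i)) p := by
  have : φ.comp (MvPolynomial.coeToMvPowerSeries.algHom SS) =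
      MvPolynomial.aeval (fun i => φ (X i)) := by
    apply MvPolynomial.algHom_ext
    intro i
    simp [MvPolynomial.coeToMvPowerSeries.algHom_apply]
  have h2 := DFunLike.congr_fun this p
  rw [← h2]
  simp [MvPolynomial.coeToMvPowerSeries.algHom_apply]

/-- Continuous `𝕊`-algebra homomorphisms are determined by the images of the variables. -/
lemma algHom_eq_of_continuous {φ ψ : MvPowerSeries ι SS →ₐ[SS] XA} (hφ : Continuous φ)
    (hψ : Continuous ψ) (h : ∀ i, φ (X i) = ψ (X i)) : φ = ψ := by
  apply DFunLike.ext'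
  refine (WithPiTopology.denseRange_toMvPowerSeries (σ := ι) (R := SS)).equalizer hφ hψ ?_
  funext p
  change φ (p : MvPowerSeries ι SS) = ψ (p : MvPowerSeries ι SS)
  rw [algHom_coe_eq, algHom_coe_eq]
  simp only [h]

/-- The ideal of series whose coefficients vanish at all `d' ≤ d`. -/
def truncIdeal (d : ℤ ⊕ ℤ →₀ ℕ) : Ideal XA where
  carrier := {f | ∀ d' ≤ d, coeff d' f = 0}
  add_mem' := by
    intro f g hf hg d' hd
    rw [map_add, hf d' hd, hg d' hd, add_zero]
  zero_mem' := fun d' _ => by simp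
  smul_mem' := by
    intro c f hf d' hd
    classical
    rw [smul_eq_mul, coeff_mul]
    refine Finset.sum_eq_zero fun ij hij => ?_
    rw [Finset.HasAntidiagonal.mem_antidiagonal] at hij
    rw [hf ij.2 (le_trans (hij ▸ le_add_self) hd), mul_zero]

lemma mem_truncIdeal {d : ℤ ⊕ ℤ →₀ ℕ} {f : XA} :
    f ∈ truncIdeal d ↔ ∀ d' ≤ d, coeff d' f = 0 := Iff.rfl

lemma eq_zero_of_mem_truncIdeal {f : XA} (h : ∀ d, f ∈ truncIdeal d) : f = 0 := by
  ext d
  simpa using h d d le_rfl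

/-- Continuous homomorphisms that are congruent on the variables are congruent. -/
lemma algHom_congr_of_continuous {φ ψ : MvPowerSeries ι SS →ₐ[SS] XA} (hφ : Continuous φ)
    (hψ : Continuous ψ) (d : ℤ ⊕ ℤ →₀ ℕ) (h : ∀ i, φ (X i) - ψ (X i) ∈ truncIdeal d)
    (f : MvPowerSeries ι SS) : φ f - ψ f ∈ truncIdeal d := by
  have hclosed : IsClosed {f | φ f - ψ f ∈ truncIdeal d} := by
    have : {f | φ f - ψ f ∈ truncIdeal d} = ⋂ d' : {d' // d' ≤ d},
        (fun f => coeff d'.1 (φ f - ψ f)) ⁻¹' {0} := by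
      ext f
      simp [mem_truncIdeal]
    rw [this]
    refine isClosed_iInter fun d' => IsClosed.preimage ?_ isClosed_singleton
    exact (WithPiTopology.continuous_coeff ℤ d'.1).comp (hφ.sub hψ)
  refine (WithPiTopology.denseRange_toMvPowerSeries (σ := ι) (R := SS)).induction_on
    (p := fun f => φ f - ψ f ∈ truncIdeal d) f hclosed ?_
  intro p
  have hq : ((Ideal.Quotient.mkₐ SS (truncIdeal d)).comp φ).comp
        (MvPolynomial.coeToMvPowerSeries.algHom SS) =
      ((Ideal.Quotient.mkₐ SS (truncIdeal d)).comp ψ).comp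
        (MvPolynomial.coeToMvPowerSeries.algHom SS) := by
    apply MvPolynomial.algHom_ext
    intro i
    simp only [AlgHom.coe_comp, Function.comp_apply, MvPolynomial.coeToMvPowerSeries.algHom_apply,
      MvPolynomial.coe_X, Algebra.algebraMap_self, MvPowerSeries.map_id, RingHom.id_apply]
    exact Ideal.Quotient.eq.2 (h i)
  have := DFunLike.congr_fun hq p
  simp only [AlgHom.coe_comp, Function.comp_apply, MvPolynomial.coeToMvPowerSeries.algHom_apply,
      Algebra.algebraMap_self, MvPowerSeries.map_id, RingHom.id_apply] at this
  exact Ideal.Quotient.eq.1 this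

lemma continuous_realizeLam : Continuous realizeLam := by
  change Continuous ⇑(MvPowerSeries.eval₂Hom continuous_inclA hasEval_superE)
  rw [MvPowerSeries.coe_eval₂Hom]
  exact continuous_eval₂ continuous_inclA hasEval_superE

@[simp] lemma realizeLam_X (k : ℕ) : realizeLam (X k) = superE (k + 1) := by
  change MvPowerSeries.eval₂Hom continuous_inclA hasEval_superE (X k) = _
  rw [MvPowerSeries.coe_eval₂Hom, eval₂_X]

lemma hasEval_point (E : Point) : HasEval fun k : ℕ => PowerSeries.coeff (k + 1) E.ser :=
  hasEval_of_order _ (fun k => k + 1) (fun n => (Set.finite_le_nat n).subset fun i hi => by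
    simp only [Set.mem_ofPred_eq] at hi ⊢; omega) (fun k => Nat.succ_pos k)
    fun k => E.decays.2 (k + 1)

lemma hasEval_point_pair (E E' : Point) : HasEval (Sum.elim
    (fun k : ℕ => PowerSeries.coeff (k + 1) E.ser)
    (fun k : ℕ => PowerSeries.coeff (k + 1) E'.ser)) :=
  hasEval_of_order _ (fun k => Sum.elim id id k + 1) (fun n => by
    refine (((Set.finite_le_nat n).image Sum.inl).union
      ((Set.finite_le_nat n).image Sum.inr)).subset ?_
    rintro (i | i) hi
    · simp only [Set.mem_ofPred_eq, Sum.elim_inl, id] at hi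
      exact Or.inl ⟨i, by simp only [Set.mem_ofPred_eq]; omega, rfl⟩
    · simp only [Set.mem_ofPred_eq, Sum.elim_inr, id] at hi
      exact Or.inr ⟨i, by simp only [Set.mem_ofPred_eq]; omega, rfl⟩)
    (fun k => Nat.succ_pos _) (by
      rintro (k | k)
      · exact E.decays.2 (k + 1)
      · exact E'.decays.2 (k + 1))

/-- Evaluation of an element of `Λ̂(x‖a)` at a point. -/
def ev (E : Point) : Lam →ₐ[SS] XA := evalSeries _ (hasEval_point E)

/-- Evaluation of an element of the completed tensor square at a pair of points. -/
def ev₂ (E E' : Point) : LamLam →ₐ[SS] XA := evalSeries _ (hasEval_point_pair E E')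

lemma continuous_ev (E : Point) : Continuous (ev E) := continuous_evalSeries _ _

lemma continuous_ev₂ (E E' : Point) : Continuous (ev₂ E E') := continuous_evalSeries _ _

@[simp] lemma ev_X (E : Point) (k : ℕ) : ev E (X k) = PowerSeries.coeff (k + 1) E.ser :=
  evalSeries_X _ _ _

@[simp] lemma ev₂_X_inl (E E' : Point) (k : ℕ) :
    ev₂ E E' (X (Sum.inl k)) = PowerSeries.coeff (k + 1) E.ser := evalSeries_X _ _ _

@[simp] lemma ev₂_X_inr (E E' : Point) (k : ℕ) :
    ev₂ E E' (X (Sum.inr k)) = PowerSeries.coeff (k + 1) E'.ser := evalSeries_X _ _ _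

@[simp] lemma ev_elemSym (E : Point) (k : ℕ) : ev E (elemSym k) = PowerSeries.coeff k E.ser := by
  cases k with
  | zero => simp only [elemSym, map_one, Point.coeff_zero_ser]
  | succ k => exact ev_X E k

lemma continuous_rename_embedding {σ τ : Type} (e : σ ↪ τ) :
    Continuous (MvPowerSeries.rename (R := SS) e) := by
  rw [continuous_iff_continuousAt]
  intro f
  unfold ContinuousAt
  rw [MvPowerSeries.WithPiTopology.tendsto_iff_coeff_tendsto]
  intro d
  by_cases hd : ∃ d', d = Finsupp.embDomain e d'
  · obtain ⟨d', rfl⟩ := hd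
    simp only [MvPowerSeries.coeff_embDomain_rename]
    exact (MvPowerSeries.WithPiTopology.continuous_coeff SS d').tendsto f
  · have h : ∀ g : MvPowerSeries σ SS, MvPowerSeries.coeff d (MvPowerSeries.rename e g) = 0 :=
      fun g => by
      refine MvPowerSeries.coeff_rename_eq_zero _ g ?_
      rintro ⟨d', rfl⟩
      exact hd ⟨d', by rw [Finsupp.embDomain_eq_mapDomain]⟩
    simp only [h]
    exact tendsto_const_nhds

lemma ev₂_inclLeft (E E' : Point) (f : Lam) : ev₂ E E' (inclLeft f) = ev E f := by
  have : (ev₂ E E').comp inclLeft = ev E := by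
    refine algHom_eq_of_continuous ((continuous_ev₂ E E').comp (continuous_rename_embedding _))
      (continuous_ev E) fun i => ?_
    simp [inclLeft, rename_X]
  exact DFunLike.congr_fun this f

lemma ev₂_inclRight (E E' : Point) (f : Lam) : ev₂ E E' (inclRight f) = ev E' f := by
  have : (ev₂ E E').comp inclRight = ev E' := by
    refine algHom_eq_of_continuous ((continuous_ev₂ E E').comp (continuous_rename_embedding _))
      (continuous_ev E') fun i => ?_
    simp [inclRight, rename_X]
  exact DFunLike.congr_fun this f

lemma continuous_Delta : Continuous Delta := by
  rw [continuous_iff_continuousAt]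
  intro f
  unfold ContinuousAt
  rw [MvPowerSeries.WithPiTopology.tendsto_iff_coeff_tendsto]
  intro d
  -- Taking the series with all coefficients equal to 1 makes this finite support contain every
  -- monomial that can contribute to the coefficient at d, uniformly in the series being substituted
  -- into.
  have hfin : (Function.support _).Finite :=
    coeff_subst_finite (R := SS) hasSubst_deltaE (fun _ => (1 : SS)) d
  have hsum : ∀ g : Lam, coeff d (Delta g) = ∑ m ∈ hfin.toFinset, coeff m g •
      coeff d (m.prod fun s e => deltaE (s + 1) ^ e) := by
    intro g
    rw [Delta, substAlgHom_apply, coeff_subst hasSubst_deltaE,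
      finsum_eq_sum_of_support_subset _ (s := hfin.toFinset)]
    intro m hm
    simp only [Set.Finite.coe_toFinset, Function.mem_support] at hm ⊢
    intro h0
    apply hm
    have h1 : coeff m (fun _ => (1 : SS) : Lam) = 1 := rfl
    rw [h1, one_smul] at h0
    rw [h0, smul_zero]
  simp only [hsum]
  refine tendsto_finsetSum _ fun m _ => ?_
  simp only [smul_eq_mul]
  exact Filter.Tendsto.mul_const _ ((WithPiTopology.continuous_coeff SS m).tendsto f)

/-- The formula for Δ(e_k) is the Cauchy product rule for generating series, so Δ turns into
multiplication of alphabets. -/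
lemma ev₂_Delta (E E' : Point) (f : Lam) : ev₂ E E' (Delta f) = ev (E * E') f := by
  have : (ev₂ E E').comp Delta = ev (E * E') := by
    refine algHom_eq_of_continuous ((continuous_ev₂ E E').comp continuous_Delta)
      (continuous_ev _) fun i => ?_
    rw [AlgHom.comp_apply, Delta, substAlgHom_X, ev_X, Point.ser_mul, PowerSeries.coeff_mul,
      deltaE, map_sum]
    simp only [map_mul, ev₂_inclLeft, ev₂_inclRight, ev_elemSym]
  exact DFunLike.congr_fun this f

lemma ev_one (f : Lam) : ev 1 f = algebraMap SS XA (counit f) := by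
  have hc : Continuous (algebraMap SS XA ∘ counit) :=
    continuous_inclA.comp (WithPiTopology.continuous_constantCoeff SS)
  have : ev 1 = { toRingHom := (algebraMap SS XA).comp counit
                  commutes' := fun r => congrArg (algebraMap SS XA) (constantCoeff_C r) } := by
    refine algHom_eq_of_continuous (continuous_ev _) hc fun i => ?_
    rw [ev_X]
    change _ = algebraMap SS XA (constantCoeff (X i))
    simp [PowerSeries.coeff_one]
  exact DFunLike.congr_fun this f

lemma ev_congr {E E' : Point} {d : ℤ ⊕ ℤ →₀ ℕ}
    (h : ∀ k, PowerSeries.coeff k E.ser - PowerSeries.coeff k E'.ser ∈ truncIdeal d) (f : Lam) :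
    ev E f - ev E' f ∈ truncIdeal d :=
  algHom_congr_of_continuous (continuous_ev E) (continuous_ev E') d
    (fun i => by rw [ev_X, ev_X]; exact h (i + 1)) f

lemma ev₂_congr {E₁ E₂ E₁' E₂' : Point} {d : ℤ ⊕ ℤ →₀ ℕ}
    (h : ∀ k, PowerSeries.coeff k E₁.ser - PowerSeries.coeff k E₂.ser ∈ truncIdeal d)
    (h' : ∀ k, PowerSeries.coeff k E₁'.ser - PowerSeries.coeff k E₂'.ser ∈ truncIdeal d)
    (f : LamLam) : ev₂ E₁ E₁' f - ev₂ E₂ E₂' f ∈ truncIdeal d :=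
  algHom_congr_of_continuous (continuous_ev₂ _ _) (continuous_ev₂ _ _) d
    (by rintro (i | i)
        · rw [ev₂_X_inl, ev₂_X_inl]; exact h (i + 1)
        · rw [ev₂_X_inr, ev₂_X_inr]; exact h' (i + 1)) f

lemma realizeLam_congr {E : Point} {d : ℤ ⊕ ℤ →₀ ℕ}
    (h : ∀ k, superE k - PowerSeries.coeff k E.ser ∈ truncIdeal d) (f : Lam) :
    realizeLam f - ev E f ∈ truncIdeal d :=
  algHom_congr_of_continuous continuous_realizeLam (continuous_ev E) d
    (fun i => by rw [realizeLam_X, ev_X]; exact h (i + 1)) f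

/-- The power series `∑ c_k e_{k+1}`. -/
def linSeries (c : ℕ → ℤ) : Lam := fun m =>
  if m.degree = 1 then m.sum (fun k n => (n : SS) * (c k : SS)) else 0

lemma hasSum_linSeries (c : ℕ → ℤ) : HasSum (fun k => (c k : Lam) * X k) (linSeries c) := by
  have h := WithPiTopology.hasSum_of_monomials_self (linSeries c)
  have hinj : Function.Injective fun k : ℕ => Finsupp.single k 1 :=
    Finsupp.single_left_injective one_ne_zero
  rw [← hinj.hasSum_iff] at h
  · convert h using 2 with k
    simp only [Function.comp_apply]
    have : coeff (Finsupp.single k 1) (linSeries c) = (c k : SS) := by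
      change linSeries c _ = _
      simp [linSeries]
    rw [this, X_def, ← map_intCast (C : SS →+* Lam), ← smul_eq_C_mul, ← map_smul, smul_eq_mul, mul_one]
  · intro m hm
    have : coeff m (linSeries c) = 0 := by
      change linSeries c m = 0
      rw [linSeries, if_neg]
      intro h1
      obtain ⟨k, rfl⟩ := (Finsupp.sum_eq_one_iff m).1 h1
      exact hm ⟨k, rfl⟩
    rw [this, map_zero]

lemma hasSum_ev_linSeries (E : Point) (c : ℕ → ℤ) :
    HasSum (fun k => (c k : XA) * PowerSeries.coeff (k + 1) E.ser) (ev E (linSeries c)) := by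
  have := (hasSum_linSeries c).map (ev E) (continuous_ev E)
  convert this using 2 with k
  simp

end Evaluation

end DoubleKStanley
end

noncomputable section
namespace DoubleKStanley

/-! ### Functions on points with bounded poles -/

/-- `Φ` has a pole of order at most `r` in each variable of the denominator alphabet. -/
def BoundedPole (r : ℕ) (Φ : Point → XA) : Prop :=
  ∀ E : Point, ∃ p : Polynomial XA, p.natDegree ≤ r ∧
    ∀ y : MaxId, (1 - y.1) ^ r * Φ (E * (pt y)⁻¹) = p.eval y.1

namespace BoundedPole

variable {r s : ℕ} {Φ Ψ : Point → XA}

lemma const (c : XA) : BoundedPole 0 fun _ => c :=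
  fun _ => ⟨Polynomial.C c, by simp, by simp⟩

lemma mul (hΦ : BoundedPole r Φ) (hΨ : BoundedPole s Ψ) :
    BoundedPole (r + s) fun E => Φ E * Ψ E := by
  intro E
  obtain ⟨p, hp, hp'⟩ := hΦ E
  obtain ⟨q, hq, hq'⟩ := hΨ E
  refine ⟨p * q, Polynomial.natDegree_mul_le.trans (add_le_add hp hq), fun y => ?_⟩
  rw [Polynomial.eval_mul, ← hp', ← hq']
  ring

lemma add (hΦ : BoundedPole r Φ) (hΨ : BoundedPole r Ψ) :
    BoundedPole r fun E => Φ E + Ψ E := by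
  intro E
  obtain ⟨p, hp, hp'⟩ := hΦ E
  obtain ⟨q, hq, hq'⟩ := hΨ E
  refine ⟨p + q, (Polynomial.natDegree_add_le _ _).trans (max_le hp hq), fun y => ?_⟩
  rw [Polynomial.eval_add, ← hp', ← hq']
  ring

lemma const_mul (c : XA) (hΦ : BoundedPole r Φ) : BoundedPole r fun E => c * Φ E := by
  have := (BoundedPole.const c).mul hΦ
  rwa [zero_add] at this

lemma sub (hΦ : BoundedPole r Φ) (hΨ : BoundedPole r Ψ) :
    BoundedPole r fun E => Φ E - Ψ E := by
  have := hΦ.add (hΨ.const_mul (-1))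
  simpa [sub_eq_add_neg] using this

lemma mono (hrs : r ≤ s) (hΦ : BoundedPole r Φ) : BoundedPole s Φ := by
  intro E
  obtain ⟨p, hp, hp'⟩ := hΦ E
  obtain ⟨k, rfl⟩ := Nat.exists_eq_add_of_le hrs
  refine ⟨p * (1 - Polynomial.X) ^ k, ?_, fun y => ?_⟩
  · refine Polynomial.natDegree_mul_le.trans (add_le_add hp ?_)
    refine (Polynomial.natDegree_pow_le).trans ?_
    have : (1 - Polynomial.X : Polynomial XA).natDegree ≤ 1 := by
      refine (Polynomial.natDegree_sub_le _ _).trans ?_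
      simp
    simpa using Nat.mul_le_mul_left k this
  · rw [Polynomial.eval_mul, ← hp', pow_add]
    simp
    ring

lemma zero : BoundedPole r fun _ => 0 := (BoundedPole.const 0).mono (Nat.zero_le r)

lemma sum {ι : Type*} (t : Finset ι) (F : ι → Point → XA) (h : ∀ i ∈ t, BoundedPole r (F i)) :
    BoundedPole r fun E => ∑ i ∈ t, F i E := by
  classical
  induction t using Finset.induction_on with
  | empty => simpa using BoundedPole.zero
  | insert i t hi ih =>
    simp only [Finset.sum_insert hi]
    exact (h i (Finset.mem_insert_self i t)).add
      (ih fun j hj => h j (Finset.mem_insert_of_mem hj))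

lemma prod {ι : Type*} (t : Finset ι) (F : ι → Point → XA) (h : ∀ i ∈ t, BoundedPole 1 (F i)) :
    BoundedPole t.card fun E => ∏ i ∈ t, F i E := by
  classical
  induction t using Finset.induction_on with
  | empty => simpa using BoundedPole.const 1
  | insert i t hi ih =>
    simp only [Finset.prod_insert hi, Finset.card_insert_of_notMem hi]
    rw [add_comm]
    exact (h i (Finset.mem_insert_self i t)).mul
      (ih fun j hj => h j (Finset.mem_insert_of_mem hj))

lemma comp_mul (E₀ : Point) (hΦ : BoundedPole r Φ) : BoundedPole r fun E => Φ (E₀ * E) := by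
  intro E
  obtain ⟨p, hp, hp'⟩ := hΦ (E₀ * E)
  exact ⟨p, hp, fun y => by simpa only [mul_assoc] using hp' y⟩

end BoundedPole

/-! ### Expansion of the generating series at `1` -/

/-- The coefficient of `t^j` in `(1 - t)^{-k}`. -/
def negBinom : ℕ → ℕ → ℤ
  | 0, j => if j = 0 then 1 else 0
  | k + 1, j => (k + j).choose j

lemma negBinom_zero_right (k : ℕ) : negBinom k 0 = 1 := by
  cases k <;> simp [negBinom]

/-- This is the coefficient form of (1 - t) · (1 - t)^{-(k+1)} = (1 - t)^{-k}. -/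
lemma negBinom_succ_succ (k j : ℕ) :
    negBinom (k + 1) (j + 1) = negBinom (k + 1) j + negBinom k (j + 1) := by
  cases k with
  | zero => simp [negBinom]
  | succ k =>
    simp only [negBinom]
    rw [show k + 1 + (j + 1) = (k + 1 + j) + 1 by ring, Nat.choose_succ_succ,
      show k + (j + 1) = k + 1 + j by ring]
    push_cast
    ring

/-- The coefficients of `∑_k (-1)^k e_k (1-t)^{-k}`. -/
def expandOne (j : ℕ) : Lam :=
  (negBinom 0 j : Lam) + linSeries fun k => (-1) ^ (k + 1) * negBinom (k + 1) j

section HasSum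

open scoped MvPowerSeries.WithPiTopology

lemma hasSum_congr_fun {f g : ℕ → XA} {c : XA} (h : ∀ k, f k = g k) :
    HasSum f c ↔ HasSum g c := by
  rw [funext h]

lemma hasSum_ev_expandOne (E : Point) (j : ℕ) :
    HasSum (fun k => (((-1) ^ k * negBinom k j : ℤ) : XA) * PowerSeries.coeff k E.ser)
      (ev E (expandOne j)) := by
  rw [← hasSum_nat_add_iff' 1]
  have h : ev E (expandOne j) - ∑ i ∈ Finset.range 1,
      (((-1) ^ i * negBinom i j : ℤ) : XA) * PowerSeries.coeff i E.ser =
      ev E (linSeries fun k => (-1) ^ (k + 1) * negBinom (k + 1) j) := by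
    rw [Finset.sum_range_one, Point.coeff_zero_ser, expandOne, map_add, map_intCast, pow_zero,
      one_mul, mul_one, add_sub_cancel_left]
  rw [h]
  exact hasSum_ev_linSeries E (fun k => (-1) ^ (k + 1) * negBinom (k + 1) j)

lemma coeff_succ_mul_pt (E : Point) (x : MaxId) (k : ℕ) :
    PowerSeries.coeff (k + 1) (E * pt x).ser =
      PowerSeries.coeff (k + 1) E.ser + x.1 * PowerSeries.coeff k E.ser := by
  rw [Point.ser_mul, pt_ser, mul_add, mul_one, map_add, ← mul_assoc, PowerSeries.coeff_succ_mul_X,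
    PowerSeries.coeff_mul_C, mul_comm (x.1)]

lemma hasSum_expandOne_diff (E : Point) (x : MaxId) (j : ℕ) :
    HasSum (fun k => (((-1) ^ (k + 1) * negBinom (k + 1) j : ℤ) : XA) *
      (x.1 * PowerSeries.coeff k E.ser))
      (ev (E * pt x) (expandOne j) - ev E (expandOne j)) := by
  have h := (hasSum_ev_expandOne (E * pt x) j).sub (hasSum_ev_expandOne E j)
  rw [← hasSum_nat_add_iff' 1] at h
  rw [Finset.sum_range_one, Point.coeff_zero_ser, Point.coeff_zero_ser, sub_self, sub_zero] at h
  refine (hasSum_congr_fun fun k => ?_).2 h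
  rw [coeff_succ_mul_pt]
  ring

lemma ev_expandOne_zero_mul_pt (E : Point) (x : MaxId) :
    ev (E * pt x) (expandOne 0) = (1 - x.1) * ev E (expandOne 0) := by
  have h1 := hasSum_expandOne_diff E x 0
  have h2 := (hasSum_ev_expandOne E 0).mul_left (-x.1)
  have := h1.unique ((hasSum_congr_fun fun k => by
    rw [negBinom_zero_right, negBinom_zero_right]
    push_cast
    ring).2 h2)
  linear_combination this

lemma ev_expandOne_succ_mul_pt (E : Point) (x : MaxId) (j : ℕ) :
    ev (E * pt x) (expandOne (j + 1)) - ev (E * pt x) (expandOne j) =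
      (1 - x.1) * ev E (expandOne (j + 1)) - ev E (expandOne j) := by
  have h1 := (hasSum_expandOne_diff E x (j + 1)).sub (hasSum_expandOne_diff E x j)
  have h2 := (hasSum_ev_expandOne E (j + 1)).mul_left (-x.1)
  have := h1.unique ((hasSum_congr_fun fun k => by
    rw [negBinom_succ_succ]
    push_cast
    ring).2 h2)
  linear_combination this

end HasSum

/-- The series `∑_k (-1)^k e_k (1-t)^{-k}`. -/
def seriesOne : PowerSeries Lam := PowerSeries.mk expandOne

/-- The series `∑_k (-1)^k e_k t^k`. -/
def seriesInf : PowerSeries Lam := PowerSeries.mk fun k => (-1) ^ k * elemSym k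

/-- Evaluation of a power series with coefficients in `Λ̂(x‖a)` at a point. -/
abbrev evS (E : Point) : PowerSeries Lam →+* PowerSeries XA := PowerSeries.map (ev E : Lam →+* XA)

lemma coeff_evS (E : Point) (F : PowerSeries Lam) (i : ℕ) :
    PowerSeries.coeff i (evS E F) = ev E (PowerSeries.coeff i F) := PowerSeries.coeff_map _ _ _

/-- The series is E(-1/(1-t)), and the factor 1 + xs contributed by a letter x becomes (1 - x -
t)/(1 - t) at s = -1/(1-t). -/
lemma evS_seriesOne_mul_pt (E : Point) (x : MaxId) :
    evS (E * pt x) seriesOne * (1 - PowerSeries.X) =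
      evS E seriesOne * (PowerSeries.C (1 - x.1) - PowerSeries.X) := by
  ext1 j
  rw [mul_sub, mul_sub, mul_one, map_sub, map_sub, PowerSeries.coeff_mul_C]
  cases j with
  | zero =>
    simp only [PowerSeries.coeff_zero_mul_X, coeff_evS, seriesOne, PowerSeries.coeff_mk]
    rw [ev_expandOne_zero_mul_pt]
    ring
  | succ j =>
    simp only [PowerSeries.coeff_succ_mul_X, coeff_evS, seriesOne, PowerSeries.coeff_mk]
    rw [ev_expandOne_succ_mul_pt]
    ring

lemma coeff_evS_seriesInf (E : Point) (k : ℕ) :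
    PowerSeries.coeff k (evS E seriesInf) = (-1) ^ k * PowerSeries.coeff k E.ser := by
  rw [coeff_evS, seriesInf, PowerSeries.coeff_mk, map_mul, ev_elemSym]
  simp

/-- Here the series is E(-t), so a letter x contributes 1 - xt. -/
lemma evS_seriesInf_mul_pt (E : Point) (x : MaxId) :
    evS (E * pt x) seriesInf = evS E seriesInf * (1 - PowerSeries.C x.1 * PowerSeries.X) := by
  ext1 j
  rw [mul_sub, mul_one, ← mul_assoc, map_sub]
  cases j with
  | zero =>
    simp only [coeff_evS_seriesInf, PowerSeries.coeff_zero_mul_X, Point.coeff_zero_ser, sub_zero]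
  | succ j =>
    rw [PowerSeries.coeff_succ_mul_X, PowerSeries.coeff_mul_C, coeff_evS_seriesInf,
      coeff_evS_seriesInf, coeff_evS_seriesInf, coeff_succ_mul_pt]
    ring

/-! ### Moment series and Jacobi–Trudi determinants -/

/-- The element `1 - a_i` of `𝕊`. -/
def vS (i : ℤ) : SS := 1 - MvPowerSeries.X i

lemma isUnit_vS (i : ℤ) : IsUnit (vS i) := by
  rw [MvPowerSeries.isUnit_iff_constantCoeff]
  simp [vS]

lemma constantCoeff_linSeries (c : ℕ → ℤ) : MvPowerSeries.constantCoeff (linSeries c) = 0 := by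
  rw [← MvPowerSeries.coeff_zero_eq_constantCoeff_apply]
  change linSeries c 0 = 0
  rw [linSeries, if_neg]
  simp

lemma isUnit_expandOne_zero : IsUnit (expandOne 0) := by
  rw [MvPowerSeries.isUnit_iff_constantCoeff]
  rw [expandOne, map_add, constantCoeff_linSeries]
  simp [negBinom]

variable {r : ℕ}

/-- The leading constant `A(0) ∏ (1 - a_{b i})` of the moment series with base `b`. -/
def momentConst (b : Fin r → ℤ) : Lam := expandOne 0 * ∏ i, algebraMap SS Lam (vS (b i))

/-- The denominator of the series of negative moments. -/
def polarDenom (b : Fin r → ℤ) : PowerSeries Lam :=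
  seriesOne * ∏ i, (PowerSeries.C (algebraMap SS Lam (vS (b i))) - PowerSeries.X)

/-- The denominator of the series of nonnegative moments. -/
def posDenom (b : Fin r → ℤ) : PowerSeries Lam :=
  seriesInf * ∏ i, (1 - PowerSeries.C (algebraMap SS Lam (MvPowerSeries.X (b i))) * PowerSeries.X)

lemma isUnit_polarDenom (b : Fin r → ℤ) : IsUnit (polarDenom b) := by
  rw [PowerSeries.isUnit_iff_constantCoeff, polarDenom, map_mul, map_prod]
  refine IsUnit.mul ?_ ?_
  · simpa [seriesOne, ← PowerSeries.coeff_zero_eq_constantCoeff_apply] using isUnit_expandOne_zero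
  · rw [IsUnit.prod_univ_iff]
    intro i
    simpa using (isUnit_vS (b i)).map (algebraMap SS Lam)

lemma isUnit_posDenom (b : Fin r → ℤ) : IsUnit (posDenom b) := by
  rw [PowerSeries.isUnit_iff_constantCoeff, posDenom, map_mul, map_prod]
  refine IsUnit.mul ?_ ?_
  · simp [seriesInf, ← PowerSeries.coeff_zero_eq_constantCoeff_apply, elemSym]
  · rw [IsUnit.prod_univ_iff]
    intro i
    simp

/-- The generating series of the negative moments. -/
def polarSeries (b : Fin r → ℤ) : PowerSeries Lam :=
  Ring.inverse (polarDenom b) * PowerSeries.C (momentConst b)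

/-- The series of residues at infinity, with respect to powers of `x`. -/
def posSeries (b : Fin r → ℤ) : PowerSeries Lam :=
  Ring.inverse (posDenom b) * (PowerSeries.C (momentConst b) * PowerSeries.X ^ (r - 1))

lemma polarSeries_mul (b : Fin r → ℤ) :
    polarSeries b * polarDenom b = PowerSeries.C (momentConst b) := by
  rw [polarSeries, mul_right_comm, Ring.inverse_mul_cancel _ (isUnit_polarDenom b), one_mul]

lemma posSeries_mul (b : Fin r → ℤ) :
    posSeries b * posDenom b = PowerSeries.C (momentConst b) * PowerSeries.X ^ (r - 1) := by
  rw [posSeries, mul_right_comm, Ring.inverse_mul_cancel _ (isUnit_posDenom b), one_mul]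

/-- The moments: at a finite alphabet `(x_1, …, x_n / b, c)` this is, up to a constant, the sum of
`(1 - x_l)^z ∏ (x_l - c) / ∏_{m ≠ l} (x_l - x_m)`. -/
def moment (b : Fin r → ℤ) : ℤ → Lam
  | Int.ofNat k =>
    ∑ i ∈ Finset.range (k + 1), (((-1) ^ i * k.choose i : ℤ) : Lam) * PowerSeries.coeff i (posSeries b)
  | Int.negSucc i => PowerSeries.coeff i (polarSeries b)

lemma ev_momentConst_mul_pt (b : Fin r → ℤ) (E : Point) (x : MaxId) :
    ev (E * pt x) (momentConst b) = (1 - x.1) * ev E (momentConst b) := by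
  simp only [momentConst, map_mul, ev_expandOne_zero_mul_pt, map_prod, AlgHom.commutes]
  ring

lemma evS_polarDenom_mul_pt (b : Fin r → ℤ) (E : Point) (x : MaxId) :
    evS (E * pt x) (polarDenom b) * (1 - PowerSeries.X) =
      evS E (polarDenom b) * (PowerSeries.C (1 - x.1) - PowerSeries.X) := by
  have h := evS_seriesOne_mul_pt E x
  simp only [polarDenom, map_mul, map_prod, map_sub, PowerSeries.map_C, PowerSeries.map_X,
    AlgHom.commutes, RingHom.coe_coe, map_one] at h ⊢
  linear_combination (∏ i, (PowerSeries.C (algebraMap SS XA (vS (b i))) - PowerSeries.X)) * h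

lemma evS_posDenom_mul_pt (b : Fin r → ℤ) (E : Point) (x : MaxId) :
    evS (E * pt x) (posDenom b) =
      evS E (posDenom b) * (1 - PowerSeries.C x.1 * PowerSeries.X) := by
  have h := evS_seriesInf_mul_pt E x
  simp only [posDenom, map_mul, map_prod, map_sub, PowerSeries.map_C, PowerSeries.map_X,
    AlgHom.commutes, RingHom.coe_coe, map_one] at h ⊢
  rw [h]
  ring

lemma evS_polarSeries_mul_pt (b : Fin r → ℤ) (E : Point) (x : MaxId) :
    PowerSeries.C (1 - x.1) * evS E (polarSeries b) * (1 - PowerSeries.X) =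
      evS (E * pt x) (polarSeries b) * (PowerSeries.C (1 - x.1) - PowerSeries.X) := by
  have h1 := congrArg (evS E) (polarSeries_mul b)
  have h2 := congrArg (evS (E * pt x)) (polarSeries_mul b)
  have h3 := evS_polarDenom_mul_pt b E x
  rw [map_mul, PowerSeries.map_C] at h1 h2
  rw [RingHom.coe_coe, ev_momentConst_mul_pt, map_mul] at h2
  rw [RingHom.coe_coe] at h1
  apply ((isUnit_polarDenom b).map (evS (E * pt x))).mul_right_cancel
  linear_combination (PowerSeries.C (1 - x.1) * evS E (polarSeries b)) * h3 +
    PowerSeries.C (1 - x.1) * (PowerSeries.C (1 - x.1) - PowerSeries.X) * h1 -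
    (PowerSeries.C (1 - x.1) - PowerSeries.X) * h2

lemma evS_posSeries_mul_pt (b : Fin r → ℤ) (E : Point) (x : MaxId) :
    PowerSeries.C (1 - x.1) * evS E (posSeries b) =
      evS (E * pt x) (posSeries b) * (1 - PowerSeries.C x.1 * PowerSeries.X) := by
  have h1 := congrArg (evS E) (posSeries_mul b)
  have h2 := congrArg (evS (E * pt x)) (posSeries_mul b)
  have h3 := evS_posDenom_mul_pt b E x
  rw [map_mul, map_mul, PowerSeries.map_C] at h1 h2
  rw [RingHom.coe_coe, ev_momentConst_mul_pt, map_mul] at h2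
  rw [RingHom.coe_coe] at h1
  simp only [map_pow, PowerSeries.map_X] at h1 h2
  apply ((isUnit_posDenom b).map (evS E)).mul_right_cancel
  linear_combination (evS (E * pt x) (posSeries b)) * h3 + PowerSeries.C (1 - x.1) * h1 - h2

/-- Dividing E by the letter y multiplies the polar series by (1 - y - t)/((1 - y)(1 - t)), so after
clearing 1 - y every coefficient is affine in y. -/
lemma boundedPole_polar (b : Fin r → ℤ) (i : ℕ) :
    BoundedPole 1 fun E => ev E (PowerSeries.coeff i (polarSeries b)) := by
  intro E
  set S : PowerSeries XA := PowerSeries.mk fun _ => 1 with hS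
  have hS1 : (1 - PowerSeries.X) * S = 1 := by
    rw [mul_comm]
    exact PowerSeries.mk_one_mul_one_sub_eq_one XA
  refine ⟨(1 - Polynomial.X) * Polynomial.C (PowerSeries.coeff i (evS E (polarSeries b) * S)) -
    Polynomial.C (PowerSeries.coeff i (evS E (polarSeries b) * S * PowerSeries.X)), ?_, ?_⟩
  · compute_degree
  · intro y
    have h := evS_polarSeries_mul_pt b (E * (pt y)⁻¹) y
    rw [inv_mul_cancel_right] at h
    have h' : PowerSeries.C (1 - y.1) * evS (E * (pt y)⁻¹) (polarSeries b) =
        PowerSeries.C (1 - y.1) * (evS E (polarSeries b) * S) -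
          evS E (polarSeries b) * S * PowerSeries.X := by
      linear_combination S * h -
        PowerSeries.C (1 - y.1) * evS (E * (pt y)⁻¹) (polarSeries b) * hS1
    have h'' := congrArg (PowerSeries.coeff i) h'
    rw [PowerSeries.coeff_C_mul, map_sub, PowerSeries.coeff_C_mul, coeff_evS] at h''
    rw [pow_one, h'']
    simp

/-- Dividing E by the letter y multiplies this series by (1 - yt)/(1 - y), which is again affine in
y after clearing 1 - y. -/
lemma boundedPole_pos (b : Fin r → ℤ) (i : ℕ) :
    BoundedPole 1 fun E => ev E (PowerSeries.coeff i (posSeries b)) := by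
  intro E
  refine ⟨Polynomial.C (PowerSeries.coeff i (evS E (posSeries b))) -
    Polynomial.C (PowerSeries.coeff i (evS E (posSeries b) * PowerSeries.X)) * Polynomial.X, ?_, ?_⟩
  · compute_degree
  · intro y
    have h := evS_posSeries_mul_pt b (E * (pt y)⁻¹) y
    rw [inv_mul_cancel_right] at h
    have h' : PowerSeries.C (1 - y.1) * evS (E * (pt y)⁻¹) (posSeries b) =
        evS E (posSeries b) - PowerSeries.C y.1 * (evS E (posSeries b) * PowerSeries.X) := by
      rw [h]; ring
    have h'' := congrArg (PowerSeries.coeff i) h'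
    rw [PowerSeries.coeff_C_mul, map_sub, PowerSeries.coeff_C_mul, coeff_evS] at h''
    rw [pow_one, h'', Polynomial.eval_sub, Polynomial.eval_mul, Polynomial.eval_X,
      Polynomial.eval_C, Polynomial.eval_C]
    ring

lemma boundedPole_moment (b : Fin r → ℤ) (z : ℤ) : BoundedPole 1 fun E => ev E (moment b z) := by
  cases z with
  | ofNat k =>
    simp only [moment, map_sum, map_mul, map_intCast]
    exact BoundedPole.sum _ _ fun i _ => (boundedPole_pos b i).const_mul _
  | negSucc i => exact boundedPole_polar b i

/-- The pairing of a polynomial in `1 - x` with the moments, shifted by `j + 1`. -/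
def entry (b : Fin r → ℤ) (j : ℕ) (q : Polynomial Ra) : Lam :=
  q.sum fun k c => c • moment b ((k : ℤ) - j - 1)

/-- The Jacobi–Trudi determinant. -/
def detLam (b : Fin r → ℤ) (q : Fin r → Polynomial Ra) : Lam :=
  Matrix.det (Matrix.of fun i j : Fin r => entry b j (q i))

lemma ev_smul (E : Point) (c : Ra) (f : Lam) : ev E (c • f) = algebraMap Ra XA c * ev E f := by
  rw [← Algebra.smul_def]
  exact map_smul (ev E) (c : SS) f

lemma ev_entry (E : Point) (b : Fin r → ℤ) (j : ℕ) (q : Polynomial Ra) :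
    ev E (entry b j q) =
      q.sum fun k c => algebraMap Ra XA c * ev E (moment b ((k : ℤ) - j - 1)) := by
  rw [entry, Polynomial.sum, map_sum]
  exact Finset.sum_congr rfl fun k _ => ev_smul _ _ _

/-- Each term of the Leibniz expansion is a product of r entries, each with a pole of order at most
one. -/
lemma boundedPole_detLam (b : Fin r → ℤ) (q : Fin r → Polynomial Ra) :
    BoundedPole r fun E => ev E (detLam b q) := by
  simp only [detLam, Matrix.det_apply', map_sum, map_mul, map_intCast, map_prod, Matrix.of_apply]
  refine BoundedPole.sum _ _ fun σ _ => BoundedPole.const_mul _ ?_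
  have := BoundedPole.prod (Finset.univ : Finset (Fin r))
    (fun i E => ev E (entry b i (q (σ i)))) fun i _ => ?_
  · simpa using this
  · simp only [ev_entry, Polynomial.sum]
    exact BoundedPole.sum _ _ fun k _ => (boundedPole_moment b _).const_mul _

end DoubleKStanley
end

noncomputable section
namespace DoubleKStanley

/-! ### Bialternants over a field -/

section Field

open Polynomial Matrix

variable {K : Type*} [Field K] {ι : Type*} [Fintype ι] [DecidableEq ι]

/-- The product of the differences `u_m - u_l` for `m ≠ l`. -/
def nodeDiff (u : ι → K) (l : ι) : K := ∏ m ∈ Finset.univ.erase l, (u m - u l)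

lemma nodeDiff_ne_zero {u : ι → K} (hu : Function.Injective u) (l : ι) : nodeDiff u l ≠ 0 := by
  refine Finset.prod_ne_zero_iff.2 fun m hm => ?_
  exact sub_ne_zero.2 (hu.ne (Finset.ne_of_mem_erase hm))

/-- Lagrange interpolation: both sides have degree below the number of nodes and agree at every
node. -/
lemma interpolation_identity {u : ι → K} (hu : Function.Injective u) (p : K[X])
    (hp : p.natDegree < Fintype.card ι) :
    ∑ l, C (p.eval (u l) * (nodeDiff u l)⁻¹) * ∏ m ∈ Finset.univ.erase l, (C (u m) - X) = p := by
  have hpos : 0 < Fintype.card ι := by omega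
  refine Polynomial.eq_of_degrees_lt_of_eval_index_eq (v := u) Finset.univ hu.injOn ?_ ?_ ?_
  · rw [Finset.card_univ]
    refine lt_of_le_of_lt (degree_sum_le _ _) ?_
    rw [Finset.sup_lt_iff (by simp)]
    intro l _
    refine lt_of_le_of_lt (degree_mul_le _ _) ?_
    refine lt_of_le_of_lt (add_le_add degree_C_le (degree_prod_le _ _)) ?_
    have : ∑ m ∈ Finset.univ.erase l, (C (u m) - X : K[X]).degree ≤
        ∑ m ∈ Finset.univ.erase l, (1 : WithBot ℕ) := by
      refine Finset.sum_le_sum fun m _ => ?_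
      refine (degree_sub_le _ _).trans (max_le ?_ degree_X_le)
      exact degree_C_le.trans zero_le_one
    refine lt_of_le_of_lt (add_le_add le_rfl this) ?_
    rw [zero_add, Finset.sum_const, Finset.card_erase_of_mem (Finset.mem_univ l),
      Finset.card_univ, nsmul_one]
    exact_mod_cast Nat.sub_lt hpos one_pos
  · rw [Finset.card_univ]
    exact lt_of_le_of_lt degree_le_natDegree (by exact_mod_cast hp)
  · intro i _
    rw [eval_finsetSum, Finset.sum_eq_single i]
    · rw [eval_mul, eval_C, eval_prod]
      simp only [eval_sub, eval_C, eval_X]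
      change _ * nodeDiff u i = _
      rw [inv_mul_cancel_right₀ (nodeDiff_ne_zero hu i)]
    · intro l _ hl
      rw [eval_mul, eval_prod, Finset.prod_eq_zero (i := i)]
      · rw [mul_zero]
      · exact Finset.mem_erase.2 ⟨hl.symm, Finset.mem_univ i⟩
      · simp
    · simp

/-- The constant term of the interpolation identity, divided by the product of all nodes. -/
lemma sum_eval_div_nodeDiff_mul {u : ι → K} (hu : Function.Injective u) (h0 : ∀ l, u l ≠ 0)
    (p : K[X]) (hp : p.natDegree < Fintype.card ι) :
    ∑ l, p.eval (u l) * (nodeDiff u l)⁻¹ * (u l)⁻¹ = p.eval 0 * (∏ l, u l)⁻¹ := by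
  have h := congrArg (eval 0) (interpolation_identity hu p hp)
  rw [← h, eval_finsetSum, Finset.sum_mul]
  refine Finset.sum_congr rfl fun l _ => ?_
  rw [eval_mul, eval_C, eval_prod]
  simp only [eval_sub, eval_C, eval_X, sub_zero]
  rw [← Finset.mul_prod_erase Finset.univ u (Finset.mem_univ l), mul_inv]
  have : ∏ m ∈ Finset.univ.erase l, u m ≠ 0 := Finset.prod_ne_zero_iff.2 fun m _ => h0 m
  field_simp

/-- The previous sum for p · X, whose value at 0 vanishes; multiplying by X is what costs one
degree. -/
lemma sum_eval_div_nodeDiff {u : ι → K} (hu : Function.Injective u) (h0 : ∀ l, u l ≠ 0)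
    (p : K[X]) (hp : p.natDegree + 1 < Fintype.card ι) :
    ∑ l, p.eval (u l) * (nodeDiff u l)⁻¹ = 0 := by
  have h := sum_eval_div_nodeDiff_mul hu h0 (p * X)
    (lt_of_le_of_lt natDegree_mul_le (by rw [natDegree_X]; exact hp))
  simp only [eval_mul, eval_X, mul_zero, zero_mul] at h
  rw [← h]
  refine Finset.sum_congr rfl fun l _ => ?_
  have := h0 l
  field_simp

/-- The matrix of inverse powers. -/
def invPowers {n : ℕ} (u : ι → K) (e : ι ≃ Fin n) : Matrix ι ι K :=
  of fun l j => (u l ^ ((e j : ℕ) + 1))⁻¹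

/-- The (transposed) Vandermonde matrix. -/
def powers {R : Type*} [CommRing R] {n : ℕ} (u : ι → R) (e : ι ≃ Fin n) : Matrix ι ι R :=
  of fun i l => u l ^ (e i : ℕ)

lemma pairing_apply {n : ℕ} (u : ι → K) (e : ι ≃ Fin n) (F : Matrix ι ι K) (i j : ι) :
    (F * diagonal (fun l => (nodeDiff u l)⁻¹) * invPowers u e) i j =
      ∑ l, F i l * (nodeDiff u l)⁻¹ * (u l ^ ((e j : ℕ) + 1))⁻¹ := by
  rw [mul_apply]
  simp only [mul_diagonal, invPowers, of_apply]

/-- After cancelling u^{b+1} the numerator is u^{a-b-1} p(u), of degree at most n - 2, so its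
weighted sum over the nodes vanishes. -/
lemma pairing_eq_zero {n : ℕ} {u : ι → K} (hu : Function.Injective u) (h0 : ∀ l, u l ≠ 0)
    (e : ι ≃ Fin n) (p : K[X]) {a b : ℕ} (hab : b < a) (hp : p.natDegree + a < n) :
    ∑ l, u l ^ a * p.eval (u l) * (nodeDiff u l)⁻¹ * (u l ^ (b + 1))⁻¹ = 0 := by
  have hcard : Fintype.card ι = n := by simpa using Fintype.card_congr e
  obtain ⟨c, rfl⟩ := Nat.exists_eq_add_of_lt hab
  have h := sum_eval_div_nodeDiff hu h0 (X ^ c * p) (by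
    rw [hcard]
    have : (X ^ c * p).natDegree ≤ c + p.natDegree :=
      natDegree_mul_le.trans (by rw [natDegree_X_pow])
    omega)
  rw [← h]
  refine Finset.sum_congr rfl fun l _ => ?_
  rw [eval_mul, eval_pow, eval_X, show b + c + 1 = c + (b + 1) by ring, pow_add]
  have := h0 l
  field_simp

lemma pairing_diag {n : ℕ} {u : ι → K} (hu : Function.Injective u) (h0 : ∀ l, u l ≠ 0)
    (e : ι ≃ Fin n) (p : K[X]) {a : ℕ} (hp : p.natDegree + a < n) :
    ∑ l, u l ^ a * p.eval (u l) * (nodeDiff u l)⁻¹ * (u l ^ (a + 1))⁻¹ =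
      p.eval 0 * (∏ l, u l)⁻¹ := by
  have hcard : Fintype.card ι = n := by simpa using Fintype.card_congr e
  rw [← sum_eval_div_nodeDiff_mul hu h0 p (by omega)]
  refine Finset.sum_congr rfl fun l _ => ?_
  have := h0 l
  rw [pow_succ]
  field_simp

/-- The product matrix is upper triangular with every diagonal entry equal to the inverse of the
product of the nodes. -/
lemma det_pairing_powers {n : ℕ} {u : ι → K} (hu : Function.Injective u) (h0 : ∀ l, u l ≠ 0)
    (e : ι ≃ Fin n) :
    (powers u e * diagonal (fun l => (nodeDiff u l)⁻¹) * invPowers u e).det =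
      ((∏ l, u l)⁻¹) ^ n := by
  set A := powers u e * diagonal (fun l => (nodeDiff u l)⁻¹) * invPowers u e with hA
  rw [← det_submatrix_equiv_self e.symm A, det_of_isUpperTriangular]
  · rw [Finset.prod_congr rfl (g := fun _ => (∏ l, u l)⁻¹), Finset.prod_const, Finset.card_univ,
      Fintype.card_fin]
    intro i _
    rw [submatrix_apply, hA, pairing_apply]
    have := pairing_diag hu h0 e 1 (a := i) (by simp)
    simpa [powers] using this
  · intro i j hij
    rw [submatrix_apply, hA, pairing_apply]
    have hij' : (j : ℕ) < i := hij
    have := pairing_eq_zero hu h0 e 1 (a := i) (b := j) hij' (by simp)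
    simpa [powers] using this

/-- The bialternant with `r` prescribed rows `g`, completed by `k` rows of the form
`u^{r+t} p_t(u)`, divided by the Vandermonde determinant, as an `r × r` determinant. -/
lemma det_block_mul_det_powers {r k : ℕ} {u : Fin r ⊕ Fin k → K} (hu : Function.Injective u)
    (h0 : ∀ l, u l ≠ 0) (g : Fin r → Fin r ⊕ Fin k → K) (p : Fin k → K[X])
    (hp0 : ∀ t, (p t).eval 0 = 1) (hp : ∀ t, (p t).natDegree + t < k) :
    det (of fun i j : Fin r => ∑ l, g i l * (nodeDiff u l)⁻¹ * (u l ^ ((j : ℕ) + 1))⁻¹) *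
        det (powers u finSumFinEquiv) =
      det (of fun i l => Sum.elim g (fun (t : Fin k) l => u l ^ (r + (t : ℕ)) * (p t).eval (u l)) i l) *
        ((∏ l, u l)⁻¹) ^ r := by
  set F : Matrix (Fin r ⊕ Fin k) (Fin r ⊕ Fin k) K :=
    of fun i l => Sum.elim g (fun (t : Fin k) l => u l ^ (r + (t : ℕ)) * (p t).eval (u l)) i l with hF
  set e : Fin r ⊕ Fin k ≃ Fin (r + k) := finSumFinEquiv with he
  set A := F * diagonal (fun l => (nodeDiff u l)⁻¹) * invPowers u e with hA
  have hAdet : A.det = det (of fun i j : Fin r =>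
      ∑ l, g i l * (nodeDiff u l)⁻¹ * (u l ^ ((j : ℕ) + 1))⁻¹) * ((∏ l, u l)⁻¹) ^ k := by
    rw [← fromBlocks_toBlocks A]
    -- The added rows have u-exponent at least r, while the first r columns divide by at most u^r;
    -- the degree bound on p makes these pairings vanish.
    have h21 : A.toBlocks₂₁ = 0 := by
      ext t j
      change A (Sum.inr t) (Sum.inl j) = 0
      rw [hA, pairing_apply]
      have := pairing_eq_zero hu h0 e (p t) (a := r + t) (b := j) (by omega)
        (by have := hp t; omega)
      simpa [hF, he] using this
    rw [h21, det_fromBlocks_zero₂₁]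
    congr 1
    · congr 1
      ext i j
      change A (Sum.inl i) (Sum.inl j) = _
      rw [hA, pairing_apply]
      simp [hF, he]
    · rw [det_of_isUpperTriangular]
      · rw [Finset.prod_congr rfl (g := fun _ => (∏ l, u l)⁻¹), Finset.prod_const,
          Finset.card_univ, Fintype.card_fin]
        intro t _
        change A (Sum.inr t) (Sum.inr t) = _
        rw [hA, pairing_apply]
        have := pairing_diag hu h0 e (p t) (a := r + t) (by have := hp t; omega)
        rw [hp0, one_mul] at this
        rw [← this]
        simp [hF, he]
      · intro t s hts
        have hts' : (s : ℕ) < t := hts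
        change A (Sum.inr t) (Sum.inr s) = 0
        rw [hA, pairing_apply]
        have := pairing_eq_zero hu h0 e (p t) (a := r + t) (b := r + s) (by omega)
          (by have := hp t; omega)
        simpa [hF, he] using this
  -- The Vandermonde matrix paired in the same way has the same diagonal and inverse power factors,
  -- so comparing the two determinants eliminates them.
  have hV := det_pairing_powers hu h0 e
  rw [hA, det_mul, det_mul] at hAdet
  rw [det_mul, det_mul] at hV
  have hne : ((∏ l, u l)⁻¹) ^ k ≠ 0 :=
    pow_ne_zero _ (inv_ne_zero (Finset.prod_ne_zero_iff.2 fun l _ => h0 l))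
  apply mul_right_cancel₀ hne
  rw [mul_right_comm, ← hAdet]
  rw [pow_add] at hV
  linear_combination F.det * hV

/-! ### Moments by partial fractions -/

variable {κ : Type*} [Fintype κ]

/-- The weight of the node `l` in the moments with zeros `v`. -/
def nodeWeight (u : ι → K) (v : κ → K) (l : ι) : K :=
  (∏ c, (v c - u l)) * (nodeDiff u l)⁻¹

lemma sum_nodeWeight_mul_prod {u : ι → K} (hu : Function.Injective u) (v : κ → K)
    (hκ : Fintype.card κ < Fintype.card ι) :
    ∑ l, C (nodeWeight u v l) * ∏ m ∈ Finset.univ.erase l, (C (u m) - X) =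
      ∏ c, (C (v c) - X) := by
  have h := interpolation_identity hu (∏ c, (C (v c) - X)) (by
    refine lt_of_le_of_lt (natDegree_prod_le _ _) (lt_of_le_of_lt ?_ hκ)
    have : ∑ c : κ, (C (v c) - X : K[X]).natDegree ≤ ∑ c : κ, 1 := by
      refine Finset.sum_le_sum fun c _ => ?_
      refine (natDegree_sub_le _ _).trans ?_
      simp
    simpa using this)
  simpa only [nodeWeight, eval_prod, eval_sub, eval_C, eval_X] using h

/-- Partial fractions of ∏ (v_c - t) / ∏ (u_l - t), with each 1/(u_l - t) expanded as a geometric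
series. Having fewer zeros than poles excludes a polynomial part. -/
lemma coeff_polar_eq {u : ι → K} (hu : Function.Injective u) (h0 : ∀ l, u l ≠ 0) (v : κ → K)
    (hκ : Fintype.card κ < Fintype.card ι) (ψ : K) (N : PowerSeries K)
    (hN : N * ∏ l, (PowerSeries.C (u l) - PowerSeries.X) =
      PowerSeries.C ψ * ∏ c, (PowerSeries.C (v c) - PowerSeries.X)) (i : ℕ) :
    PowerSeries.coeff i N = ψ * ∑ l, nodeWeight u v l * (u l ^ (i + 1))⁻¹ := by
  set S : PowerSeries K :=
    ∑ l, PowerSeries.C (nodeWeight u v l) * PowerSeries.mk fun i => (u l ^ (i + 1))⁻¹ with hS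
  have hgeom : ∀ l, (PowerSeries.mk fun i => (u l ^ (i + 1))⁻¹) *
      (PowerSeries.C (u l) - PowerSeries.X) = 1 := by
    intro l
    ext1 j
    rw [mul_sub, map_sub, PowerSeries.coeff_mul_C]
    have := h0 l
    cases j with
    | zero => simp [this]
    | succ j =>
      rw [PowerSeries.coeff_succ_mul_X, PowerSeries.coeff_mk, PowerSeries.coeff_mk,
        PowerSeries.coeff_one, if_neg (Nat.succ_ne_zero j), pow_succ (u l) (j + 1)]
      field_simp
      simp
  have hSN : S * ∏ l, (PowerSeries.C (u l) - PowerSeries.X) =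
      ∏ c, (PowerSeries.C (v c) - PowerSeries.X) := by
    have h := congrArg Polynomial.coeToPowerSeries.ringHom (sum_nodeWeight_mul_prod hu v hκ)
    simp only [map_sum, map_mul, map_prod, map_sub, Polynomial.coeToPowerSeries.ringHom_apply,
      Polynomial.coe_C, Polynomial.coe_X] at h
    rw [← h, hS, Finset.sum_mul]
    refine Finset.sum_congr rfl fun l _ => ?_
    rw [← Finset.mul_prod_erase Finset.univ _ (Finset.mem_univ l), mul_assoc, ← mul_assoc _ _ (∏ m ∈ _, _),
      hgeom, one_mul]
  have hne : ∏ l, (PowerSeries.C (u l) - PowerSeries.X) ≠ 0 := by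
    refine Finset.prod_ne_zero_iff.2 fun l _ hl => ?_
    have := hgeom l
    rw [hl, mul_zero] at this
    exact zero_ne_one this
  have : N = PowerSeries.C ψ * S := by
    apply mul_right_cancel₀ hne
    rw [hN, mul_assoc, hSN]
  rw [this, PowerSeries.coeff_C_mul, hS, map_sum]
  simp only [PowerSeries.coeff_C_mul, PowerSeries.coeff_mk]

/-- The same partial fractions expanded at infinity. The factor X^(r-1) accounts for the excess of
nodes over zeros, so the weights are the same as for the negative moments. -/
lemma coeff_pos_eq [Infinite K] {u : ι → K} (hu : Function.Injective u) (v : κ → K) {r : ℕ}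
    (hr : 0 < r) (hκ : Fintype.card ι = r + Fintype.card κ) (ψ : K) (H : PowerSeries K)
    (hH : H * ∏ l, (1 - PowerSeries.C (1 - u l) * PowerSeries.X) =
      PowerSeries.C ψ * PowerSeries.X ^ (r - 1) *
        ∏ c, (1 - PowerSeries.C (1 - v c) * PowerSeries.X)) (i : ℕ) :
    PowerSeries.coeff i H = ψ * ∑ l, nodeWeight u v l * (1 - u l) ^ i := by
  set S : PowerSeries K :=
    ∑ l, PowerSeries.C (nodeWeight u v l) * PowerSeries.mk fun i => (1 - u l) ^ i with hS
  have hgeom : ∀ l, (PowerSeries.mk fun i => (1 - u l) ^ i) *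
      (1 - PowerSeries.C (1 - u l) * PowerSeries.X) = 1 := by
    intro l
    ext1 j
    rw [mul_sub, mul_one, ← mul_assoc, map_sub]
    cases j with
    | zero => simp
    | succ j =>
      rw [PowerSeries.coeff_succ_mul_X, PowerSeries.coeff_mul_C, PowerSeries.coeff_mk,
        PowerSeries.coeff_mk, PowerSeries.coeff_one, if_neg (Nat.succ_ne_zero j), pow_succ, sub_self]
  -- The interpolation identity at 1 - 1/τ, multiplied by τ to the number of nodes minus one.
  -- Checking τ ≠ 0 is enough since the field is infinite.
  have hpoly : ∑ l, C (nodeWeight u v l) * ∏ m ∈ Finset.univ.erase l, (1 - C (1 - u m) * X) =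
      X ^ (r - 1) * ∏ c, (1 - C (1 - v c) * X) := by
    apply Polynomial.eq_of_infinite_eval_eq
    refine Set.Infinite.mono (s := {0}ᶜ) ?_ (Set.finite_singleton (0 : K)).infinite_compl
    intro τ hτ
    have hτ : τ ≠ 0 := hτ
    have h := congrArg (eval (1 - τ⁻¹)) (sum_nodeWeight_mul_prod hu v (by omega))
    simp only [eval_finsetSum, eval_mul, eval_prod, eval_sub, eval_C, eval_X] at h
    simp only [Set.mem_ofPred_eq, eval_finsetSum, eval_mul, eval_prod, eval_sub, eval_C, eval_X,
      eval_one, eval_pow]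
    have hfac : ∀ s : K, 1 - (1 - s) * τ = τ * (s - (1 - τ⁻¹)) := by
      intro s
      field_simp
      ring
    have h2 : ∏ c, (1 - (1 - v c) * τ) = τ ^ Fintype.card κ * ∏ c, (v c - (1 - τ⁻¹)) := by
      simp only [hfac, Finset.prod_mul_distrib, Finset.prod_const, Finset.card_univ]
    have h1 : ∀ l, ∏ m ∈ Finset.univ.erase l, (1 - (1 - u m) * τ) =
        τ ^ (Fintype.card ι - 1) * ∏ m ∈ Finset.univ.erase l, (u m - (1 - τ⁻¹)) := by
      intro l
      simp only [hfac, Finset.prod_mul_distrib, Finset.prod_const, Finset.card_univ,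
        Finset.card_erase_of_mem (Finset.mem_univ l)]
    rw [h2, ← h, ← mul_assoc, ← pow_add, show r - 1 + Fintype.card κ = Fintype.card ι - 1 by omega,
      Finset.mul_sum]
    refine Finset.sum_congr rfl fun l _ => ?_
    rw [h1]
    ring
  have hSN : S * ∏ l, (1 - PowerSeries.C (1 - u l) * PowerSeries.X) =
      PowerSeries.X ^ (r - 1) * ∏ c, (1 - PowerSeries.C (1 - v c) * PowerSeries.X) := by
    have h := congrArg Polynomial.coeToPowerSeries.ringHom hpoly
    simp only [map_sum, map_mul, map_prod, map_sub, map_one, map_pow,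
      Polynomial.coeToPowerSeries.ringHom_apply, Polynomial.coe_C, Polynomial.coe_X] at h
    simp only [map_sub, map_one]
    rw [← h, hS, Finset.sum_mul]
    refine Finset.sum_congr rfl fun l _ => ?_
    have hg := hgeom l
    simp only [map_sub, map_one] at hg
    rw [← Finset.mul_prod_erase Finset.univ _ (Finset.mem_univ l), mul_assoc,
      ← mul_assoc _ _ (∏ m ∈ _, _), hg, one_mul]
  have hne : ∏ l, (1 - PowerSeries.C (1 - u l) * PowerSeries.X) ≠ 0 := by
    refine Finset.prod_ne_zero_iff.2 fun l _ hl => ?_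
    have := hgeom l
    rw [hl, mul_zero] at this
    exact zero_ne_one this
  have : H = PowerSeries.C ψ * S := by
    apply mul_right_cancel₀ hne
    rw [hH, mul_assoc, mul_assoc, hSN]
  rw [this, PowerSeries.coeff_C_mul, hS, map_sum]
  simp only [PowerSeries.coeff_C_mul, PowerSeries.coeff_mk]

end Field

end DoubleKStanley
end

noncomputable section
namespace DoubleKStanley

open Matrix

/-! ### Evaluation of the determinants at finite alphabets -/

/-- The variable `x_i` as an element of the maximal ideal. -/
def xM (i : ℤ) : MaxId := ⟨xVar i, MvPowerSeries.constantCoeff_X _⟩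

/-- The variable `a_i` as an element of the maximal ideal. -/
def aM (i : ℤ) : MaxId := ⟨aVar i, MvPowerSeries.constantCoeff_X _⟩

lemma algebraMap_X (i : ℤ) : algebraMap SS XA (MvPowerSeries.X i) = aVar i :=
  MvPowerSeries.rename_X _ _

lemma algebraMap_vS (i : ℤ) : algebraMap SS XA (vS i) = 1 - (aM i).1 := by
  rw [vS, map_sub, map_one, algebraMap_X]
  rfl

/-- The point given by a finite alphabet. -/
def alph {ι : Type*} [Fintype ι] (x : ι → MaxId) : Point := ∏ l, pt (x l)

lemma evS_seriesOne_mul_prod {ι : Type*} (s : Finset ι) (x : ι → MaxId) (E : Point) :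
    evS (E * ∏ l ∈ s, pt (x l)) seriesOne * (1 - PowerSeries.X) ^ s.card =
      evS E seriesOne * ∏ l ∈ s, (PowerSeries.C (1 - (x l).1) - PowerSeries.X) := by
  classical
  induction s using Finset.induction_on with
  | empty => simp
  | insert i s hi ih =>
    rw [Finset.prod_insert hi, Finset.prod_insert hi, Finset.card_insert_of_notMem hi,
      mul_comm (pt (x i)), ← mul_assoc, pow_succ', ← mul_assoc, evS_seriesOne_mul_pt]
    linear_combination (PowerSeries.C (1 - (x i).1) - PowerSeries.X) * ih

lemma evS_seriesInf_mul_prod {ι : Type*} (s : Finset ι) (x : ι → MaxId) (E : Point) :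
    evS (E * ∏ l ∈ s, pt (x l)) seriesInf =
      evS E seriesInf * ∏ l ∈ s, (1 - PowerSeries.C (x l).1 * PowerSeries.X) := by
  classical
  induction s using Finset.induction_on with
  | empty => simp
  | insert i s hi ih =>
    rw [Finset.prod_insert hi, Finset.prod_insert hi,
      mul_comm (pt (x i)), ← mul_assoc, evS_seriesInf_mul_pt, ih]
    ring

lemma evS_one_seriesOne : evS 1 seriesOne = 1 := by
  ext1 j
  rw [coeff_evS, seriesOne, PowerSeries.coeff_mk, ev_one, expandOne]
  change algebraMap SS XA (MvPowerSeries.constantCoeff _) = _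
  rw [map_add, constantCoeff_linSeries, add_zero, map_intCast, map_intCast, PowerSeries.coeff_one]
  simp [negBinom]

lemma evS_one_seriesInf : evS 1 seriesInf = 1 := by
  ext1 j
  rw [coeff_evS_seriesInf, Point.ser_one, PowerSeries.coeff_one]
  split_ifs with h
  · simp [h]
  · simp

/-- The unit `1 - a_i` of `R(a)`. -/
def vRa (i : ℤ) : Raˣ where
  val := ⟨vS i, Algebra.subset_adjoin ⟨i, Or.inl rfl⟩⟩
  inv := ⟨Ring.inverse (vS i),
    Algebra.subset_adjoin ⟨i, Or.inr (Ring.inverse_mul_cancel _ (isUnit_vS i))⟩⟩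
  val_inv := Subtype.ext (Ring.mul_inverse_cancel _ (isUnit_vS i))
  inv_val := Subtype.ext (Ring.inverse_mul_cancel _ (isUnit_vS i))

lemma algebraMap_vRa (i : ℤ) : algebraMap Ra XA (vRa i) = 1 - (aM i).1 := algebraMap_vS i

lemma algebraMap_vRa_mul_inv (i : ℤ) :
    algebraMap Ra XA ((vRa i)⁻¹ : Raˣ) * (1 - (aM i).1) = 1 := by
  rw [← algebraMap_vRa, ← map_mul, Units.inv_mul, map_one]

/-- The polynomial `x ⊖ a_i = (1 - a_i - u) / (1 - a_i)` in the variable `u = 1 - x`. -/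
def linPoly (i : ℤ) : Polynomial Ra :=
  Polynomial.C (((vRa i)⁻¹ : Raˣ) : Ra) * (Polynomial.C (vRa i : Ra) - Polynomial.X)

lemma linPoly_eval_zero (i : ℤ) : (linPoly i).eval 0 = 1 := by
  simp [linPoly]

lemma natDegree_linPoly_le (i : ℤ) : (linPoly i).natDegree ≤ 1 := by
  unfold linPoly
  compute_degree

/-- Values of a polynomial in `u` at `u = 1 - x`. -/
def evalU (x : MaxId) : Polynomial Ra →ₐ[Ra] XA := Polynomial.aeval (1 - x.1)

@[simp] lemma evalU_X (x : MaxId) : evalU x Polynomial.X = 1 - x.1 := Polynomial.aeval_X _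

@[simp] lemma evalU_C (x : MaxId) (c : Ra) : evalU x (Polynomial.C c) = algebraMap Ra XA c :=
  Polynomial.aeval_C _ _

lemma mul_evalU_linPoly (x : MaxId) (i : ℤ) :
    (1 - (aM i).1) * evalU x (linPoly i) = (1 - (aM i).1) - (1 - x.1) := by
  rw [linPoly, map_mul, map_sub (evalU x), evalU_C, evalU_C, evalU_X, algebraMap_vRa]
  linear_combination ((1 - (aM i).1) - (1 - x.1)) * algebraMap_vRa_mul_inv i

lemma one_sub_ne_zero (x : MaxId) : 1 - x.1 ≠ 0 := by
  intro h
  have := congrArg MvPowerSeries.constantCoeff h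
  rw [map_sub, x.2] at this
  simp at this

/-! ### The bialternant formula at an alphabet (x / b, c) -/

section Bialternant

variable {r k : ℕ} (b : Fin r → ℤ) (c : Fin k → ℤ) (x : Fin r ⊕ Fin k → MaxId)

/-- The point `(x / b, c)`. -/
def superPoint : Point :=
  alph x * (alph fun i => aM (b i))⁻¹ * (alph fun i => aM (c i))⁻¹

/-- There are r + k letters in the numerator and r + k in the denominator, so the powers of 1 - t
cancel; the factors belonging to b are those built into `polarDenom`. -/
lemma evS_polarDenom_superPoint :
    evS (superPoint b c x) (polarDenom b) *
        ∏ i, (PowerSeries.C (1 - (aM (c i)).1) - PowerSeries.X) =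
      ∏ l, (PowerSeries.C (1 - (x l).1) - PowerSeries.X) := by
  have h1 := evS_seriesOne_mul_prod Finset.univ x 1
  have h2 := evS_seriesOne_mul_prod Finset.univ (fun i => aM (b i))
    (superPoint b c x * alph fun i => aM (c i))
  have h3 := evS_seriesOne_mul_prod Finset.univ (fun i => aM (c i)) (superPoint b c x)
  have hE : superPoint b c x * (alph fun i => aM (c i)) * ∏ i, pt (aM (b i)) = 1 * ∏ l, pt (x l) := by
    simp only [superPoint, alph]
    group
  rw [hE] at h2
  rw [evS_one_seriesOne, one_mul] at h1
  simp only [Finset.card_univ, Fintype.card_fin, Fintype.card_sum] at h1 h2 h3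
  simp only [polarDenom, map_mul, map_prod, map_sub, PowerSeries.map_C, PowerSeries.map_X,
    RingHom.coe_coe, AlgHom.commutes, algebraMap_vS]
  simp only [alph, map_sub, one_mul] at h1 h2 h3 ⊢
  rw [pow_add] at h1
  linear_combination (-
    ∏ i, (PowerSeries.C (1 : XA) - PowerSeries.C (aM (b i)).1 - PowerSeries.X)) * h3 +
    (-(1 - PowerSeries.X) ^ k) * h2 + h1

lemma evS_posDenom_superPoint :
    evS (superPoint b c x) (posDenom b) *
        ∏ i, (1 - PowerSeries.C (aM (c i)).1 * PowerSeries.X) =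
      ∏ l, (1 - PowerSeries.C (x l).1 * PowerSeries.X) := by
  have h1 := evS_seriesInf_mul_prod Finset.univ x 1
  have h2 := evS_seriesInf_mul_prod Finset.univ (fun i => aM (b i))
    (superPoint b c x * alph fun i => aM (c i))
  have h3 := evS_seriesInf_mul_prod Finset.univ (fun i => aM (c i)) (superPoint b c x)
  have hE : superPoint b c x * (alph fun i => aM (c i)) * ∏ i, pt (aM (b i)) = 1 * ∏ l, pt (x l) := by
    simp only [superPoint, alph]
    group
  rw [hE] at h2
  rw [evS_one_seriesInf, one_mul] at h1
  have ha : ∀ i, algebraMap SS XA (MvPowerSeries.X i) = (aM i).1 := algebraMap_X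
  simp only [posDenom, map_mul, map_prod, map_sub, PowerSeries.map_C, PowerSeries.map_X, map_one,
    RingHom.coe_coe, AlgHom.commutes, ha]
  simp only [alph, one_mul] at h1 h2 h3 ⊢
  linear_combination (-∏ i, (1 - PowerSeries.C (aM (b i)).1 * PowerSeries.X)) * h3 - h2 + h1

/-- The constant term of `evS_polarDenom_superPoint`, because the constant term of `polarDenom b` is
`momentConst b`. -/
lemma ev_momentConst_superPoint :
    ev (superPoint b c x) (momentConst b) * ∏ i, (1 - (aM (c i)).1) = ∏ l, (1 - (x l).1) := by
  have h := congrArg (PowerSeries.constantCoeff (R := XA)) (evS_polarDenom_superPoint b c x)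
  simp only [map_mul, map_prod, map_sub, PowerSeries.constantCoeff_C, PowerSeries.constantCoeff_X,
    sub_zero] at h
  rw [← PowerSeries.coeff_zero_eq_constantCoeff_apply, coeff_evS, polarDenom] at h
  simp only [PowerSeries.coeff_zero_eq_constantCoeff, map_mul, map_prod, map_sub,
    PowerSeries.constantCoeff_C, PowerSeries.constantCoeff_X, sub_zero] at h
  rw [← PowerSeries.coeff_zero_eq_constantCoeff_apply, seriesOne, PowerSeries.coeff_mk] at h
  simpa [momentConst] using h

/-- The fraction field of `ℤ[[x, a]]`. -/
abbrev FracXA : Type := FractionRing XA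

/-- The image of `1 - x_l` in the fraction field. -/
def nodeU {ι : Type*} (x : ι → MaxId) (l : ι) : FracXA := algebraMap XA FracXA (1 - (x l).1)

lemma nodeU_injective {ι : Type*} {x : ι → MaxId} (hx : Function.Injective x) :
    Function.Injective (nodeU x) := by
  intro l m h
  have h := IsFractionRing.injective XA FracXA h
  exact hx (Subtype.ext (sub_right_injective h))

lemma nodeU_ne_zero {ι : Type*} (x : ι → MaxId) (l : ι) : nodeU x l ≠ 0 := by
  rw [nodeU, Ne, IsFractionRing.to_map_eq_zero_iff]
  exact one_sub_ne_zero _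

variable {x}

lemma algebraMap_ev_polar (hx : Function.Injective x) (hr : 0 < r) (i : ℕ) :
    algebraMap XA FracXA (ev (superPoint b c x) (PowerSeries.coeff i (polarSeries b))) =
      algebraMap XA FracXA (ev (superPoint b c x) (momentConst b)) *
        ∑ l, nodeWeight (nodeU x) (nodeU fun i => aM (c i)) l * (nodeU x l ^ (i + 1))⁻¹ := by
  have h1 := congrArg (evS (superPoint b c x)) (polarSeries_mul b)
  have h2 := evS_polarDenom_superPoint b c x
  rw [map_mul, PowerSeries.map_C] at h1
  have h3 : evS (superPoint b c x) (polarSeries b) * ∏ l, (PowerSeries.C (1 - (x l).1) -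
      PowerSeries.X) = PowerSeries.C (ev (superPoint b c x) (momentConst b)) *
        ∏ i, (PowerSeries.C (1 - (aM (c i)).1) - PowerSeries.X) := by
    rw [← h2, ← mul_assoc, h1]
    rfl
  have h4 := congrArg (PowerSeries.map (algebraMap XA FracXA)) h3
  rw [map_mul, map_mul, map_prod, map_prod, PowerSeries.map_C] at h4
  rw [← coeff_evS, ← PowerSeries.coeff_map]
  refine coeff_polar_eq (nodeU_injective hx) (nodeU_ne_zero x) _ (by simpa using hr) _ _ ?_ i
  refine Eq.trans (congrArg₂ _ rfl ?_) (h4.trans (congrArg₂ _ rfl ?_))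
  all_goals
    refine Finset.prod_congr rfl fun l _ => ?_
    rw [map_sub, PowerSeries.map_C, PowerSeries.map_X]
    rfl

instance : Infinite XA :=
  Infinite.of_surjective (MvPowerSeries.constantCoeff (R := ℤ)) fun n =>
    ⟨MvPowerSeries.C n, MvPowerSeries.constantCoeff_C n⟩

lemma algebraMap_ev_pos (hx : Function.Injective x) (hr : 0 < r) (i : ℕ) :
    algebraMap XA FracXA (ev (superPoint b c x) (PowerSeries.coeff i (posSeries b))) =
      algebraMap XA FracXA (ev (superPoint b c x) (momentConst b)) *
        ∑ l, nodeWeight (nodeU x) (nodeU fun i => aM (c i)) l * (1 - nodeU x l) ^ i := by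
  have h1 := congrArg (evS (superPoint b c x)) (posSeries_mul b)
  have h2 := evS_posDenom_superPoint b c x
  rw [map_mul, map_mul, PowerSeries.map_C, map_pow, PowerSeries.map_X] at h1
  have h3 : evS (superPoint b c x) (posSeries b) * ∏ l, (1 - PowerSeries.C (x l).1 *
      PowerSeries.X) = PowerSeries.C (ev (superPoint b c x) (momentConst b)) *
        PowerSeries.X ^ (r - 1) *
        ∏ i, (1 - PowerSeries.C (aM (c i)).1 * PowerSeries.X) := by
    rw [← h2, ← mul_assoc, h1]
    rfl
  have h4 := congrArg (PowerSeries.map (algebraMap XA FracXA)) h3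
  rw [map_mul, map_mul, map_mul, map_prod, map_prod, PowerSeries.map_C, map_pow,
    PowerSeries.map_X] at h4
  rw [← coeff_evS, ← PowerSeries.coeff_map]
  have : Infinite FracXA := Infinite.of_injective _ (IsFractionRing.injective XA FracXA)
  have hfac : ∀ {ι : Type} (y : ι → MaxId) (l : ι),
      1 - PowerSeries.C (1 - nodeU y l) * PowerSeries.X =
        PowerSeries.map (algebraMap XA FracXA) (1 - PowerSeries.C (y l).1 * PowerSeries.X) := by
    intro ι y l
    rw [map_sub (PowerSeries.map _), map_mul, map_one, PowerSeries.map_C, PowerSeries.map_X, nodeU,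
      map_sub (algebraMap XA FracXA), map_one, sub_sub_cancel]
  refine coeff_pos_eq (nodeU_injective hx) _ hr (by simp) _ _ ?_ i
  refine Eq.trans (congrArg₂ _ rfl ?_) (h4.trans (congrArg₂ _ rfl ?_))
  · exact Finset.prod_congr rfl fun l _ => hfac x l
  · exact Finset.prod_congr rfl fun l _ => (hfac (fun i => aM (c i)) l).symm

lemma algebraMap_ev_moment (hx : Function.Injective x) (hr : 0 < r) (z : ℤ) :
    algebraMap XA FracXA (ev (superPoint b c x) (moment b z)) =
      algebraMap XA FracXA (ev (superPoint b c x) (momentConst b)) *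
        ∑ l, nodeWeight (nodeU x) (nodeU fun i => aM (c i)) l * nodeU x l ^ z := by
  cases z with
  | negSucc i =>
    rw [moment, algebraMap_ev_polar b c hx hr]
    simp only [zpow_negSucc]
  | ofNat k =>
    simp only [moment, map_sum, map_mul, map_intCast, algebraMap_ev_pos b c hx hr]
    simp only [Finset.mul_sum]
    rw [Finset.sum_comm]
    refine Finset.sum_congr rfl fun l _ => ?_
    -- The binomial expansion of u^k in powers of x = 1 - u is the source of the coefficients in
    -- `moment`.
    have h := add_pow (-(1 - nodeU x l)) 1 k
    rw [neg_sub, sub_add_cancel] at h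
    change _ = _ * (_ * nodeU x l ^ ((k : ℕ) : ℤ))
    rw [zpow_natCast, h, Finset.mul_sum, Finset.mul_sum]
    refine Finset.sum_congr rfl fun i _ => ?_
    rw [show nodeU x l - 1 = -1 * (1 - nodeU x l) by ring, mul_pow]
    push_cast
    ring

lemma algebraMap_ev_entry (hx : Function.Injective x) (hr : 0 < r) (j : ℕ) (q : Polynomial Ra) :
    algebraMap XA FracXA (ev (superPoint b c x) (entry b j q)) =
      ∑ l, (algebraMap XA FracXA (ev (superPoint b c x) (momentConst b)) *
        algebraMap XA FracXA (evalU (x l) q) *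
          ∏ i, (nodeU (fun i => aM (c i)) i - nodeU x l)) * (nodeDiff (nodeU x) l)⁻¹ *
        (nodeU x l ^ (j + 1))⁻¹ := by
  rw [ev_entry, Polynomial.sum, map_sum]
  simp only [map_mul, algebraMap_ev_moment b c hx hr, Finset.mul_sum]
  rw [Finset.sum_comm]
  refine Finset.sum_congr rfl fun l _ => ?_
  rw [evalU, Polynomial.aeval_eq_sum_range, ← Polynomial.sum_over_range' (p := q)
    (f := fun k c => c • (1 - (x l).1) ^ k) (fun _ => zero_smul _ _) _ (Nat.lt_succ_self _),
    Polynomial.sum, map_sum, Finset.mul_sum, Finset.sum_mul, Finset.sum_mul, Finset.sum_mul]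
  refine Finset.sum_congr rfl fun k _ => ?_
  have h0 := nodeU_ne_zero x l
  rw [Algebra.smul_def, map_mul, map_pow, nodeWeight,
    show ((k : ℤ) - j - 1) = (k : ℤ) - ((j + 1 : ℕ) : ℤ) by push_cast; ring, zpow_sub₀ h0,
    zpow_natCast, zpow_natCast]
  change _ = _ * (_ * nodeU x l ^ k) * _ * _ * _
  rw [div_eq_mul_inv]
  ring

/-- The bialternant formula: the Jacobi–Trudi determinant at a finite alphabet. -/
theorem ev_detLam_mul_det_powers (hx : Function.Injective x) (q : Fin r → Polynomial Ra)
    (p : Fin k → Polynomial Ra) (hp0 : ∀ t, (p t).eval 0 = 1)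
    (hp : ∀ t, (p t).natDegree + t < k) :
    ev (superPoint b c x) (detLam b q) * det (powers (fun l => 1 - (x l).1) finSumFinEquiv) =
      det (of fun i l => Sum.elim (fun i => evalU (x l) (q i * ∏ t, linPoly (c t)))
        (fun (t : Fin k) => evalU (x l) (Polynomial.X ^ (r + (t : ℕ)) * p t)) i) := by
  apply IsFractionRing.injective XA FracXA
  set φ := algebraMap XA FracXA with hφ
  have hmap : ∀ t, ((p t).map (φ.comp (algebraMap Ra XA))).natDegree + t < k := fun t =>
    lt_of_le_of_lt (Nat.add_le_add_right Polynomial.natDegree_map_le _) (hp t)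
  have hmap0 : ∀ t, ((p t).map (φ.comp (algebraMap Ra XA))).eval 0 = 1 := fun t => by
    rw [← map_zero (φ.comp (algebraMap Ra XA)), Polynomial.eval_map_apply, hp0, map_one]
  have hmain := det_block_mul_det_powers (nodeU_injective hx) (nodeU_ne_zero x)
    (fun i l => φ (ev (superPoint b c x) (momentConst b)) * φ (evalU (x l) (q i)) *
      ∏ i, (nodeU (fun i => aM (c i)) i - nodeU x l))
    (fun t => (p t).map (φ.comp (algebraMap Ra XA))) hmap0 hmap
  have hdet : φ (ev (superPoint b c x) (detLam b q)) = det (of fun i j : Fin r => ∑ l,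
      (φ (ev (superPoint b c x) (momentConst b)) * φ (evalU (x l) (q i)) *
        ∏ i, (nodeU (fun i => aM (c i)) i - nodeU x l)) * (nodeDiff (nodeU x) l)⁻¹ *
        (nodeU x l ^ ((j : ℕ) + 1))⁻¹) := by
    rw [detLam, AlgHom.map_det, RingHom.map_det]
    congr 1
    ext i j
    exact algebraMap_ev_entry b c hx (Fin.pos i) j (q i)
  have hpow : φ (det (powers (fun l => 1 - (x l).1) finSumFinEquiv)) =
      det (powers (nodeU x) finSumFinEquiv) := by
    rw [RingHom.map_det]
    congr 1
    ext i l
    simp [powers, nodeU, hφ]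
  rw [map_mul, hdet, hpow, hmain]
  have hprod : ∏ l, nodeU x l ≠ 0 := Finset.prod_ne_zero_iff.2 fun l _ => nodeU_ne_zero x l
  rw [inv_pow, mul_inv_eq_iff_eq_mul₀ (pow_ne_zero _ hprod), RingHom.map_det]
  -- Each of the r upper rows carries ψ ∏ (v_c - u_l), with ψ ∏ v_c = ∏ u. This equals the product
  -- of all nodes times the values of the `linPoly (c t)`, and the r extracted products cancel the
  -- power from the block determinant.
  have hscale := Matrix.det_mul_column (Sum.elim (fun _ : Fin r => ∏ l, nodeU x l)
    (fun _ : Fin k => 1)) (φ.mapMatrix (of fun i l => Sum.elim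
      (fun i => evalU (x l) (q i * ∏ t, linPoly (c t)))
        (fun (t : Fin k) => evalU (x l) (Polynomial.X ^ (r + (t : ℕ)) * p t)) i))
  have hconst : ∀ y : FracXA, ∏ i, Sum.elim (fun _ : Fin r => y) (fun _ : Fin k => 1) i = y ^ r := by
    intro y
    rw [Fintype.prod_sum_type]
    simp
  rw [hconst] at hscale
  rw [mul_comm, ← hscale]
  congr 1
  ext i l
  rcases i with i | t
  · simp only [of_apply, Sum.elim_inl, RingHom.mapMatrix_apply, map_apply, map_mul, map_prod]
    have h1 := congrArg φ (ev_momentConst_superPoint b c x)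
    rw [map_mul, map_prod, map_prod] at h1
    have h2 : ∀ i, φ (1 - (aM (c i)).1) * φ (evalU (x l) (linPoly (c i))) =
        nodeU (fun i => aM (c i)) i - nodeU x l := fun i => by
      rw [← map_mul, mul_evalU_linPoly, map_sub]
      rfl
    simp only [← h2, Finset.prod_mul_distrib]
    change _ = (∏ l, φ (1 - (x l).1)) * _
    rw [← h1]
    ring
  · simp only [of_apply, Sum.elim_inr, RingHom.mapMatrix_apply, map_apply, map_mul, map_pow,
      one_mul, evalU_X]
    rw [Polynomial.eval_map, evalU, Polynomial.aeval_def, Polynomial.hom_eval₂]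
    rfl

end Bialternant

end DoubleKStanley
end

noncomputable section
namespace DoubleKStanley

instance : IsDomain XA := NoZeroDivisors.to_isDomain XA

/-! ### Points as limits of alphabets -/

lemma alph_fin_succ {n : ℕ} (x : Fin (n + 1) → MaxId) (l : Fin (n + 1)) :
    alph x = pt (x l) * alph fun m => x (l.succAbove m) := by
  rw [alph, Fin.prod_univ_succAbove _ l]
  rfl

/-- The point `b_0, …, b_{n-1}`. -/
def initial (b : ℕ → MaxId) (n : ℕ) : Point := ∏ i ∈ Finset.range n, pt (b i)

/-- A function with poles of order at most `r` that vanishes at all supersymmetric alphabets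
with `r` variables vanishes at those with more variables. -/
theorem BoundedPole.eq_zero_of_le {r : ℕ} {Φ : Point → XA} (hΦ : BoundedPole r Φ)
    (b : ℕ → MaxId) (S : Set MaxId)
    (h : ∀ x : Fin r → MaxId, Function.Injective x → (∀ l, x l ∉ S) →
      Φ (alph x * (initial b r)⁻¹) = 0)
    (n : ℕ) (hn : r ≤ n) (x : Fin n → MaxId) (hx : Function.Injective x) (hxS : ∀ l, x l ∉ S) :
    Φ (alph x * (initial b n)⁻¹) = 0 := by
  induction n, hn using Nat.le_induction with
  | base => exact h x hx hxS
  | succ n hn ih =>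
    obtain ⟨p, hp, hp'⟩ := hΦ (alph x * pt (b n) * (initial b (n + 1))⁻¹)
    have hinit : initial b (n + 1) = initial b n * pt (b n) := Finset.prod_range_succ _ _
    -- Setting y = x_l removes one numerator letter and leaves an alphabet covered by the induction
    -- hypothesis. This gives n + 1 distinct zeros of a polynomial of degree at most r ≤ n.
    have hp0 : p = 0 := by
      refine Polynomial.eq_zero_of_natDegree_lt_card_of_eval_eq_zero p (f := fun l => (x l).1)
        (fun l m h => hx (Subtype.ext h)) (fun l => ?_) (by rw [Fintype.card_fin]; omega)
      rw [← hp' (x l)]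
      have := ih (fun m => x (l.succAbove m)) (hx.comp (Fin.succAbove_right_injective))
        fun m => hxS _
      have hE : alph x * pt (b n) * (initial b (n + 1))⁻¹ * (pt (x l))⁻¹ =
          (alph fun m => x (l.succAbove m)) * (initial b n)⁻¹ := by
        rw [alph_fin_succ x l, hinit]
        simp only [mul_inv_rev]
        rw [show pt (x l) * (alph fun m => x (l.succAbove m)) * pt (b n) *
          ((pt (b n))⁻¹ * (initial b n)⁻¹) * (pt (x l))⁻¹ = (pt (x l) * (pt (x l))⁻¹) *
          (pt (b n) * (pt (b n))⁻¹) * ((alph fun m => x (l.succAbove m)) * (initial b n)⁻¹) by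
            ac_rfl, mul_inv_cancel, mul_inv_cancel, one_mul, one_mul]
      rw [hE, this, mul_zero]
    -- Setting y = b_n cancels the auxiliary numerator letter and recovers the original point.
    have h1 := hp' (b n)
    rw [hp0, Polynomial.eval_zero, show alph x * pt (b n) * (initial b (n + 1))⁻¹ * (pt (b n))⁻¹ =
      (pt (b n) * (pt (b n))⁻¹) * (alph x * (initial b (n + 1))⁻¹) by ac_rfl, mul_inv_cancel,
      one_mul] at h1
    exact (mul_eq_zero.1 h1).resolve_left (pow_ne_zero _ (one_sub_ne_zero _))

/-- Reduction of points modulo a truncation ideal. -/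
def redPoint (d : ℤ ⊕ ℤ →₀ ℕ) : Point →* (PowerSeries (XA ⧸ truncIdeal d))ˣ :=
  (Units.map (PowerSeries.map (Ideal.Quotient.mk (truncIdeal d))).toMonoidHom).comp
    pointSubgroup.subtype

lemma coe_redPoint (d : ℤ ⊕ ℤ →₀ ℕ) (E : Point) :
    (redPoint d E : PowerSeries (XA ⧸ truncIdeal d)) =
      PowerSeries.map (Ideal.Quotient.mk (truncIdeal d)) E.ser := rfl

lemma coeff_sub_mem_of_redPoint_eq {d : ℤ ⊕ ℤ →₀ ℕ} {E E' : Point}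
    (h : redPoint d E = redPoint d E') (k : ℕ) :
    PowerSeries.coeff k E.ser - PowerSeries.coeff k E'.ser ∈ truncIdeal d := by
  have h := congrArg (fun u : (PowerSeries (XA ⧸ truncIdeal d))ˣ => PowerSeries.coeff k u.1) h
  simp only [coe_redPoint, PowerSeries.coeff_map] at h
  exact Ideal.Quotient.eq.1 h

lemma redPoint_pt_eq_one {d : ℤ ⊕ ℤ →₀ ℕ} {y : MaxId} (hy : y.1 ∈ truncIdeal d) :
    redPoint d (pt y) = 1 := by
  apply Units.ext
  rw [coe_redPoint, pt_ser, map_add, map_one, map_mul, PowerSeries.map_C,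
    Ideal.Quotient.eq_zero_iff_mem.2 hy, map_zero, zero_mul, add_zero]
  rfl

/-- The sequence tends to zero. -/
def Vanishing (b : ℕ → MaxId) : Prop := ∀ d, ∃ n₀, ∀ n, n₀ ≤ n → (b n).1 ∈ truncIdeal d

lemma aM_mem_truncIdeal {d : ℤ ⊕ ℤ →₀ ℕ} {i : ℤ} (h : d (Sum.inr i) = 0) :
    (aM i).1 ∈ truncIdeal d := by
  classical
  intro d' hd'
  change MvPowerSeries.coeff d' (MvPowerSeries.X _) = 0
  rw [MvPowerSeries.coeff_X, if_neg]
  rintro rfl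
  have := hd' (Sum.inr i)
  simp [h] at this

lemma vanishing_aM {f : ℕ → ℤ} (hf : Function.Injective f) : Vanishing fun n => aM (f n) := by
  intro d
  have hfin : {n | d (Sum.inr (f n)) ≠ 0}.Finite :=
    d.hasFiniteSupport.preimage (fun m _ n _ h => hf (Sum.inr_injective h))
  obtain ⟨B, hB⟩ := hfin.bddAbove
  refine ⟨B + 1, fun n hn => aM_mem_truncIdeal ?_⟩
  by_contra h
  have := hB h
  omega

lemma aM_injective : Function.Injective aM := fun _ _ h =>
  Sum.inr_injective (MvPowerSeries.X_inj.1 (congrArg Subtype.val h))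

lemma xM_injective : Function.Injective xM := fun _ _ h =>
  Sum.inl_injective (MvPowerSeries.X_inj.1 (congrArg Subtype.val h))

lemma xM_ne_aM (i j : ℤ) : xM i ≠ aM j := fun h =>
  Sum.inl_ne_inr (MvPowerSeries.X_inj.1 (congrArg Subtype.val h))

lemma alph_append {m n : ℕ} (x : Fin m → MaxId) (y : Fin n → MaxId) :
    alph (Fin.append x y) = alph x * alph y := by
  simp [alph, Fin.prod_univ_add]

/-- A finite alphabet is the limit of supersymmetric alphabets. -/
lemma exists_redPoint_eq {b : ℕ → MaxId} (hb : Vanishing b) {N : ℕ} (x : Fin N → MaxId)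
    (d : ℤ ⊕ ℤ →₀ ℕ) : ∃ n₀, ∀ n, n₀ ≤ n → redPoint d (alph (Fin.append x fun i : Fin n => b i) *
      (initial b (N + n))⁻¹) = redPoint d (alph x) := by
  obtain ⟨n₀, hn₀⟩ := hb d
  refine ⟨n₀, fun n hn => ?_⟩
  -- The numerator letters b_0, …, b_{n-1} cancel against the denominator. The N letters that remain
  -- there are b_n, …, b_{n+N-1}, which are negligible for large n.
  have h1 : initial b (N + n) = (∏ i ∈ Finset.range N, pt (b (n + i))) * alph fun i : Fin n => b i := by
    rw [initial, add_comm, Finset.prod_range_add, mul_comm, alph,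
      Fin.prod_univ_eq_prod_range (fun i => pt (b i))]
  have h2 : redPoint d (∏ i ∈ Finset.range N, pt (b (n + i))) = 1 := by
    rw [map_prod]
    exact Finset.prod_eq_one fun i _ => redPoint_pt_eq_one (hn₀ _ (by omega))
  rw [alph_append, h1, mul_inv, mul_comm _ (alph fun i : Fin n => b i)⁻¹, ← mul_assoc,
    mul_inv_cancel_right, map_mul, map_inv, h2, inv_one, mul_one]

/-- Elements of the completed tensor square that vanish at pairs of alphabets with `r` variables
vanish at pairs of alphabets of variables. -/
theorem ev₂_alph_eq_zero {r s : ℕ} {F : LamLam}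
    (hF : ∀ E', BoundedPole r fun E => ev₂ E E' F) (hF' : ∀ E, BoundedPole s fun E' => ev₂ E E' F)
    {b c : ℕ → MaxId} (hb : Vanishing b) (hc : Vanishing c)
    (hbc : Function.Injective (Sum.elim b c))
    (h : ∀ (x : Fin r → MaxId) (y : Fin s → MaxId), Function.Injective (Sum.elim x y) →
      ev₂ (alph x * (initial b r)⁻¹) (alph y * (initial c s)⁻¹) F = 0)
    {M N : ℕ} (x : Fin M → MaxId) (y : Fin N → MaxId)
    (hxy : Function.Injective (Sum.elim (Sum.elim x y) (Sum.elim b c))) :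
    ev₂ (alph x) (alph y) F = 0 := by
  have hstep : ∀ m, r ≤ m → ∀ n, s ≤ n → ∀ (x : Fin m → MaxId) (y : Fin n → MaxId),
      Function.Injective (Sum.elim x y) →
      ev₂ (alph x * (initial b m)⁻¹) (alph y * (initial c n)⁻¹) F = 0 := by
    intro m hm n hn x y hxy
    rw [Sum.elim_injective] at hxy
    -- First x is reduced to r letters avoiding those of y, then y is reduced to s letters avoiding
    -- those of the reduced x; thus all letters stay distinct.
    refine (hF _).eq_zero_of_le b (Set.range y) ?_ m hm x hxy.1 ?_
    · intro x hx hxS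
      refine (hF' _).eq_zero_of_le c (Set.range x) ?_ n hn y hxy.2.1 ?_
      · intro y hy hyS
        exact h x y (Sum.elim_injective.2 ⟨hx, hy, fun i j h => hyS j ⟨i, h⟩⟩)
      · rintro j ⟨i, h⟩
        exact hxS i ⟨j, h.symm⟩
    · rintro i ⟨j, h⟩
      exact hxy.2.2 i j h.symm
  apply eq_zero_of_mem_truncIdeal
  intro d
  obtain ⟨m₀, hm₀⟩ := exists_redPoint_eq hb x d
  obtain ⟨n₀, hn₀⟩ := exists_redPoint_eq hc y d
  have h1 := hm₀ (m₀ + r) (by omega)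
  have h2 := hn₀ (n₀ + s) (by omega)
  have h3 := ev₂_congr (coeff_sub_mem_of_redPoint_eq h1) (coeff_sub_mem_of_redPoint_eq h2) F
  rw [hstep _ (by omega) _ (by omega), zero_sub] at h3
  · simpa using h3
  · simp only [Sum.elim_injective] at hxy hbc ⊢
    have hval : ∀ {k : ℕ} {f : ℕ → MaxId}, Function.Injective f →
        Function.Injective fun i : Fin k => f i := fun hf => hf.comp Fin.val_injective
    refine ⟨Fin.append_injective_iff.2 ⟨hxy.1.1, hval hbc.1, fun i j => hxy.2.2 (Sum.inl i) (Sum.inl j)⟩,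
      Fin.append_injective_iff.2 ⟨hxy.1.2.1, hval hbc.2.1, fun i j => hxy.2.2 (Sum.inr i) (Sum.inr j)⟩,
      fun i j => ?_⟩
    induction i using Fin.addCases with
    | left i =>
      rw [Fin.append_left]
      induction j using Fin.addCases with
      | left j => rw [Fin.append_left]; exact hxy.1.2.2 i j
      | right j => rw [Fin.append_right]; exact hxy.2.2 (Sum.inl i) (Sum.inr j)
    | right i =>
      rw [Fin.append_right]
      induction j using Fin.addCases with
      | left j => rw [Fin.append_left]; exact (hxy.2.2 (Sum.inr j) (Sum.inl i)).symm
      | right j => rw [Fin.append_right]; exact hbc.2.2 i j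

/-! ### Algebraic independence of elementary symmetric polynomials in two alphabets -/

section EsymmPair

open MvPolynomial

/-- The elementary symmetric polynomials of positive degree in two alphabets. -/
def esymmPair (N : ℕ) : ℕ ⊕ ℕ → MvPolynomial (Fin N ⊕ Fin N) ℤ :=
  Sum.elim (fun k => rename Sum.inl (esymm (Fin N) ℤ (k + 1)))
    (fun k => rename Sum.inr (esymm (Fin N) ℤ (k + 1)))

lemma isHomogeneous_esymm (σ : Type) [Fintype σ] (n : ℕ) : (esymm σ ℤ n).IsHomogeneous n := by
  refine IsHomogeneous.sum _ _ _ fun t ht => ?_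
  rw [Finset.mem_powersetCard] at ht
  have := IsHomogeneous.prod t (fun i => (X i : MvPolynomial σ ℤ)) (fun _ => 1)
    fun i _ => isHomogeneous_X ℤ i
  simpa [ht.2] using this

lemma isHomogeneous_esymmPair (N : ℕ) (t : ℕ ⊕ ℕ) :
    (esymmPair N t).IsHomogeneous (Sum.elim id id t + 1) := by
  rcases t with k | k
  · exact (isHomogeneous_esymm _ _).rename_isHomogeneous
  · exact (isHomogeneous_esymm _ _).rename_isHomogeneous

/-- The endomorphism of a polynomial ring sending the variables to elementary symmetric
polynomials. -/
def esymmHom (N : ℕ) (R : Type) [CommRing R] : MvPolynomial (Fin N) R →+* MvPolynomial (Fin N) R :=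
  eval₂Hom C fun i : Fin N => esymm (Fin N) R (i + 1)

lemma esymmHom_injective (N : ℕ) (R : Type) [CommRing R] : Function.Injective (esymmHom N R) := by
  have h : ∀ p, esymmHom N R p = (esymmAlgHom (Fin N) R N p).val := fun p =>
    (esymmAlgHom_apply p).symm
  intro p q hpq
  rw [h, h] at hpq
  exact esymmAlgHom_injective R (by simp) (Subtype.ext hpq)

lemma sumAlgEquiv_rename_inl_esymm (N n : ℕ) :
    sumAlgEquiv ℤ (Fin N) (Fin N) (rename Sum.inl (esymm (Fin N) ℤ n)) = esymm (Fin N) _ n := by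
  have h := DFunLike.congr_fun (sumAlgEquiv_comp_rename_inl (R := ℤ) (S₁ := Fin N)
    (S₂ := Fin N)) (esymm (Fin N) ℤ n)
  exact h.trans (map_esymm (Fin N) ℤ n (algebraMap ℤ _))

lemma sumAlgEquiv_rename_inr_esymm (N n : ℕ) :
    sumAlgEquiv ℤ (Fin N) (Fin N) (rename Sum.inr (esymm (Fin N) ℤ n)) =
      C (esymm (Fin N) ℤ n) := by
  exact DFunLike.congr_fun (sumAlgEquiv_comp_rename_inr (R := ℤ) (S₁ := Fin N)
    (S₂ := Fin N)) (esymm (Fin N) ℤ n)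

lemma sumAlgEquiv_aeval_esymmPair (N : ℕ) (p : MvPolynomial (Fin N ⊕ Fin N) ℤ) :
    sumAlgEquiv ℤ (Fin N) (Fin N) (aeval (R := ℤ)
      (fun t : Fin N ⊕ Fin N => esymmPair N (Sum.map Fin.val Fin.val t)) p) =
      esymmHom N _ (MvPolynomial.map (esymmHom N ℤ) (sumAlgEquiv ℤ (Fin N) (Fin N) p)) := by
  induction p using MvPolynomial.induction_on with
  | C n => simp [esymmHom]
  | add p q hp hq => simp only [map_add, hp, hq]
  | mul_X p t hp =>
    rw [map_mul, map_mul, hp, map_mul, map_mul, map_mul, aeval_X]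
    congr 1
    rcases t with t | t
    · rw [sumAlgEquiv_X_inl, map_X]
      refine (sumAlgEquiv_rename_inl_esymm N _).trans ?_
      simp [esymmHom]
    · rw [sumAlgEquiv_X_inr, map_C]
      refine (sumAlgEquiv_rename_inr_esymm N _).trans ?_
      simp [esymmHom]

/-- A polynomial in both alphabets is a polynomial in the first with coefficients in the second, so
two applications of the fundamental theorem of symmetric polynomials suffice. -/
lemma aeval_esymmPair_injective (N : ℕ) : Function.Injective
    (aeval (R := ℤ) fun t : Fin N ⊕ Fin N => esymmPair N (Sum.map Fin.val Fin.val t)) := by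
  intro p q h
  have := congrArg (sumAlgEquiv ℤ (Fin N) (Fin N)) h
  rw [sumAlgEquiv_aeval_esymmPair, sumAlgEquiv_aeval_esymmPair] at this
  exact (sumAlgEquiv ℤ (Fin N) (Fin N)).injective
    (map_injective _ (esymmHom_injective N ℤ) (esymmHom_injective N _ this))

/-- The weight of a monomial in `e_k ⊗ 1`, `1 ⊗ e_k`. -/
def pairWeight (m : ℕ ⊕ ℕ →₀ ℕ) : ℕ := m.sum fun t n => n * (Sum.elim id id t + 1)

lemma mul_le_pairWeight (m : ℕ ⊕ ℕ →₀ ℕ) (t : ℕ ⊕ ℕ) :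
    m t * (Sum.elim id id t + 1) ≤ pairWeight m := by
  by_cases ht : t ∈ m.support
  · exact Finset.single_le_sum (f := fun t => m t * (Sum.elim id id t + 1))
      (fun _ _ => Nat.zero_le _) ht
  · simp [Finsupp.notMem_support_iff.1 ht]

lemma finite_pairWeight (w : ℕ) : {m | pairWeight m = w}.Finite := by
  classical
  let M : ℕ ⊕ ℕ →₀ ℕ := Finsupp.onFinset ((Finset.range w).disjSum (Finset.range w))
    (fun t => if Sum.elim id id t < w then w else 0) (by
      rintro (t | t) h
      · simpa using (ite_ne_right_iff.1 h).1
      · simpa using (ite_ne_right_iff.1 h).1)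
  refine (Set.finite_Iic M).subset fun m hm t => ?_
  have h := mul_le_pairWeight m t
  rw [Set.mem_ofPred_eq] at hm
  rw [hm, mul_add, mul_one] at h
  simp only [M, Finsupp.onFinset_apply]
  split_ifs with ht
  · exact le_trans (Nat.le_add_left _ _) h
  · by_contra h0
    have : 1 ≤ m t := by omega
    nlinarith

/-- The product of elementary symmetric polynomials in two alphabets. -/
def esymmMonomial (N : ℕ) (m : ℕ ⊕ ℕ →₀ ℕ) : MvPolynomial (Fin N ⊕ Fin N) ℤ :=
  m.prod fun t n => esymmPair N t ^ n

lemma isHomogeneous_esymmMonomial (N : ℕ) (m : ℕ ⊕ ℕ →₀ ℕ) :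
    (esymmMonomial N m).IsHomogeneous (pairWeight m) := by
  refine IsHomogeneous.prod _ _ _ fun t _ => ?_
  have := (isHomogeneous_esymmPair N t).pow (m t)
  rwa [mul_comm] at this

/-- A monomial of weight w involves only e_k with k ≤ w ≤ N, and these are algebraically independent
in N variables per alphabet. -/
lemma eq_zero_of_sum_esymmMonomial {w N : ℕ} (hN : w ≤ N) (s : Finset (ℕ ⊕ ℕ →₀ ℕ))
    (hs : ∀ m ∈ s, pairWeight m = w) (c : (ℕ ⊕ ℕ →₀ ℕ) → ℤ)
    (h : ∑ m ∈ s, C (c m) * esymmMonomial N m = 0) (m : ℕ ⊕ ℕ →₀ ℕ) (hm : m ∈ s) : c m = 0 := by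
  classical
  set P : MvPolynomial (ℕ ⊕ ℕ) ℤ := ∑ m ∈ s, monomial m (c m) with hP
  have hvars : (P.vars : Set (ℕ ⊕ ℕ)) ⊆ Set.range (Sum.map Fin.val Fin.val : Fin N ⊕ Fin N → ℕ ⊕ ℕ) := by
    intro t ht
    rw [Finset.mem_coe, mem_vars_iff_mem_support] at ht
    obtain ⟨m, hm, ht⟩ := ht
    have hms : m ∈ s := by
      by_contra hms
      rw [mem_support_iff, hP, coeff_sum] at hm
      refine hm (Finset.sum_eq_zero fun m' hm' => ?_)
      rw [coeff_monomial, if_neg]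
      rintro rfl
      exact hms hm'
    have h1 := mul_le_pairWeight m t
    rw [hs m hms] at h1
    have h2 : 1 ≤ m t := Nat.one_le_iff_ne_zero.2 (Finsupp.mem_support_iff.1 ht)
    have h3 : Sum.elim id id t < N := by nlinarith
    rcases t with t | t
    · exact ⟨Sum.inl ⟨t, h3⟩, rfl⟩
    · exact ⟨Sum.inr ⟨t, h3⟩, rfl⟩
  obtain ⟨Q, hQ⟩ := exists_rename_eq_of_vars_subset_range P _
    (Sum.map_injective.2 ⟨Fin.val_injective, Fin.val_injective⟩) hvars
  have h0 : aeval (R := ℤ) (fun t : Fin N ⊕ Fin N => esymmPair N (Sum.map Fin.val Fin.val t)) Q = 0 := by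
    have h1 : aeval (R := ℤ) (esymmPair N) P = 0 := by
      rw [hP, map_sum, ← h]
      refine Finset.sum_congr rfl fun m _ => ?_
      rw [aeval_monomial]
      rfl
    rw [← hQ, aeval_rename] at h1
    exact h1
  have hQ0 : Q = 0 := aeval_esymmPair_injective N (by rw [h0, map_zero])
  have hP0 : P = 0 := by rw [← hQ, hQ0, map_zero]
  have h2 := congrArg (coeff m) hP0
  rw [hP, coeff_sum, coeff_zero, Finset.sum_eq_single_of_mem m hm] at h2
  · simpa using h2
  · intro m' _ hne
    rw [coeff_monomial, if_neg hne]

/-- The scalar involves only the a_i and the polynomial only the x_i, so their monomials separate.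
This reduces independence over 𝕊 to independence over ℤ. -/
lemma coeff_algebraMap_mul_coe (c : SS) (p : MvPolynomial ℤ ℤ) (β α : ℤ →₀ ℕ) :
    MvPowerSeries.coeff (Finsupp.sumElim β α)
      (algebraMap SS XA c * ((rename Sum.inl p : MvPolynomial (ℤ ⊕ ℤ) ℤ) : MvPowerSeries (ℤ ⊕ ℤ) ℤ)) =
    MvPowerSeries.coeff α c * p.coeff β := by
  classical
  induction p using MvPolynomial.induction_on' with
  | add p q hp hq =>
    rw [map_add, MvPolynomial.coe_add, mul_add, map_add, hp, hq, coeff_add, mul_add]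
  | monomial β' n =>
    rw [rename_monomial, MvPolynomial.coe_monomial, MvPowerSeries.coeff_mul_monomial,
      coeff_monomial]
    have hinr : Finsupp.sumElim (0 : ℤ →₀ ℕ) α = α.embDomain Function.Embedding.inr := by
      ext (i | i)
      · rw [Finsupp.sumElim_inl, Finsupp.embDomain_of_notMem_range]
        · rfl
        · rintro ⟨j, h⟩
          cases h
      · rw [Finsupp.sumElim_inr]
        exact (Finsupp.embDomain_apply_self Function.Embedding.inr α i).symm
    have hinl : ∀ i, Finsupp.mapDomain (Sum.inl : ℤ → ℤ ⊕ ℤ) β' (Sum.inl i) = β' i := fun i =>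
      Finsupp.mapDomain_apply Sum.inl_injective _ _
    have hinl' : ∀ i, Finsupp.mapDomain (Sum.inl : ℤ → ℤ ⊕ ℤ) β' (Sum.inr i) = 0 := fun i =>
      Finsupp.mapDomain_of_notMem_range _ _ (by rintro ⟨j, h⟩; cases h)
    by_cases h : β' = β
    · subst h
      rw [if_pos, if_pos rfl]
      · congr 1
        have : Finsupp.sumElim β' α - Finsupp.mapDomain Sum.inl β' =
            α.embDomain Function.Embedding.inr := by
          rw [← hinr]
          ext (i | i)
          · rw [Finsupp.tsub_apply, hinl, Finsupp.sumElim_inl, Finsupp.sumElim_inl, tsub_self]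
            rfl
          · rw [Finsupp.tsub_apply, hinl', tsub_zero, Finsupp.sumElim_inr, Finsupp.sumElim_inr]
        rw [this]
        exact MvPowerSeries.coeff_embDomain_rename (Function.Embedding.inr : ℤ ↪ ℤ ⊕ ℤ) c α
      · rintro (i | i)
        · rw [hinl, Finsupp.sumElim_inl]
        · rw [hinl']
          exact Nat.zero_le _
    · rw [if_neg h, mul_zero]
      split_ifs with hle
      · refine mul_eq_zero_of_left (MvPowerSeries.coeff_rename_eq_zero _ c ?_) _
        rintro ⟨d', hd'⟩
        apply h
        ext i
        have h1 := DFunLike.congr_fun hd' (Sum.inl i)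
        have h3 : Finsupp.mapDomain (Function.Embedding.inr : ℤ ↪ ℤ ⊕ ℤ) d' (Sum.inl i) = 0 :=
          Finsupp.mapDomain_of_notMem_range _ _ (by rintro ⟨j, h⟩; cases h)
        have h2 := hle (Sum.inl i)
        rw [hinl, Finsupp.sumElim_inl] at h2
        rw [h3, Finsupp.tsub_apply, hinl, Finsupp.sumElim_inl] at h1
        omega
      · rfl

lemma ser_prod {σ : Type*} (s : Finset σ) (E : σ → Point) :
    (∏ i ∈ s, E i).ser = ∏ i ∈ s, (E i).ser := by
  classical
  induction s using Finset.induction_on with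
  | empty => rfl
  | insert i s hi ih => rw [Finset.prod_insert hi, Finset.prod_insert hi, Point.ser_mul, ih]

lemma coeff_prod_pt {σ : Type*} (s : Finset σ) (x : σ → MaxId) (k : ℕ) :
    PowerSeries.coeff k (∏ i ∈ s, pt (x i)).ser = ∑ t ∈ s.powersetCard k, ∏ i ∈ t, (x i).1 := by
  classical
  rw [ser_prod]
  simp only [pt_ser, Finset.prod_one_add, map_sum, Finset.prod_mul_distrib, Finset.prod_const,
    ← map_prod, PowerSeries.coeff_C_mul, PowerSeries.coeff_X_pow, mul_ite, mul_one, mul_zero]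
  rw [← Finset.sum_filter, Finset.powersetCard_eq_filter]
  simp only [eq_comm]

lemma coeff_alph_xM {σ : Type} [Fintype σ] (e : σ → ℤ) (k : ℕ) :
    PowerSeries.coeff k (alph fun i => xM (e i)).ser =
      ((rename (fun i => Sum.inl (e i)) (esymm σ ℤ k) : MvPolynomial (ℤ ⊕ ℤ) ℤ) :
        MvPowerSeries (ℤ ⊕ ℤ) ℤ) := by
  rw [alph, coeff_prod_pt, esymm]
  simp only [map_sum, map_prod, rename_X]
  rw [← MvPolynomial.coeToMvPowerSeries.ringHom_apply, map_sum]
  refine Finset.sum_congr rfl fun t _ => ?_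
  rw [map_prod]
  refine Finset.prod_congr rfl fun i _ => ?_
  rw [MvPolynomial.coeToMvPowerSeries.ringHom_apply, MvPolynomial.coe_X]
  rfl

open scoped MvPowerSeries.WithPiTopology in
/-- Elements of the completed tensor square are determined by their values at pairs of alphabets
of variables. -/
theorem eq_zero_of_ev₂_alph_xM {F : LamLam} (h : ∀ N (e : Fin N ⊕ Fin N ↪ ℤ),
    ev₂ (alph fun i => xM (e (Sum.inl i))) (alph fun i => xM (e (Sum.inr i))) F = 0) : F = 0 := by
  ext m₀ α
  -- Taking as many letters in each alphabet as the weight of the chosen monomial makes all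
  -- elementary symmetric polynomials that it involves independent.
  set w := pairWeight m₀ with hw
  let e : Fin w ⊕ Fin w ↪ ℤ :=
    finSumFinEquiv.toEmbedding.trans (Fin.valEmbedding.trans Nat.castEmbedding)
  set E := alph fun i => xM (e (Sum.inl i))
  set E' := alph fun i => xM (e (Sum.inr i))
  have hval : ∀ t : ℕ ⊕ ℕ, Sum.elim (fun k : ℕ => PowerSeries.coeff (k + 1) E.ser)
      (fun k : ℕ => PowerSeries.coeff (k + 1) E'.ser) t =
      ((rename (fun i => Sum.inl (e i)) (esymmPair w t) : MvPolynomial (ℤ ⊕ ℤ) ℤ) :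
        MvPowerSeries (ℤ ⊕ ℤ) ℤ) := by
    rintro (k | k)
    · rw [Sum.elim_inl, coeff_alph_xM, esymmPair, Sum.elim_inl, rename_rename]
      rfl
    · rw [Sum.elim_inr, coeff_alph_xM, esymmPair, Sum.elim_inr, rename_rename]
      rfl
  have hsum := MvPowerSeries.hasSum_eval₂ continuous_inclA (hasEval_point_pair E E') F
  rw [← coe_evalSeries _ (hasEval_point_pair E E')] at hsum
  change HasSum _ (ev₂ E E' F) at hsum
  rw [h] at hsum
  have hcoeff : ∀ (β : Fin w ⊕ Fin w →₀ ℕ), HasSum (fun m => MvPowerSeries.coeff α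
      (MvPowerSeries.coeff m F) * (esymmMonomial w m).coeff β) 0 := by
    intro β
    have h1 := hsum.map (MvPowerSeries.coeff (R := ℤ) (Finsupp.sumElim (β.mapDomain e) α))
      (MvPowerSeries.WithPiTopology.continuous_coeff ℤ _)
    rw [map_zero] at h1
    refine Eq.subst (motive := fun g => HasSum g (0 : ℤ)) (_root_.funext fun m => ?_) h1
    have h2 : (m.prod fun t n => (Sum.elim (fun k : ℕ => PowerSeries.coeff (k + 1) E.ser)
      (fun k : ℕ => PowerSeries.coeff (k + 1) E'.ser) t) ^ n) =
      ((rename Sum.inl (rename e (esymmMonomial w m)) : MvPolynomial (ℤ ⊕ ℤ) ℤ) :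
        MvPowerSeries (ℤ ⊕ ℤ) ℤ) := by
      simp only [hval]
      rw [rename_rename, esymmMonomial, Finsupp.prod, Finsupp.prod, map_prod,
        ← MvPolynomial.coeToMvPowerSeries.ringHom_apply, map_prod]
      refine Finset.prod_congr rfl fun t _ => ?_
      rw [map_pow, map_pow]
      rfl
    change MvPowerSeries.coeff _ (_ * _) = _
    rw [h2, coeff_algebraMap_mul_coe, coeff_rename_mapDomain _ e.injective]
  have hfin := finite_pairWeight w
  refine eq_zero_of_sum_esymmMonomial le_rfl hfin.toFinset (fun m hm => by simpa using hm)
    (fun m => MvPowerSeries.coeff α (MvPowerSeries.coeff m F)) ?_ m₀ (by simp [hw])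
  ext β
  rw [coeff_sum, coeff_zero]
  simp only [coeff_C_mul]
  -- By homogeneity only the finitely many monomials of weight w contribute in x-degree w, so the
  -- convergent sum becomes finite there; in other degrees the weight w part contributes nothing.
  by_cases hβ : β.degree = w
  · refine HasSum.unique (hasSum_sum_of_ne_finset_zero fun m hm => ?_) (hcoeff β)
    rw [(isHomogeneous_esymmMonomial w m).coeff_eq_zero, mul_zero]
    intro h
    exact hm (by simp [← h, hβ])
  · refine Finset.sum_eq_zero fun m hm => ?_
    rw [(isHomogeneous_esymmMonomial w m).coeff_eq_zero, mul_zero]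
    intro h
    exact hβ (by simpa [h] using hm)

end EsymmPair

/-! ### Determination by values at alphabets with a fixed number of letters -/

/-- Elements of the completed tensor square with bounded poles are determined by their values at
pairs of supersymmetric alphabets with a fixed number of variables. -/
theorem eq_zero_of_ev₂ {r s : ℕ} {F : LamLam}
    (hF : ∀ E', BoundedPole r fun E => ev₂ E E' F) (hF' : ∀ E, BoundedPole s fun E' => ev₂ E E' F)
    {f g : ℕ → ℤ} (hfg : Function.Injective (Sum.elim f g))
    (h : ∀ (x : Fin r → MaxId) (y : Fin s → MaxId), Function.Injective (Sum.elim x y) →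
      ev₂ (alph x * (initial (aM ∘ f) r)⁻¹) (alph y * (initial (aM ∘ g) s)⁻¹) F = 0) : F = 0 := by
  refine eq_zero_of_ev₂_alph_xM fun N e => ?_
  have hfg' := Sum.elim_injective.1 hfg
  refine ev₂_alph_eq_zero hF hF' (vanishing_aM hfg'.1) (vanishing_aM hfg'.2.1) ?_ h _ _ ?_
  · exact Sum.elim_injective.2 ⟨aM_injective.comp hfg'.1, aM_injective.comp hfg'.2.1,
      fun i j h => hfg'.2.2 i j (aM_injective h)⟩
  · refine Sum.elim_injective.2 ⟨Sum.elim_injective.2 ⟨?_, ?_, ?_⟩, Sum.elim_injective.2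
      ⟨aM_injective.comp hfg'.1, aM_injective.comp hfg'.2.1,
      fun i j h => hfg'.2.2 i j (aM_injective h)⟩, ?_⟩
    · exact xM_injective.comp (e.injective.comp Sum.inl_injective)
    · exact xM_injective.comp (e.injective.comp Sum.inr_injective)
    · intro i j h
      cases e.injective (xM_injective h)
    · rintro (i | i) (j | j)
      all_goals exact xM_ne_aM _ _

/-- Elements of `Λ̂(x‖a)` with bounded poles are determined by their values at supersymmetric
alphabets with a fixed number of variables. -/
theorem eq_zero_of_ev {r : ℕ} {F : Lam} (hF : BoundedPole r fun E => ev E F)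
    {f : ℕ → ℤ} (hf : Function.Injective f) (S : Set MaxId)
    (hS : ∀ n, xM n ∉ S) (hS' : ∀ n, aM (f n) ∉ S)
    (h : ∀ x : Fin r → MaxId, Function.Injective x → (∀ l, x l ∉ S) →
      ev (alph x * (initial (aM ∘ f) r)⁻¹) F = 0) : F = 0 := by
  -- Passing to the left factor of the tensor square allows the criterion for two alphabets to be
  -- reused.
  have h0 : inclLeft F = 0 := by
    refine eq_zero_of_ev₂_alph_xM fun N e => ?_
    rw [ev₂_inclLeft]
    apply eq_zero_of_mem_truncIdeal
    intro d
    obtain ⟨n₀, hn₀⟩ := exists_redPoint_eq (vanishing_aM hf) (fun i => xM (e (Sum.inl i))) d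
    have h3 := ev_congr (coeff_sub_mem_of_redPoint_eq (hn₀ (n₀ + r) (by omega))) F
    have h4 := hF.eq_zero_of_le (aM ∘ f) S h (N + (n₀ + r)) (by omega)
      (Fin.append (fun i => xM (e (Sum.inl i))) fun i : Fin (n₀ + r) => aM (f i)) ?_ ?_
    · change ev (_ * (initial (aM ∘ f) _)⁻¹) F - _ ∈ _ at h3
      rw [h4, zero_sub] at h3
      simpa using h3
    · exact Fin.append_injective_iff.2
        ⟨xM_injective.comp (e.injective.comp Sum.inl_injective),
          aM_injective.comp (hf.comp Fin.val_injective), fun i j => xM_ne_aM _ _⟩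
    · intro l
      induction l using Fin.addCases with
      | left i => rw [Fin.append_left]; exact hS _
      | right i => rw [Fin.append_right]; exact hS' _
  exact MvPowerSeries.rename_injective _ (h0.trans (map_zero inclLeft).symm)

end DoubleKStanley
end

noncomputable section
namespace DoubleKStanley

open Polynomial Matrix

/-! ### Alternants -/

section Alternants

variable {R : Type*} [CommRing R] {B : Type*} [CommRing B] [Algebra R B] {n : ℕ}

/-- The alternant `det (q_i(u_l))` as an alternating map in the polynomials `q_i`. -/
def alternant (u : Fin n → B) : R[X] [⋀^Fin n]→ₗ[R] B where
  toFun q := det (of fun i l => aeval (u l) (q i))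
  map_update_add' := @fun inst q i p p' => by
    obtain rfl : inst = instDecidableEqFin n := Subsingleton.elim _ _
    have h : ∀ z : R[X], (of fun j l => aeval (u l) (Function.update q i z j) : Matrix _ _ B) =
        updateRow (of fun j l => aeval (u l) (q j)) i fun l => aeval (u l) z := by
      intro z
      ext j l
      rw [updateRow_apply, of_apply, Function.update_apply]
      split_ifs <;> rfl
    rw [h, h, h, ← det_updateRow_add]
    congr 2
    ext l
    simp
  map_update_smul' := @fun inst q i c p => by
    obtain rfl : inst = instDecidableEqFin n := Subsingleton.elim _ _
    have h : ∀ z : R[X], (of fun j l => aeval (u l) (Function.update q i z j) : Matrix _ _ B) =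
        updateRow (of fun j l => aeval (u l) (q j)) i fun l => aeval (u l) z := by
      intro z
      ext j l
      rw [updateRow_apply, of_apply, Function.update_apply]
      split_ifs <;> rfl
    rw [h, h, Algebra.smul_def c (det _), ← det_updateRow_smul]
    congr 2
    ext l
    simp [Algebra.smul_def]
  map_eq_zero_of_eq' q i j h hij := det_zero_of_row_eq hij (by ext l; simp [h])

lemma alternant_apply (u : Fin n → B) (q : Fin n → R[X]) :
    alternant u q = det (of fun i l => aeval (u l) (q i)) := rfl

lemma map_alternant {B' : Type*} [CommRing B'] [Algebra R B'] (φ : B →ₐ[R] B') (u : Fin n → B)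
    (q : Fin n → R[X]) : φ (alternant u q) = alternant (fun l => φ (u l)) q := by
  rw [alternant_apply, alternant_apply, AlgHom.map_det]
  congr 1
  ext i l
  simp [aeval_algHom_apply]

/-- The exponents of the Vandermonde determinant. -/
def vanRows : Fin n → R[X] := fun i => X ^ (i : ℕ)

/-- The remainder of `q` modulo `∏ (T - X_l)`. -/
def genericRem (n : ℕ) (q : R[X]) : (MvPolynomial (Fin n) R)[X] :=
  q.map MvPolynomial.C %ₘ ∏ l : Fin n, (X - C (MvPolynomial.X l))

/-- The quotient of an alternant by the Vandermonde determinant. -/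
def alternantQuot (q : Fin n → R[X]) : MvPolynomial (Fin n) R :=
  det (of fun i j : Fin n => (genericRem n (q i)).coeff j)

/-- Reducing each q_i modulo ∏ (T - X_l) changes no value at the nodes and brings the degree below
n, so the alternant matrix is a coefficient matrix times the Vandermonde matrix. The identity for
generic nodes then specializes to any algebra. -/
lemma alternant_eq_quot_mul (u : Fin n → B) (q : Fin n → R[X]) :
    alternant u q = MvPolynomial.aeval u (alternantQuot q) * alternant u (vanRows (R := R)) := by
  rcases subsingleton_or_nontrivial R with hR | hR
  · have : Subsingleton B := Module.subsingleton R B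
    exact Subsingleton.elim _ _
  have key : alternant (R := R) (fun l : Fin n => (MvPolynomial.X l : MvPolynomial (Fin n) R)) q =
      alternantQuot q * alternant (fun l : Fin n => (MvPolynomial.X l : MvPolynomial (Fin n) R))
        (vanRows (R := R)) := by
    rw [alternantQuot, alternant_apply, alternant_apply, ← det_mul]
    congr 1
    refine Matrix.ext fun i l => ?_
    have hmonic : (∏ l : Fin n, (X - C (MvPolynomial.X l : MvPolynomial (Fin n) R))).Monic :=
      monic_prod_of_monic _ _ fun l _ => monic_X_sub_C _
    have hdeg : (genericRem n (q i)).natDegree < n ∨ n = 0 := by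
      rcases Nat.eq_zero_or_pos n with h0 | hpos
      · exact Or.inr h0
      · left
        have hnd : (∏ l : Fin n, (X - C (MvPolynomial.X l : MvPolynomial (Fin n) R))).natDegree = n := by
          rw [natDegree_prod_of_monic _ _ fun l _ => monic_X_sub_C _]
          simp
        have h1 := natDegree_modByMonic_lt ((q i).map (MvPolynomial.C (σ := Fin n))) hmonic (by
          intro h
          rw [h, natDegree_one] at hnd
          omega)
        rwa [hnd] at h1
    have hroot : eval (MvPolynomial.X l) (∏ l : Fin n, (X - C (MvPolynomial.X l : MvPolynomial (Fin n) R))) = 0 := by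
      rw [eval_prod]
      exact Finset.prod_eq_zero (Finset.mem_univ l) (by simp)
    have h2 : eval (MvPolynomial.X l) (genericRem n (q i)) = aeval (MvPolynomial.X l) (q i) := by
      have h3 := modByMonic_add_div ((q i).map (MvPolynomial.C (σ := Fin n)))
        (∏ l : Fin n, (X - C (MvPolynomial.X l : MvPolynomial (Fin n) R)))
      have h4 := congrArg (eval (MvPolynomial.X l)) h3
      rw [eval_add, eval_mul, hroot, zero_mul, add_zero, eval_map] at h4
      exact h4
    rw [of_apply, ← h2, mul_apply]
    have hn : (genericRem n (q i)).natDegree < n := hdeg.resolve_right (Fin.pos l).ne'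
    rw [eval_eq_sum_range' hn, Finset.sum_range]
    exact Finset.sum_congr rfl fun j _ => by simp [vanRows]
  have h := congrArg (MvPolynomial.aeval (R := R) u) key
  rw [map_mul, map_alternant, map_alternant] at h
  simpa using h

end Alternants

/-! ### Spanning the exterior power of the polynomial ring -/

section Spanning

variable {R : Type*} [CommRing R] {N : Type*} [AddCommGroup N] [Module R N] {n : ℕ}

/-- Multilinearity, released one row at a time: the induction is on the set of rows allowed to lie
in the span rather than in the generating set. -/
lemma map_mem_of_mem_span {M : Type*} [AddCommGroup M] [Module R M]
    (f : M [⋀^Fin n]→ₗ[R] N) (W : Submodule R N) (T : Fin n → Set M)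
    (h : ∀ p : Fin n → M, (∀ i, p i ∈ T i) → f p ∈ W) (p : Fin n → M)
    (hp : ∀ i, p i ∈ Submodule.span R (T i)) : f p ∈ W := by
  have key : ∀ s : Finset (Fin n), ∀ p : Fin n → M, (∀ i ∈ s, p i ∈ Submodule.span R (T i)) →
      (∀ i ∉ s, p i ∈ T i) → f p ∈ W := by
    intro s
    induction s using Finset.induction_on with
    | empty => exact fun p _ hp => h p fun i => hp i (Finset.notMem_empty i)
    | insert i s hi ih =>
      intro p hp hp'
      have hle : Submodule.span R (T i) ≤ W.comap (f.toMultilinearMap.toLinearMap p i) := by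
        refine Submodule.span_le.2 fun y hy => ?_
        refine ih (Function.update p i y) (fun j hj => ?_) (fun j hj => ?_)
        · rw [Function.update_of_ne (by rintro rfl; exact hi hj)]
          exact hp j (Finset.mem_insert_of_mem hj)
        · rcases eq_or_ne j i with rfl | hne
          · rwa [Function.update_self]
          · rw [Function.update_of_ne hne]
            exact hp' j (by simp [hne, hj])
      have := hle (hp i (Finset.mem_insert_self i s))
      change f (Function.update p i (p i)) ∈ W at this
      rwa [Function.update_eq_self] at this
  exact key Finset.univ p (fun i _ => hp i) fun i hi => absurd (Finset.mem_univ i) hi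

variable {br : ℕ → R[X]} {v : ℕ → Rˣ}

lemma mem_span_range_bracket (h0 : br 0 = 1) (hbr : ∀ k, X * br k = C (v k : R) * (br k - br (k + 1)))
    (q : R[X]) : q ∈ Submodule.span R (Set.range br) := by
  have hX : ∀ q ∈ Submodule.span R (Set.range br), X * q ∈ Submodule.span R (Set.range br) := by
    intro q hq
    induction hq using Submodule.span_induction with
    | mem q hq =>
      obtain ⟨k, rfl⟩ := hq
      rw [hbr, ← smul_eq_C_mul]
      exact Submodule.smul_mem _ _ (Submodule.sub_mem _ (Submodule.subset_span ⟨k, rfl⟩)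
        (Submodule.subset_span ⟨k + 1, rfl⟩))
    | zero => simp
    | add p q _ _ hp hq => rw [mul_add]; exact Submodule.add_mem _ hp hq
    | smul c q _ hq => rw [mul_smul_comm]; exact Submodule.smul_mem _ _ hq
  induction q using Polynomial.induction_on' with
  | add p q hp hq => exact Submodule.add_mem _ hp hq
  | monomial k c =>
    rw [← C_mul_X_pow_eq_monomial, ← smul_eq_C_mul]
    refine Submodule.smul_mem _ _ ?_
    induction k with
    | zero => rw [pow_zero, ← h0]; exact Submodule.subset_span ⟨0, rfl⟩
    | succ k ih => rw [pow_succ']; exact hX _ ih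

/-- Solving the recursion gives br k = v_k⁻¹ X br k + br (k+1), iterated up to K. This is where the
units v_k have to be inverted. -/
lemma bracket_mem_span (hbr : ∀ k, X * br k = C (v k : R) * (br k - br (k + 1))) {K k : ℕ}
    (hk : k ≤ K) : br k ∈ Submodule.span R (insert (br K) ((fun k => X * br k) '' Set.Iio K)) := by
  induction hk using Nat.decreasingInduction with
  | self => exact Submodule.subset_span (Set.mem_insert _ _)
  | of_succ k hk ih =>
    have : br k = ((v k)⁻¹ : Rˣ).val • (X * br k) + br (k + 1) := by
      rw [hbr, smul_eq_C_mul, ← mul_assoc, ← C_mul, Units.inv_mul, C_1]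
      ring
    rw [this]
    refine Submodule.add_mem _ (Submodule.smul_mem _ _ (Submodule.subset_span ?_)) ih
    exact Set.mem_insert_of_mem _ ⟨k, hk, rfl⟩

/-- The alternants of the polynomials `X^i [κ_i]` with `κ` strictly decreasing span the exterior
power. -/
theorem map_mem_of_bracket (f : R[X] [⋀^Fin n]→ₗ[R] N) (W : Submodule R N)
    (h0 : br 0 = 1) (hbr : ∀ k, X * br k = C (v k : R) * (br k - br (k + 1)))
    (hW : ∀ κ : Fin n → ℕ, StrictAnti κ → f (fun i => X ^ (i : ℕ) * br (κ i)) ∈ W)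
    (p : Fin n → R[X]) : f p ∈ W := by
  -- Invariant: the first j rows are already X^i br(κ_i) with κ strictly decreasing, and every later
  -- row is X^j times a combination of br k with k smaller than all the chosen κ_i.
  have key : ∀ j ≤ n, ∀ κ : Fin n → ℕ, (∀ i i' : Fin n, i < i' → (i' : ℕ) < j → κ i' < κ i) →
      ∀ p : Fin n → R[X], (∀ i : Fin n, (i : ℕ) < j → p i = X ^ (i : ℕ) * br (κ i)) →
      (∀ i : Fin n, j ≤ (i : ℕ) → p i ∈ Submodule.span R
        ((fun k => X ^ j * br k) '' {k | ∀ i : Fin n, (i : ℕ) < j → k < κ i})) → f p ∈ W := by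
    intro j hj
    induction hj using Nat.decreasingInduction with
    | self =>
      intro κ hκ p hp _
      rw [_root_.funext fun i => hp i i.2]
      exact hW κ fun i i' h => hκ i i' h i'.2
    | of_succ j hj ih =>
      intro κ hκ p hp hp'
      refine map_mem_of_mem_span f W (fun i => if (i : ℕ) < j then {X ^ (i : ℕ) * br (κ i)} else
        (fun k => X ^ j * br k) '' {k | ∀ i : Fin n, (i : ℕ) < j → k < κ i}) ?_ p ?_
      swap
      · intro i
        split_ifs with h
        · exact Submodule.subset_span (hp i h)
        · exact hp' i (not_lt.1 h)
      clear hp hp' p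
      intro p hp
      have hk : ∀ i : Fin n, ∃ k : ℕ, j ≤ (i : ℕ) → (∀ i : Fin n, (i : ℕ) < j → k < κ i) ∧
          X ^ j * br k = p i := by
        intro i
        by_cases h : (i : ℕ) < j
        · exact ⟨0, fun h' => by omega⟩
        · have := hp i
          rw [if_neg h] at this
          obtain ⟨k, hk, hk'⟩ := this
          exact ⟨k, fun _ => ⟨hk, hk'⟩⟩
      choose k hk using hk
      -- The remaining row with the largest index becomes row j. A repeated largest index means two
      -- equal rows and value zero.
      obtain ⟨i₀, hi₀, hmax⟩ := Finset.exists_max_image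
        (Finset.univ.filter fun i : Fin n => j ≤ (i : ℕ)) k ⟨⟨j, hj⟩, by simp⟩
      simp only [Finset.mem_filter, Finset.mem_univ, true_and] at hi₀ hmax
      set jj : Fin n := ⟨j, hj⟩ with hjj
      have hdist : ∀ i : Fin n, j ≤ (i : ℕ) → i ≠ i₀ → k i = k i₀ → f p ∈ W := by
        intro i hi hne hki
        rw [f.map_eq_zero_of_eq p (i := i) (j := i₀) _ hne]
        · exact W.zero_mem
        · rw [← (hk i hi).2, ← (hk i₀ hi₀).2, hki]
      by_cases hex : ∃ i : Fin n, j ≤ (i : ℕ) ∧ i ≠ i₀ ∧ k i = k i₀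
      · obtain ⟨i, h1, h2, h3⟩ := hex
        exact hdist i h1 h2 h3
      have hlt : ∀ i : Fin n, j ≤ (i : ℕ) → i ≠ i₀ → k i < k i₀ := fun i h1 h2 =>
        lt_of_le_of_ne (hmax i h1) fun h3 => hex ⟨i, h1, h2, h3⟩
      set p' := p ∘ Equiv.swap jj i₀ with hp'
      have hsw : f p' ∈ W → f p ∈ W := by
        intro h
        by_cases hne : jj = i₀
        · rw [hp', hne, Equiv.swap_self] at h
          exact h
        · rw [hp', f.map_swap p hne] at h
          simpa using W.neg_mem h
      apply hsw
      set κ' := Function.update κ jj (k i₀) with hκ'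
      have hκ'lt : ∀ i : Fin n, (i : ℕ) < j → κ' i = κ i := fun i hi =>
        Function.update_of_ne (by rintro rfl; simp [hjj] at hi) _ _
      have hκ'j : κ' jj = k i₀ := Function.update_self _ _ _
      have hp'lt : ∀ i : Fin n, (i : ℕ) < j → p' i = X ^ (i : ℕ) * br (κ i) := by
        intro i hi
        have h1 := hp i
        rw [if_pos hi] at h1
        rw [hp', Function.comp_apply, Equiv.swap_apply_of_ne_of_ne]
        · exact h1
        · rintro rfl; simp [hjj] at hi
        · rintro rfl; omega
      have hp'j : p' jj = X ^ j * br (k i₀) := by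
        rw [hp', Function.comp_apply, Equiv.swap_apply_left, (hk i₀ hi₀).2]
      have hp'gt : ∀ i : Fin n, j < (i : ℕ) → ∃ m < k i₀, p' i = X ^ j * br m := by
        intro i hi
        rw [hp', Function.comp_apply]
        have h3 : j ≤ (Equiv.swap jj i₀ i : ℕ) := by
          rcases eq_or_ne i i₀ with rfl | hne
          · rw [Equiv.swap_apply_right]
          · rw [Equiv.swap_apply_of_ne_of_ne (by rintro rfl; simp [hjj] at hi) hne]
            exact hi.le
        refine ⟨k (Equiv.swap jj i₀ i), hlt _ h3 ?_, (hk _ h3).2.symm⟩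
        intro h4
        rw [Equiv.swap_apply_eq_iff, Equiv.swap_apply_right] at h4
        rw [h4, hjj] at hi
        simp at hi
      -- Below row j, each br m is a combination of br(k i₀) and multiples X br m' with m' < k i₀.
      -- The first repeats row j and contributes zero; the others have the form required at stage j
      -- + 1.
      refine map_mem_of_mem_span f W (fun i => if (i : ℕ) < j then {X ^ (i : ℕ) * br (κ i)} else
        if i = jj then {X ^ j * br (k i₀)} else
          insert (X ^ j * br (k i₀)) ((fun m => X ^ (j + 1) * br m) '' Set.Iio (k i₀))) ?_ p' ?_
      · intro z hz
        by_cases hrow : ∃ i, i ≠ jj ∧ z i = z jj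
        · obtain ⟨i, h1, h2⟩ := hrow
          rw [f.map_eq_zero_of_eq z h2 h1]
          exact W.zero_mem
        · have hzj : z jj = X ^ j * br (k i₀) := by
            have := hz jj
            rw [if_neg (by simp [hjj]), if_pos rfl] at this
            exact this
          refine ih κ' ?_ z ?_ ?_
          · intro i i' hii hi'
            rcases Nat.lt_succ_iff_lt_or_eq.1 hi' with h1 | h1
            · rw [hκ'lt _ h1, hκ'lt _ (lt_trans hii h1)]
              exact hκ i i' hii h1
            · obtain rfl : i' = jj := Fin.ext h1
              have h2 : (i : ℕ) < j := hii
              rw [hκ'j, hκ'lt _ h2]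
              exact (hk i₀ hi₀).1 i h2
          · intro i hi
            rcases Nat.lt_succ_iff_lt_or_eq.1 hi with h1 | h1
            · have := hz i
              rw [if_pos h1] at this
              rw [hκ'lt _ h1]
              exact this
            · obtain rfl : i = jj := Fin.ext h1
              rw [hzj, hκ'j]
          · intro i hi
            have h1 : i ≠ jj := by rintro rfl; simp [hjj] at hi
            have h2 := hz i
            rw [if_neg (by omega), if_neg h1] at h2
            rcases h2 with h2 | ⟨m, hm, h2⟩
            · exact absurd ⟨i, h1, h2.trans hzj.symm⟩ hrow
            · refine Submodule.subset_span ⟨m, ?_, h2⟩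
              intro i' hi'
              rcases Nat.lt_succ_iff_lt_or_eq.1 hi' with h1 | h1
              · rw [hκ'lt _ h1]
                exact lt_trans hm ((hk i₀ hi₀).1 i' h1)
              · obtain rfl : i' = jj := Fin.ext h1
                rw [hκ'j]
                exact hm
      · intro i
        split_ifs with h1 h2
        · exact Submodule.subset_span (hp'lt i h1)
        · subst h2
          exact Submodule.subset_span hp'j
        · have hji : j < (i : ℕ) := lt_of_le_of_ne (not_lt.1 h1) fun h => h2 (Fin.ext h.symm)
          obtain ⟨m, hm, hm'⟩ := hp'gt i hji
          rw [hm']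
          have h3 := Submodule.mem_map_of_mem (f := LinearMap.mulLeft R (X ^ j : R[X]))
            (bracket_mem_span hbr hm.le)
          rw [Submodule.map_span, Set.image_insert_eq, Set.image_image] at h3
          simpa only [LinearMap.mulLeft_apply, pow_succ, mul_assoc] using h3
  -- At stage 0 no index has been chosen, so κ is irrelevant and the condition on k is vacuous.
  refine key 0 (Nat.zero_le n) (fun _ => 0) (fun i i' _ h => by omega) p (fun i h => by omega)
    fun i _ => ?_
  have := mem_span_range_bracket h0 hbr (p i)
  have hset : ((fun k => X ^ 0 * br k) '' {k | ∀ i : Fin n, (i : ℕ) < 0 → k < 0}) = Set.range br := by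
    ext q
    simp
  rwa [hset]

end Spanning

end DoubleKStanley
end

noncomputable section
namespace DoubleKStanley

open Polynomial Matrix

/-! ### The determinants attached to partitions -/

/-- The product `∏ (x ⊖ a_m)` over the `k` integers `m` starting from `1 - n`. -/
def bracket (n k : ℕ) : Polynomial Ra := ∏ m ∈ Finset.range k, linPoly (1 - n + m)

lemma bracket_zero (n : ℕ) : bracket n 0 = 1 := Finset.prod_range_zero _

lemma bracket_succ (n k : ℕ) : bracket n (k + 1) = bracket n k * linPoly (1 - n + k) :=
  Finset.prod_range_succ _ _

lemma C_mul_sub_mul {R : Type*} [CommRing R] (v : Rˣ) (p : R[X]) :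
    C (v : R) * (p - p * (C ((v⁻¹ : Rˣ) : R) * (C (v : R) - X))) = X * p := by
  have h : C (v : R) * C ((v⁻¹ : Rˣ) : R) = 1 := by rw [← C_mul, Units.mul_inv, C_1]
  linear_combination (-p * (C (v : R) - X)) * h

lemma X_mul_bracket (n k : ℕ) :
    X * bracket n k = C (vRa (1 - n + k) : Ra) * (bracket n k - bracket n (k + 1)) := by
  rw [bracket_succ]
  exact (C_mul_sub_mul (vRa (1 - n + k)) (bracket n k)).symm

/-- Enlarging n by k moves the starting index from 1 - n to 1 - n - k. The k new factors belong to
the letters a_{-n}, …, a_{-(n+k-1)}, the denominators of the larger alphabet. -/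
lemma bracket_add (n k j : ℕ) : bracket (n + k) (k + j) =
    bracket n j * ∏ t : Fin k, linPoly (-((n : ℤ) + (t : ℕ))) := by
  rw [bracket, Finset.prod_range_add, mul_comm]
  refine congrArg₂ (· * ·) (Finset.prod_congr rfl fun m _ => congrArg linPoly ?_) ?_
  · push_cast
    ring
  · rw [Fin.prod_univ_eq_prod_range (fun t => linPoly (-((n : ℤ) + (t : ℕ)))) k,
      ← Finset.prod_range_reflect]
    refine Finset.prod_congr rfl fun m hm => ?_
    rw [Finset.mem_range] at hm
    refine congrArg linPoly ?_
    have : ((k - 1 - m : ℕ) : ℤ) = k - 1 - m := by omega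
    rw [this]
    push_cast
    ring

lemma bracket_eval_zero (n k : ℕ) : (bracket n k).eval 0 = 1 := by
  rw [bracket, eval_prod]
  exact Finset.prod_eq_one fun m _ => linPoly_eval_zero _

lemma natDegree_bracket_le (n k : ℕ) : (bracket n k).natDegree ≤ k := by
  refine (natDegree_prod_le _ _).trans ((Finset.sum_le_card_nsmul _ _ 1 fun m _ =>
    natDegree_linPoly_le _).trans ?_)
  simp

/-- The rows of the determinant of a partition, for alphabets with `n` variables. -/
def rowPoly (μ : YoungDiagram) (n : ℕ) (i : Fin n) : Polynomial Ra :=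
  X ^ (i : ℕ) * bracket n (μ.rowLen i + (n - 1 - i))

/-- The sequence `0, -1, -2, …`. -/
def negIdx (n : ℕ) : ℤ := -(n : ℤ)

lemma negIdx_injective : Function.Injective negIdx := fun m n h => by
  simpa [negIdx] using h

/-- The Jacobi–Trudi determinant of a partition. -/
def partDet (μ : YoungDiagram) : Lam :=
  detLam (fun i : Fin (μ.colLen 0) => negIdx i) (rowPoly μ (μ.colLen 0))

/-- The supersymmetric alphabet `(x_1, …, x_n / a_0, …, a_{1-n})`. -/
def superAlph {n : ℕ} (x : Fin n → MaxId) : Point := alph x * (initial (aM ∘ negIdx) n)⁻¹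

/-- The alphabet in the variables `u = 1 - x`. -/
def uVar {ι : Type*} (x : ι → MaxId) (l : ι) : XA := 1 - (x l).1

lemma rowLen_eq_zero {μ : YoungDiagram} {i : ℕ} (h : μ.colLen 0 ≤ i) : μ.rowLen i = 0 := by
  by_contra h0
  have := YoungDiagram.mem_iff_lt_rowLen.2 (Nat.pos_of_ne_zero h0)
  rw [YoungDiagram.mem_iff_lt_colLen] at this
  omega

/-- In the bialternant formula the extra denominators lengthen the brackets of the first r rows by
`bracket_add`. The added rows may be taken to be those of zero parts, since a bracket of length k -
1 - t has value 1 at u = 0 and degree at most k - 1 - t. Hence the value has the same shape for all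
numbers of letters. -/
lemma ev_superAlph_detLam {r k : ℕ} {x : Fin (r + k) → MaxId} (hx : Function.Injective x)
    (μ : YoungDiagram) (hμ : μ.colLen 0 ≤ r) :
    ev (superAlph x) (detLam (fun i : Fin r => negIdx i) (rowPoly μ r)) *
        alternant (uVar x) (vanRows (R := Ra)) =
      alternant (uVar x) (rowPoly μ (r + k)) := by
  set c : Fin k → ℤ := fun t => -((r : ℤ) + (t : ℕ)) with hc
  have hpt : superPoint (fun i : Fin r => negIdx i) c (x ∘ finSumFinEquiv) = superAlph x := by
    have h1 : alph (x ∘ finSumFinEquiv) = alph x := by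
      rw [alph, alph, ← finSumFinEquiv.prod_comp]
      rfl
    have h2 : initial (aM ∘ negIdx) (r + k) = (alph fun i : Fin r => aM (negIdx i)) *
        alph fun t => aM (c t) := by
      rw [initial, Finset.prod_range_add, alph, alph,
        Fin.prod_univ_eq_prod_range (fun i => pt (aM (negIdx i)))]
      congr 1
      rw [hc, Fin.prod_univ_eq_prod_range (fun i => pt (aM (-((r : ℤ) + (i : ℕ)))))]
      refine Finset.prod_congr rfl fun t _ => ?_
      simp [negIdx]
    rw [superPoint, superAlph, h1, h2, mul_inv, mul_assoc]
  have hp : ∀ t : Fin k, (bracket (r + k) (k - 1 - t)).natDegree + t < k := fun t => by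
    have := natDegree_bracket_le (r + k) (k - 1 - t)
    omega
  have h := ev_detLam_mul_det_powers (fun i : Fin r => negIdx i) c
    (hx.comp finSumFinEquiv.injective) (rowPoly μ r) (fun t => bracket (r + k) (k - 1 - t))
    (fun t => bracket_eval_zero _ _) hp
  rw [hpt] at h
  have h1 : det (powers (fun l => 1 - ((x ∘ finSumFinEquiv) l).1) finSumFinEquiv) =
      alternant (uVar x) (vanRows (R := Ra)) := by
    rw [alternant_apply, ← det_submatrix_equiv_self finSumFinEquiv]
    congr 1
    ext1 i l
    simp [powers, vanRows, uVar]
  rw [h1] at h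
  rw [h, alternant_apply, ← det_submatrix_equiv_self finSumFinEquiv]
  congr 1
  refine Matrix.ext fun i l => ?_
  rw [submatrix_apply, of_apply, of_apply]
  rcases i with i | t
  · rw [Sum.elim_inl, finSumFinEquiv_apply_left, evalU]
    refine congrArg (aeval (uVar x _)) ?_
    rw [rowPoly, rowPoly, Fin.val_castAdd, mul_assoc]
    refine congrArg (X ^ (i : ℕ) * ·) ?_
    have hi := i.2
    rw [show μ.rowLen i + (r + k - 1 - i) = k + (μ.rowLen i + (r - 1 - i)) by omega, bracket_add]
  · rw [Sum.elim_inr, finSumFinEquiv_apply_right, evalU]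
    refine congrArg (aeval (uVar x _)) ?_
    rw [rowPoly, Fin.val_natAdd, rowLen_eq_zero (by omega),
      show 0 + (r + k - 1 - (r + (t : ℕ))) = k - 1 - t by omega]

theorem ev_superAlph_partDet {n : ℕ} {x : Fin n → MaxId} (hx : Function.Injective x)
    (μ : YoungDiagram) (hμ : μ.colLen 0 ≤ n) :
    ev (superAlph x) (partDet μ) * alternant (uVar x) (vanRows (R := Ra)) =
      alternant (uVar x) (rowPoly μ n) := by
  obtain ⟨k, rfl⟩ := Nat.exists_eq_add_of_le hμ
  exact ev_superAlph_detLam hx μ le_rfl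

/-! ### Elements with polynomial values -/

/-- The elements of `Λ̂(x‖a)` with poles of order at most `r`. -/
def poleModule (r : ℕ) : Submodule Ra Lam where
  carrier := {f | BoundedPole r fun E => ev E f}
  add_mem' := by
    intro f g hf hg
    have hf : BoundedPole r fun E => ev E f := hf
    have hg : BoundedPole r fun E => ev E g := hg
    simpa only [Set.mem_ofPred_eq, map_add] using hf.add hg
  zero_mem' := by
    simpa only [Set.mem_ofPred_eq, map_zero] using BoundedPole.zero
  smul_mem' := by
    intro c f hf
    have hf : BoundedPole r fun E => ev E f := hf
    simpa only [Set.mem_ofPred_eq, ev_smul] using hf.const_mul _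

lemma partDet_mem_poleModule {μ : YoungDiagram} {r : ℕ} (hμ : μ.colLen 0 ≤ r) :
    partDet μ ∈ poleModule r := (boundedPole_detLam _ _).mono hμ

/-- The variables `a_i` with `i > 0`. -/
def posA : Set MaxId := Set.range fun n : ℕ => aM (n + 1)

/-- The values at supersymmetric alphabets with `r` variables are polynomials in `1 - x`. -/
def PolyValued (r : ℕ) (f : Lam) : Prop :=
  ∃ s : MvPolynomial (Fin r) Ra, ∀ x : Fin r → MaxId, Function.Injective x → (∀ l, x l ∉ posA) →
    ev (superAlph x) f = MvPolynomial.aeval (uVar x) s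

lemma PolyValued.mul {r : ℕ} {f g : Lam} (hf : PolyValued r f) (hg : PolyValued r g) :
    PolyValued r (f * g) := by
  obtain ⟨s, hs⟩ := hf
  obtain ⟨t, ht⟩ := hg
  exact ⟨s * t, fun x hx hx' => by rw [map_mul, map_mul, hs x hx hx', ht x hx hx']⟩

lemma alternant_vanRows {n : ℕ} (u : Fin n → XA) :
    alternant u (vanRows (R := Ra)) = (vandermonde u).det := by
  rw [alternant_apply, ← det_transpose]
  congr 1
  ext1 i l
  simp [vanRows, vandermonde]

lemma uVar_injective {ι : Type*} {x : ι → MaxId} (hx : Function.Injective x) :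
    Function.Injective (uVar x) := fun _ _ h => hx (Subtype.ext (sub_right_injective h))

lemma alternant_vanRows_ne_zero {n : ℕ} {x : Fin n → MaxId} (hx : Function.Injective x) :
    alternant (uVar x) (vanRows (R := Ra)) ≠ 0 := by
  rw [alternant_vanRows]
  exact det_vandermonde_ne_zero_iff.2 (uVar_injective hx)

lemma polyValued_partDet {μ : YoungDiagram} {r : ℕ} (hμ : μ.colLen 0 ≤ r) :
    PolyValued r (partDet μ) := by
  refine ⟨alternantQuot (rowPoly μ r), fun x hx _ => ?_⟩
  apply mul_right_cancel₀ (alternant_vanRows_ne_zero hx)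
  rw [ev_superAlph_partDet hx μ hμ, ← alternant_eq_quot_mul]

/-- Subtracting the staircase n - 1, n - 2, …, 0 from a strictly decreasing sequence leaves a
partition. -/
lemma exists_rowLen_eq {n : ℕ} {κ : Fin n → ℕ} (hκ : StrictAnti κ) :
    ∃ μ : YoungDiagram, μ.colLen 0 ≤ n ∧ ∀ i : Fin n, μ.rowLen i + (n - 1 - i) = κ i := by
  have hle : ∀ i : Fin n, n - 1 - i ≤ κ i := by
    intro i
    obtain ⟨d, hd⟩ : ∃ d, d = n - 1 - (i : ℕ) := ⟨_, rfl⟩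
    rw [← hd]
    induction d generalizing i with
    | zero => exact Nat.zero_le _
    | succ d ih =>
      have hi : (i : ℕ) + 1 < n := by omega
      have h1 := ih ⟨i + 1, hi⟩ (by simp only; omega)
      have h2 := hκ (show i < ⟨i + 1, hi⟩ from Nat.lt_succ_self _)
      omega
  let w : List ℕ := List.ofFn fun i : Fin n => κ i - (n - 1 - i)
  have hw : w.SortedGE := by
    rw [List.sortedGE_ofFn_iff]
    intro i j hij
    rcases eq_or_lt_of_le hij with rfl | hij
    · exact le_rfl
    · have h3 : ∀ d : ℕ, ∀ j : Fin n, (j : ℕ) = i + d → κ j + d ≤ κ i := by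
        intro d
        induction d with
        | zero => intro j hj; rw [show j = i from Fin.ext (by omega)]; rfl
        | succ d ih =>
          intro j hj
          have h1 := ih ⟨i + d, by omega⟩ rfl
          have h2 := hκ (show (⟨i + d, by omega⟩ : Fin n) < j from by
            rw [Fin.lt_def]; simp only; omega)
          omega
      have := h3 (j - i) j (by rw [Fin.lt_def] at hij; omega)
      rw [Fin.lt_def] at hij
      simp only
      omega
  refine ⟨YoungDiagram.ofRowLens w hw, ?_, fun i => ?_⟩
  · by_contra h
    have h1 : (n, 0) ∈ YoungDiagram.ofRowLens w hw := YoungDiagram.mem_iff_lt_colLen.2 (not_le.1 h)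
    rw [YoungDiagram.mem_ofRowLens] at h1
    obtain ⟨h1, _⟩ := h1
    simp [w] at h1
  · have h1 := YoungDiagram.rowLen_ofRowLens (w := w) (hw := hw) ⟨i, by simp [w]⟩
    simp only [w] at h1
    have h2 := hle i
    simp only [w]
    simp only [Fin.getElem_fin, List.getElem_ofFn, Fin.eta] at h1
    omega

/-! ### Expansion of symmetric values in the determinants of partitions -/

/-- The tuples of distinct elements of the maximal ideal that avoid the `a_i` with `i > 0`. -/
abbrev Tuple (r : ℕ) : Type := {x : Fin r → MaxId // Function.Injective x ∧ ∀ l, x l ∉ posA}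

/-- The tuple of functions `u_l = 1 - x_l`. -/
def genU (r : ℕ) (l : Fin r) (y : Tuple r) : XA := uVar y.1 l

lemma alternant_genU {r : ℕ} (q : Fin r → Polynomial Ra) (y : Tuple r) :
    alternant (genU r) q y = alternant (uVar y.1) q :=
  map_alternant (Pi.evalAlgHom Ra (fun _ : Tuple r => XA) y) (genU r) q

/-- The values at supersymmetric alphabets, multiplied by the Vandermonde determinant. -/
def evalVan (r : ℕ) : Lam →ₗ[Ra] Tuple r → XA where
  toFun g y := ev (superAlph y.1) g * alternant (uVar y.1) (vanRows (R := Ra))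
  map_add' g h := by
    ext1 y
    simp only [map_add, add_mul]
    rfl
  map_smul' c g := by
    ext1 y
    change ev _ (c • g) * _ = c • (ev _ g * _)
    rw [ev_smul, Algebra.smul_def, mul_assoc]

lemma evalVan_apply {r : ℕ} (g : Lam) (y : Tuple r) : evalVan r g y =
    ev (superAlph y.1) g * alternant (uVar y.1) (vanRows (R := Ra)) := rfl

lemma evalVan_partDet {r : ℕ} {μ : YoungDiagram} (hμ : μ.colLen 0 ≤ r) :
    evalVan r (partDet μ) = alternant (genU r) (rowPoly μ r) := by
  ext1 y
  rw [alternant_genU]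
  exact ev_superAlph_partDet y.2.1 μ hμ

/-- The spanning theorem is applied to functions on all admissible tuples at once, so the
coefficients of the expansion do not depend on the tuple. -/
lemma alternant_genU_mem (r : ℕ) (q : Fin r → Polynomial Ra) : alternant (genU r) q ∈
    (Submodule.span Ra (partDet '' {μ | μ.colLen 0 ≤ r})).map (evalVan r) := by
  refine map_mem_of_bracket (alternant (genU r)) _ (bracket_zero r) (X_mul_bracket r) ?_ q
  intro κ hκ
  obtain ⟨μ, hμ, hμ'⟩ := exists_rowLen_eq hκ
  refine ⟨partDet μ, Submodule.subset_span ⟨μ, hμ, rfl⟩, ?_⟩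
  rw [evalVan_partDet hμ]
  exact congrArg _ (_root_.funext fun i => by rw [rowPoly, hμ'])

lemma alternant_X_pow {R B : Type*} [CommRing R] [CommRing B] [Algebra R B] {r : ℕ} (u : Fin r → B)
    (e : Fin r → ℕ) : alternant u (fun i => (X : Polynomial R) ^ e i) =
      ∑ σ : Equiv.Perm (Fin r), Equiv.Perm.sign σ • ∏ i, u (σ i) ^ e i := by
  rw [alternant_apply, ← det_transpose, det_apply]
  simp

/-- The product of a symmetric polynomial and the Vandermonde determinant, as a combination of
alternants. -/
lemma symm_mul_alternant {R B : Type*} [CommRing R] [CommRing B] [Algebra R B] {r : ℕ}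
    (u : Fin r → B) (s : MvPolynomial (Fin r) R)
    (hs : ∀ σ : Equiv.Perm (Fin r), MvPolynomial.aeval (u ∘ σ) s = MvPolynomial.aeval u s) :
    MvPolynomial.aeval u s * alternant u (vanRows (R := R)) =
      ∑ m ∈ s.support, s.coeff m • alternant u fun i => (X : Polynomial R) ^ (m i + i) := by
  have hsym : ∀ σ : Equiv.Perm (Fin r), MvPolynomial.aeval u s =
      ∑ m ∈ s.support, s.coeff m • ∏ i, u (σ i) ^ m i := by
    intro σ
    rw [← hs σ, MvPolynomial.aeval_def, MvPolynomial.eval₂_eq]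
    refine Finset.sum_congr rfl fun m _ => ?_
    rw [Algebra.smul_def]
    congr 1
    exact Finset.prod_subset (Finset.subset_univ _) fun i _ hi => by
      rw [Finsupp.notMem_support_iff.1 hi, pow_zero]
  simp only [alternant_X_pow]
  rw [show alternant u (vanRows (R := R)) = _ from alternant_X_pow u fun i => i, Finset.mul_sum]
  simp only [Finset.smul_sum]
  rw [Finset.sum_comm]
  refine Finset.sum_congr rfl fun σ _ => ?_
  -- In the term σ of the Vandermonde determinant the symmetric polynomial is written in the
  -- variables permuted by σ, so that exponents add up to those of an alternant.
  rw [hsym σ, Finset.sum_mul]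
  refine Finset.sum_congr rfl fun m _ => ?_
  rw [mul_smul_comm, smul_mul_assoc, smul_comm, ← Finset.prod_mul_distrib]
  simp only [pow_add]

lemma superAlph_comp_perm {r : ℕ} (x : Fin r → MaxId) (σ : Equiv.Perm (Fin r)) :
    superAlph (x ∘ σ) = superAlph x := by
  rw [superAlph, superAlph, alph, alph, ← Equiv.prod_comp σ (fun l => pt (x l))]
  rfl

lemma evalVan_eq_sum {r : ℕ} {f : Lam} {s : MvPolynomial (Fin r) Ra}
    (hs : ∀ x : Fin r → MaxId, Function.Injective x → (∀ l, x l ∉ posA) →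
      ev (superAlph x) f = MvPolynomial.aeval (uVar x) s) :
    evalVan r f = ∑ m ∈ s.support,
      s.coeff m • alternant (genU r) fun i => (X : Polynomial Ra) ^ (m i + i) := by
  ext1 y
  rw [Finset.sum_apply, evalVan_apply, hs y.1 y.2.1 y.2.2, symm_mul_alternant]
  · refine Finset.sum_congr rfl fun m _ => ?_
    rw [Pi.smul_apply, alternant_genU]
  · intro σ
    rw [← hs y.1 y.2.1 y.2.2, ← superAlph_comp_perm y.1 σ]
    exact (hs _ (y.2.1.comp σ.injective) fun l => y.2.2 _).symm

/-- The values are symmetric because an alphabet ignores the order of its letters, so times the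
Vandermonde determinant they are combinations of alternants. Some g in the span then has the same
values as f with r letters, and the pole bound forces f = g. -/
theorem mem_span_partDet {r : ℕ} {f : Lam} (hf : f ∈ poleModule r) (hs : PolyValued r f) :
    f ∈ Submodule.span Ra (partDet '' {μ | μ.colLen 0 ≤ r}) := by
  obtain ⟨s, hs⟩ := hs
  have hmem : evalVan r f ∈
      (Submodule.span Ra (partDet '' {μ | μ.colLen 0 ≤ r})).map (evalVan r) := by
    rw [evalVan_eq_sum hs]
    exact Submodule.sum_mem _ fun m _ => Submodule.smul_mem _ _ (alternant_genU_mem _ _)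
  obtain ⟨g, hg, hgf⟩ := hmem
  have hgp : g ∈ poleModule r := by
    refine Submodule.span_le.2 ?_ hg
    rintro _ ⟨μ, hμ, rfl⟩
    exact partDet_mem_poleModule hμ
  have hfg : f - g = 0 := by
    refine eq_zero_of_ev (r := r) ((poleModule r).sub_mem hf hgp) negIdx_injective posA ?_ ?_ ?_
    · rintro n ⟨i, hi⟩
      exact xM_ne_aM _ _ hi.symm
    · rintro n ⟨i, hi⟩
      have := aM_injective hi
      simp only [negIdx] at this
      omega
    · intro x hx hxS
      have h1 := congrFun hgf ⟨x, hx, hxS⟩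
      have h2 := mul_right_cancel₀ (alternant_vanRows_ne_zero hx) h1
      change ev (superAlph x) (f - g) = 0
      rw [map_sub, ← h2, sub_self]
  rw [sub_eq_zero.1 hfg]
  exact hg

/-- The span of the determinants of partitions. -/
def partSpan : Submodule Ra Lam := Submodule.span Ra (Set.range partDet)

end DoubleKStanley
end

noncomputable section
namespace DoubleKStanley

open Polynomial Matrix

/-! ### Polynomial values for arbitrary bases -/

/-- The bialternant formula with all auxiliary polynomials equal to 1, divided by the Vandermonde
determinant by means of `alternantQuot`. -/
lemma exists_ev_superPoint_detLam {r k : ℕ} (b : Fin r → ℤ) (c : Fin k → ℤ)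
    (q : Fin r → Polynomial Ra) : ∃ t : MvPolynomial (Fin r ⊕ Fin k) Ra,
      ∀ z : Fin r ⊕ Fin k → MaxId, Function.Injective z →
        ev (superPoint b c z) (detLam b q) = MvPolynomial.aeval (uVar z) t := by
  set Q : Fin (r + k) → Polynomial Ra := fun i => Sum.elim
    (fun i => q i * ∏ t, linPoly (c t)) (fun t : Fin k => X ^ (r + (t : ℕ)) * 1)
    (finSumFinEquiv.symm i) with hQ
  refine ⟨MvPolynomial.rename finSumFinEquiv.symm (alternantQuot Q), fun z hz => ?_⟩
  have h := ev_detLam_mul_det_powers b c hz q (fun _ => 1) (fun _ => eval_one) (fun t => by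
    rw [natDegree_one, zero_add]
    exact t.2)
  set y : Fin (r + k) → MaxId := z ∘ finSumFinEquiv.symm with hy
  have hyinj : Function.Injective y := hz.comp finSumFinEquiv.symm.injective
  have h1 : det (powers (fun l => 1 - (z l).1) finSumFinEquiv) =
      alternant (uVar y) (vanRows (R := Ra)) := by
    rw [alternant_apply, ← det_submatrix_equiv_self finSumFinEquiv]
    refine congrArg det (Matrix.ext fun i l => ?_)
    simp [powers, vanRows, uVar, hy]
  have h2 : det (of fun i l => Sum.elim (fun i => evalU (z l) (q i * ∏ t, linPoly (c t)))
      (fun (t : Fin k) => evalU (z l) (X ^ (r + (t : ℕ)) * 1)) i) = alternant (uVar y) Q := by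
    rw [alternant_apply, ← det_submatrix_equiv_self finSumFinEquiv]
    refine congrArg det (Matrix.ext fun i l => ?_)
    rw [submatrix_apply, of_apply, of_apply, hQ]
    simp only [Equiv.symm_apply_apply]
    have hu : uVar y (finSumFinEquiv l) = 1 - (z l).1 := by simp [uVar, hy]
    rw [hu]
    rcases i with i | t
    · rfl
    · rfl
  rw [h1, h2, alternant_eq_quot_mul (uVar y) Q] at h
  have h3 := mul_right_cancel₀ (alternant_vanRows_ne_zero hyinj) h
  rw [h3, MvPolynomial.aeval_rename]
  rfl

/-- The bialternant formula without additional denominators. -/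
lemma ev_detLam_mul_alternant {r : ℕ} (b : Fin r → ℤ) (q : Fin r → Polynomial Ra)
    {x : Fin r → MaxId} (hx : Function.Injective x) :
    ev (alph x * (alph fun i => aM (b i))⁻¹) (detLam b q) *
      alternant (uVar x) (vanRows (R := Ra)) = alternant (uVar x) q := by
  have hinj : Function.Injective (Sum.elim x (Fin.elim0 : Fin 0 → MaxId)) :=
    Sum.elim_injective.2 ⟨hx, fun i => i.elim0, fun _ i => i.elim0⟩
  have h := ev_detLam_mul_det_powers b (Fin.elim0 : Fin 0 → ℤ) hinj q Fin.elim0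
    (fun t => t.elim0) (fun t => t.elim0)
  have hpt : superPoint b (Fin.elim0 : Fin 0 → ℤ) (Sum.elim x (Fin.elim0 : Fin 0 → MaxId)) =
      alph x * (alph fun i => aM (b i))⁻¹ := by
    simp [superPoint, alph]
  rw [hpt] at h
  have h1 : det (powers (fun l => 1 - (Sum.elim x (Fin.elim0 : Fin 0 → MaxId) l).1)
      finSumFinEquiv) = alternant (uVar x) (vanRows (R := Ra)) := by
    rw [alternant_apply, ← det_submatrix_equiv_self (Equiv.sumEmpty (Fin r) (Fin 0))]
    refine congrArg det (Matrix.ext fun i l => ?_)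
    rcases i with i | i
    · rcases l with l | l
      · simp [powers, vanRows, uVar]
        rfl
      · exact l.elim0
    · exact i.elim0
  rw [h1] at h
  rw [h, alternant_apply, ← det_submatrix_equiv_self (Equiv.sumEmpty (Fin r) (Fin 0))]
  refine congrArg det (Matrix.ext fun i l => ?_)
  rcases i with i | i
  · rcases l with l | l
    · rw [of_apply, Sum.elim_inl, Fintype.prod_empty, mul_one]
      rfl
    · exact l.elim0
  · exact i.elim0

/-- The sequence `1, 2, 3, …`. -/
def posIdx (n : ℕ) : ℤ := n + 1

lemma posIdx_injective : Function.Injective posIdx := fun m n h => by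
  simpa [posIdx] using h

lemma negIdx_ne_posIdx (m n : ℕ) : negIdx m ≠ posIdx n := by
  simp only [negIdx, posIdx]
  omega

lemma alph_fin (f : ℕ → ℤ) (r : ℕ) :
    (alph fun i : Fin r => aM (f i)) = initial (aM ∘ f) r :=
  Fin.prod_univ_eq_prod_range (fun i => pt (aM (f i))) r

lemma detLam_neg_mem {r : ℕ} (q : Fin r → Polynomial Ra) :
    detLam (fun i : Fin r => negIdx i) q ∈
      Submodule.span Ra (partDet '' {μ | μ.colLen 0 ≤ r}) := by
  refine mem_span_partDet (boundedPole_detLam _ _) ⟨alternantQuot q, fun x hx _ => ?_⟩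
  have h := ev_detLam_mul_alternant (fun i : Fin r => negIdx i) q hx
  rw [alph_fin, alternant_eq_quot_mul (uVar x) q] at h
  exact mul_right_cancel₀ (alternant_vanRows_ne_zero hx) h

/-- Adjoining a_1, …, a_r to numerator and denominator turns (x / a_0, …, a_{1-r}) into a point of
the shape required for the base a_1, …, a_r. The numerator must stay injective, which is why the
tuples in `PolyValued` avoid `posA`. -/
lemma detLam_pos_mem {r : ℕ} (q : Fin r → Polynomial Ra) :
    detLam (fun i : Fin r => posIdx i) q ∈
      Submodule.span Ra (partDet '' {μ | μ.colLen 0 ≤ r}) := by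
  obtain ⟨t, ht⟩ := exists_ev_superPoint_detLam (fun i : Fin r => posIdx i)
    (fun i : Fin r => negIdx i) q
  refine mem_span_partDet (boundedPole_detLam _ _) ⟨MvPolynomial.aeval (Sum.elim
    MvPolynomial.X fun i : Fin r => MvPolynomial.C (vRa (posIdx i) : Ra)) t, fun x hx hx' => ?_⟩
  have hpt : superPoint (fun i : Fin r => posIdx i) (fun i : Fin r => negIdx i)
      (Sum.elim x fun i : Fin r => aM (posIdx i)) = superAlph x := by
    rw [superPoint, superAlph, ← alph_fin]
    have : alph (Sum.elim x fun i : Fin r => aM (posIdx i)) =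
        alph x * alph fun i : Fin r => aM (posIdx i) := by
      rw [alph, Fintype.prod_sum_type]
      rfl
    rw [this, mul_inv_cancel_right]
  rw [← hpt, ht]
  · rw [← AlgHom.comp_apply]
    refine DFunLike.congr_fun (MvPolynomial.algHom_ext fun i => ?_) t
    rcases i with i | i
    · simp [uVar]
    · simp only [MvPolynomial.aeval_X, AlgHom.comp_apply, Sum.elim_inr, MvPolynomial.aeval_C]
      exact (algebraMap_vRa _).symm
  · refine Sum.elim_injective.2 ⟨hx, aM_injective.comp (posIdx_injective.comp Fin.val_injective),
      fun i j h => hx' i ⟨j, h.symm⟩⟩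

/-! ### The coproduct -/

lemma symm_mul_alternant₂ {R B : Type*} [CommRing R] [CommRing B] [Algebra R B] {r : ℕ}
    (u w : Fin r → B) (s : MvPolynomial (Fin r ⊕ Fin r) R)
    (hs : ∀ σ τ : Equiv.Perm (Fin r), MvPolynomial.aeval (Sum.elim (u ∘ σ) (w ∘ τ)) s =
      MvPolynomial.aeval (Sum.elim u w) s) :
    MvPolynomial.aeval (Sum.elim u w) s *
        (alternant u (vanRows (R := R)) * alternant w (vanRows (R := R))) =
      ∑ m ∈ s.support, s.coeff m •
        ((alternant u fun i => (X : Polynomial R) ^ (m (Sum.inl i) + i)) *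
          alternant w fun i => (X : Polynomial R) ^ (m (Sum.inr i) + i)) := by
  have hsym : ∀ σ τ : Equiv.Perm (Fin r), MvPolynomial.aeval (Sum.elim u w) s =
      ∑ m ∈ s.support, s.coeff m •
        ((∏ i, u (σ i) ^ m (Sum.inl i)) * ∏ i, w (τ i) ^ m (Sum.inr i)) := by
    intro σ τ
    rw [← hs σ τ, MvPolynomial.aeval_def, MvPolynomial.eval₂_eq]
    refine Finset.sum_congr rfl fun m _ => ?_
    rw [Algebra.smul_def]
    congr 1
    rw [Finset.prod_subset (Finset.subset_univ _) fun i _ hi => by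
      rw [Finsupp.notMem_support_iff.1 hi, pow_zero], Fintype.prod_sum_type]
    rfl
  simp only [alternant_X_pow]
  rw [show alternant u (vanRows (R := R)) = _ from alternant_X_pow u fun i => i,
    show alternant w (vanRows (R := R)) = _ from alternant_X_pow w fun i => i]
  simp only [Finset.sum_mul_sum]
  simp only [Finset.mul_sum, Finset.smul_sum]
  rw [eq_comm, Finset.sum_comm]
  refine Finset.sum_congr rfl fun σ _ => ?_
  rw [Finset.sum_comm]
  refine Finset.sum_congr rfl fun τ _ => ?_
  rw [eq_comm, hsym σ τ, Finset.sum_mul]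
  refine Finset.sum_congr rfl fun m _ => ?_
  simp only [pow_add, Finset.prod_mul_distrib, Units.smul_def, Algebra.smul_def]
  ring

/-- At a pair (x / a_0, a_{-1}, …), (y / a_1, a_2, …) the value of the coproduct is a polynomial in
1 - x and 1 - y, symmetric in each set. Times both Vandermonde determinants it is a combination of
products of alternants, and each factor is the numerator of a determinant with base `negIdx` or
`posIdx`. Pole bounds in each argument promote this to an identity. -/
theorem Delta_partDet (μ : YoungDiagram) : ∃ (ι : Type) (t : Finset ι) (g h : ι → Lam),
    (∀ i, g i ∈ Submodule.span Ra (Set.range partDet)) ∧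
    (∀ i, h i ∈ Submodule.span Ra (Set.range partDet)) ∧
    Delta (partDet μ) = ∑ i ∈ t, inclLeft (g i) * inclRight (h i) := by
  set r := μ.colLen 0 with hr
  obtain ⟨s, hs⟩ := exists_ev_superPoint_detLam (fun i : Fin r => negIdx i)
    (fun i : Fin r => posIdx i) (rowPoly μ r)
  let g : (Fin r ⊕ Fin r →₀ ℕ) → Lam := fun m => s.coeff m •
    detLam (fun i : Fin r => negIdx i) fun i => X ^ (m (Sum.inl i) + i)
  let h : (Fin r ⊕ Fin r →₀ ℕ) → Lam := fun m =>
    detLam (fun i : Fin r => posIdx i) fun i => X ^ (m (Sum.inr i) + i)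
  refine ⟨_, s.support, g, h, fun m => ?_, fun m => ?_, ?_⟩
  · exact Submodule.smul_mem _ _
      (Submodule.span_mono (Set.image_subset_range _ _) (detLam_neg_mem _))
  · exact Submodule.span_mono (Set.image_subset_range _ _) (detLam_pos_mem _)
  have hpole : BoundedPole r fun E => ev E (partDet μ) := boundedPole_detLam _ _
  have hg : ∀ m, BoundedPole r fun E => ev E (g m) := fun m =>
    (poleModule r).smul_mem _ (boundedPole_detLam _ _)
  have hh : ∀ m, BoundedPole r fun E => ev E (h m) := fun m => boundedPole_detLam _ _
  rw [← sub_eq_zero]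
  refine eq_zero_of_ev₂ (r := r) (s := r) (f := negIdx) (g := posIdx) ?_ ?_ ?_ ?_
  · intro E'
    simp only [map_sub, map_sum, map_mul, ev₂_Delta, ev₂_inclLeft, ev₂_inclRight, mul_comm _ E',
      mul_comm _ (ev E' _)]
    exact (hpole.comp_mul E').sub (BoundedPole.sum _ _ fun m _ => (hg m).const_mul _)
  · intro E
    simp only [map_sub, map_sum, map_mul, ev₂_Delta, ev₂_inclLeft, ev₂_inclRight]
    exact (hpole.comp_mul E).sub (BoundedPole.sum _ _ fun m _ => (hh m).const_mul _)
  · exact Sum.elim_injective.2 ⟨negIdx_injective, posIdx_injective, negIdx_ne_posIdx⟩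
  · intro x y hxy
    have hxy' := Sum.elim_injective.1 hxy
    -- The product of the two alphabets is a single point with base a_0, …, a_{1-r} and extra
    -- denominators a_1, …, a_r.
    have hval : ∀ x y : Fin r → MaxId, Function.Injective (Sum.elim x y) →
        ev ((alph x * (initial (aM ∘ negIdx) r)⁻¹) * (alph y * (initial (aM ∘ posIdx) r)⁻¹))
          (partDet μ) = MvPolynomial.aeval (Sum.elim (uVar x) (uVar y)) s := by
      intro x y hxy
      have h1 := hs (Sum.elim x y) hxy
      have hpt : superPoint (fun i : Fin r => negIdx i) (fun i : Fin r => posIdx i)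
          (Sum.elim x y) = (alph x * (initial (aM ∘ negIdx) r)⁻¹) *
            (alph y * (initial (aM ∘ posIdx) r)⁻¹) := by
        rw [superPoint, alph_fin, alph_fin]
        have : alph (Sum.elim x y) = alph x * alph y := by
          rw [alph, Fintype.prod_sum_type]
          rfl
        rw [this]
        ac_rfl
      rw [hpt] at h1
      rw [partDet, h1]
      congr 1
      refine congrArg _ (_root_.funext fun i => ?_)
      rcases i with i | i <;> rfl
    rw [map_sub, map_sum, ev₂_Delta]
    simp only [map_mul, ev₂_inclLeft, ev₂_inclRight]
    rw [sub_eq_zero]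
    have hVx := alternant_vanRows_ne_zero hxy'.1
    have hVy := alternant_vanRows_ne_zero hxy'.2.1
    apply mul_right_cancel₀ (mul_ne_zero hVx hVy)
    rw [hval x y hxy, symm_mul_alternant₂, Finset.sum_mul]
    · refine Finset.sum_congr rfl fun m _ => ?_
      have h1 := ev_detLam_mul_alternant (fun i : Fin r => negIdx i)
        (fun i => X ^ (m (Sum.inl i) + i)) hxy'.1
      have h2 := ev_detLam_mul_alternant (fun i : Fin r => posIdx i)
        (fun i => X ^ (m (Sum.inr i) + i)) hxy'.2.1
      rw [alph_fin] at h1 h2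
      rw [← h1, ← h2, ev_smul, Algebra.smul_def]
      ring
    · intro σ τ
      have hperm : ∀ (z : Fin r → MaxId) (σ : Equiv.Perm (Fin r)), alph (z ∘ σ) = alph z := by
        intro z σ
        rw [alph, alph, ← Equiv.prod_comp σ (fun l => pt (z l))]
        rfl
      have h1 := hval (x ∘ σ) (y ∘ τ) (Sum.elim_injective.2 ⟨hxy'.1.comp σ.injective,
        hxy'.2.1.comp τ.injective, fun i j => hxy'.2.2 _ _⟩)
      rw [hperm, hperm, hval x y hxy] at h1
      exact h1.symm

end DoubleKStanley
end

noncomputable section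
namespace DoubleKStanley

open Polynomial Matrix

/-! ### Localization at partitions -/

/-- The tuple `a_{μ_1}, a_{μ_2 - 1}, …`. -/
def locTuple (μ : YoungDiagram) (n : ℕ) (l : Fin n) : MaxId := aM ((μ.rowLen l : ℤ) - (l : ℕ))

/-- The point at which elements of `Λ̂(x‖a)` are localized at `μ`. -/
def locPoint (μ : YoungDiagram) : Point := superAlph (locTuple μ (μ.colLen 0))

/-- For a zero part the numerator letter is a_{-l}, which cancels the denominator letter of the same
index. -/
lemma superAlph_locTuple {μ : YoungDiagram} {n : ℕ} (hn : μ.colLen 0 ≤ n) :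
    superAlph (locTuple μ n) = locPoint μ := by
  have h : ∀ n, superAlph (locTuple μ n) = ∏ l ∈ Finset.range n,
      (pt (aM ((μ.rowLen l : ℤ) - (l : ℕ))) * (pt (aM (negIdx l)))⁻¹) := by
    intro n
    rw [Finset.prod_mul_distrib, Finset.prod_inv_distrib]
    exact congrArg₂ (· * ·)
      (Fin.prod_univ_eq_prod_range (fun l => pt (aM ((μ.rowLen l : ℤ) - (l : ℕ)))) n) rfl
  rw [locPoint, h, h]
  refine (Finset.prod_subset (Finset.range_subset_range.2 hn) fun l _ hl => ?_).symm
  rw [Finset.mem_range, not_lt] at hl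
  rw [rowLen_eq_zero hl, show ((0 : ℕ) : ℤ) - (l : ℕ) = negIdx l by simp [negIdx], mul_inv_cancel]

lemma locTuple_injective (μ : YoungDiagram) (n : ℕ) : Function.Injective (locTuple μ n) := by
  intro l m h
  have h := aM_injective h
  have h1 := μ.rowLen_anti l m
  have h2 := μ.rowLen_anti m l
  apply Fin.ext
  omega

lemma evalU_linPoly_eq_zero_iff (i j : ℤ) : evalU (aM j) (linPoly i) = 0 ↔ j = i := by
  have h := mul_evalU_linPoly (aM j) i
  constructor
  · intro h0
    rw [h0, mul_zero] at h
    apply aM_injective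
    apply Subtype.ext
    linear_combination -h
  · rintro rfl
    rw [sub_self] at h
    exact (mul_eq_zero.1 h).resolve_left (one_sub_ne_zero _)

lemma evalU_bracket_eq_zero_iff (n k : ℕ) (j : ℤ) :
    evalU (aM j) (bracket n k) = 0 ↔ 1 - (n : ℤ) ≤ j ∧ j < 1 - n + k := by
  rw [bracket, map_prod, Finset.prod_eq_zero_iff]
  simp only [evalU_linPoly_eq_zero_iff, Finset.mem_range]
  constructor
  · rintro ⟨m, hm, rfl⟩
    omega
  · rintro ⟨h1, h2⟩
    exact ⟨(j - (1 - n)).toNat, by omega, by omega⟩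

/-- The power of u is nonzero, and the bracket vanishes at a_j for 1 - n ≤ j < ν_i - i. The lower
bound is automatic for j = μ_l - l since l < n. -/
lemma aeval_rowPoly_locTuple_eq_zero_iff (ν μ : YoungDiagram) {n : ℕ} (i l : Fin n) :
    aeval (uVar (locTuple μ n) l) (rowPoly ν n i) = 0 ↔
      (μ.rowLen l : ℤ) - (l : ℕ) < ν.rowLen i - (i : ℕ) := by
  change evalU (aM _) _ = 0 ↔ _
  rw [rowPoly, map_mul, map_pow, evalU_X, mul_eq_zero, or_iff_right (pow_ne_zero _ (one_sub_ne_zero _)),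
    evalU_bracket_eq_zero_iff]
  have hi := i.2
  have hl := l.2
  have : ((ν.rowLen i + (n - 1 - i) : ℕ) : ℤ) = ν.rowLen i + (n - 1 - (i : ℕ)) := by omega
  rw [this]
  constructor
  · rintro ⟨h1, h2⟩
    omega
  · intro h
    omega

/-- By counting, a permutation cannot send all the columns from i₀ on to rows beyond i₀, so every
Leibniz term meets the zero block. -/
lemma det_eq_zero_of_block {R : Type*} [CommRing R] {n : ℕ} (M : Matrix (Fin n) (Fin n) R)
    (i₀ : Fin n) (h : ∀ i l, i ≤ i₀ → i₀ ≤ l → M i l = 0) : M.det = 0 := by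
  rw [det_apply']
  refine Finset.sum_eq_zero fun σ _ => ?_
  obtain ⟨l, hl, hl'⟩ : ∃ l, σ l ≤ i₀ ∧ i₀ ≤ l := by
    by_contra hcon
    push Not at hcon
    have h1 : Finset.card (Finset.Iic i₀) ≤ Finset.card (Finset.Iio i₀) := by
      refine Finset.card_le_card_of_injOn σ.symm (fun i hi => ?_) σ.symm.injective.injOn
      simp only [Finset.coe_Iio, Set.mem_Iio]
      exact hcon _ (by simpa using hi)
    simp at h1
  rw [Finset.prod_eq_zero (f := fun i => M (σ i) i) (Finset.mem_univ l) (h _ _ hl hl'), mul_zero]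

lemma ev_locPoint_mul {ν μ : YoungDiagram} {n : ℕ} (hν : ν.colLen 0 ≤ n) (hμ : μ.colLen 0 ≤ n) :
    ev (locPoint μ) (partDet ν) * alternant (uVar (locTuple μ n)) (vanRows (R := Ra)) =
      alternant (uVar (locTuple μ n)) (rowPoly ν n) := by
  rw [← superAlph_locTuple hμ]
  exact ev_superAlph_partDet (locTuple_injective μ n) ν hν

/-- If μ_{i₀} < ν_{i₀}, then μ_l - l < ν_i - i for all i ≤ i₀ ≤ l, and this zero block kills the
alternant. -/
theorem le_of_ev_locPoint_ne_zero {ν μ : YoungDiagram} (h : ev (locPoint μ) (partDet ν) ≠ 0) :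
    ν ≤ μ := by
  by_contra hle
  apply h
  set n := max (ν.colLen 0) (μ.colLen 0)
  have h1 := ev_locPoint_mul (ν := ν) (μ := μ) (n := n) (le_max_left _ _) (le_max_right _ _)
  apply (mul_eq_zero.1 (h1.trans ?_)).resolve_right
    (alternant_vanRows_ne_zero (locTuple_injective μ n))
  obtain ⟨i₀, hi₀⟩ : ∃ i, μ.rowLen i < ν.rowLen i := by
    by_contra hcon
    push Not at hcon
    apply hle
    rintro ⟨i, j⟩ hij
    change (i, j) ∈ ν at hij
    rw [YoungDiagram.mem_iff_lt_rowLen] at hij ⊢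
    exact lt_of_lt_of_le hij (hcon i)
  have hi₀n : i₀ < n := by
    by_contra hcon
    rw [rowLen_eq_zero ((le_max_left _ _).trans (not_lt.1 hcon))] at hi₀
    omega
  refine det_eq_zero_of_block _ ⟨i₀, hi₀n⟩ fun i l hi hl => ?_
  refine (aeval_rowPoly_locTuple_eq_zero_iff ν μ i l).2 ?_
  have h2 := ν.rowLen_anti i i₀ hi
  have h3 := μ.rowLen_anti i₀ l hl
  rw [Fin.le_def] at hi hl
  simp only at hi hl
  omega

/-- For ν = μ the alternant matrix is lower triangular with nonzero diagonal, because μ_i - i is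
strictly decreasing. -/
theorem ev_locPoint_self_ne_zero (μ : YoungDiagram) : ev (locPoint μ) (partDet μ) ≠ 0 := by
  intro h
  have h1 := ev_locPoint_mul (ν := μ) (μ := μ) le_rfl le_rfl
  rw [h, zero_mul, alternant_apply, det_of_isLowerTriangular] at h1
  · obtain ⟨i, _, hi⟩ := Finset.prod_eq_zero_iff.1 h1.symm
    exact lt_irrefl _ ((aeval_rowPoly_locTuple_eq_zero_iff μ μ i i).1 hi)
  · intro i l hil
    refine (aeval_rowPoly_locTuple_eq_zero_iff μ μ i l).2 ?_
    have hil : i < l := hil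
    have h2 := μ.rowLen_anti i l hil.le
    rw [Fin.lt_def] at hil
    omega

lemma algebraMap_Ra_XA_injective : Function.Injective (algebraMap Ra XA) := fun _ _ h =>
  Subtype.ext (MvPowerSeries.rename_injective (Function.Embedding.inr : ℤ ↪ ℤ ⊕ ℤ) h)

/-- At a minimal index j of the support of c, only the diagonal term survives in the j-th relation.
-/
lemma eq_zero_of_triangular {ι : Type*} [PartialOrder ι] (c : ι →₀ Ra) (a : ι → ι → XA)
    (ha : ∀ i j, a i j ≠ 0 → i ≤ j) (hd : ∀ i, a i i ≠ 0)
    (h : ∀ j, c.sum (fun i t => algebraMap Ra XA t * a i j) = 0) : c = 0 := by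
  by_contra hc
  obtain ⟨j, hj⟩ := Finset.exists_minimal (Finsupp.support_nonempty_iff.2 hc)
  have h1 := h j
  rw [Finsupp.sum, Finset.sum_eq_single_of_mem j hj.1] at h1
  · have h2 := (mul_eq_zero.1 h1).resolve_right (hd j)
    rw [← map_zero (algebraMap Ra XA)] at h2
    exact Finsupp.mem_support_iff.1 hj.1 (algebraMap_Ra_XA_injective h2)
  · intro i hi hij
    by_contra hne
    have hle := ha i j (right_ne_zero_of_mul hne)
    exact hij (le_antisymm hle (hj.2 hi hle))

/-! ### The bialgebra -/

theorem linearIndependent_partDet : LinearIndependent Ra partDet := by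
  rw [linearIndependent_iff]
  intro c hc
  refine eq_zero_of_triangular c (fun ν μ => ev (locPoint μ) (partDet ν))
    (fun ν μ h => le_of_ev_locPoint_ne_zero h) ev_locPoint_self_ne_zero fun μ => ?_
  have h := congrArg (ev (locPoint μ)) hc
  rw [Finsupp.linearCombination_apply, Finsupp.sum, map_sum, map_zero] at h
  simp only [ev_smul] at h
  exact h

/-- Polynomiality is recorded for all large r, not for one r, so that two elements can be compared
at a common level. -/
lemma exists_mem_level {f : Lam} (hf : f ∈ partSpan) :
    ∃ r₀, ∀ r, r₀ ≤ r → PolyValued r f := by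
  induction hf using Submodule.span_induction with
  | mem f hf =>
    obtain ⟨μ, rfl⟩ := hf
    exact ⟨μ.colLen 0, fun r hr => polyValued_partDet hr⟩
  | zero => exact ⟨0, fun r _ => ⟨0, fun x _ _ => by rw [map_zero, map_zero]⟩⟩
  | add f g _ _ hf hg =>
    obtain ⟨r₀, hr₀⟩ := hf
    obtain ⟨r₁, hr₁⟩ := hg
    refine ⟨max r₀ r₁, fun r hr => ?_⟩
    obtain ⟨s, hs⟩ := hr₀ r ((le_max_left _ _).trans hr)
    obtain ⟨t, ht⟩ := hr₁ r ((le_max_right _ _).trans hr)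
    exact ⟨s + t, fun x hx hx' => by rw [map_add, map_add, hs x hx hx', ht x hx hx']⟩
  | smul c f _ hf =>
    obtain ⟨r₀, hr₀⟩ := hf
    refine ⟨r₀, fun r hr => ?_⟩
    obtain ⟨s, hs⟩ := hr₀ r hr
    exact ⟨c • s, fun x hx hx' => by rw [ev_smul, map_smul, hs x hx hx', Algebra.smul_def]⟩

lemma poleModule_mono {r s : ℕ} (h : r ≤ s) : poleModule r ≤ poleModule s :=
  fun f hf => by
    have hf : BoundedPole r fun E => ev E f := hf
    exact hf.mono h

lemma exists_mem_poleModule {f : Lam} (hf : f ∈ partSpan) : ∃ r, f ∈ poleModule r := by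
  induction hf using Submodule.span_induction with
  | mem f hf =>
    obtain ⟨μ, rfl⟩ := hf
    exact ⟨_, partDet_mem_poleModule le_rfl⟩
  | zero => exact ⟨0, Submodule.zero_mem _⟩
  | add f g _ _ hf hg =>
    obtain ⟨r₀, hr₀⟩ := hf
    obtain ⟨r₁, hr₁⟩ := hg
    exact ⟨max r₀ r₁, Submodule.add_mem _ (poleModule_mono (le_max_left _ _) hr₀)
      (poleModule_mono (le_max_right _ _) hr₁)⟩
  | smul c f _ hf =>
    obtain ⟨r, hr⟩ := hf
    exact ⟨r, Submodule.smul_mem _ _ hr⟩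

lemma mem_partSpan {r : ℕ} {f : Lam} (hf : f ∈ poleModule r) (hs : PolyValued r f) :
    f ∈ partSpan := Submodule.span_mono (Set.image_subset_range _ _) (mem_span_partDet hf hs)

/-- Pole orders add and polynomial values multiply; a level exceeding all the bounds involved
satisfies both hypotheses of the membership criterion. -/
lemma mul_mem_partSpan (f g : Lam) (hf : f ∈ partSpan) (hg : g ∈ partSpan) : f * g ∈ partSpan := by
  obtain ⟨r₁, h₁⟩ := exists_mem_level hf
  obtain ⟨r₂, h₂⟩ := exists_mem_level hg
  obtain ⟨r₃, h₃⟩ := exists_mem_poleModule hf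
  obtain ⟨r₄, h₄⟩ := exists_mem_poleModule hg
  have hpole : f * g ∈ poleModule (r₃ + r₄) := by
    have h₃ : BoundedPole r₃ fun E => ev E f := h₃
    have h₄ : BoundedPole r₄ fun E => ev E g := h₄
    have := h₃.mul h₄
    change BoundedPole _ fun E => ev E (f * g)
    simpa only [map_mul] using this
  exact mem_partSpan (r := r₁ + r₂ + (r₃ + r₄)) (poleModule_mono (by omega) hpole)
    ((h₁ _ (by omega)).mul (h₂ _ (by omega)))

lemma one_mem_partSpan : (1 : Lam) ∈ partSpan := by
  refine mem_partSpan (r := 0) ?_ ⟨1, fun x _ _ => by rw [map_one, map_one]⟩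
  change BoundedPole _ fun E => ev E 1
  simpa only [map_one] using BoundedPole.const 1

/-- The subalgebra spanned by the determinants of partitions. -/
def partAlg : Subalgebra Ra Lam := partSpan.toSubalgebra one_mem_partSpan mul_mem_partSpan

lemma mem_span_coe_partDet {f : Lam} (hf : f ∈ partSpan) : (⟨f, hf⟩ : partAlg) ∈
    Submodule.span Ra (Set.range fun μ => (⟨partDet μ, Submodule.subset_span ⟨μ, rfl⟩⟩ : partAlg)) := by
  induction hf using Submodule.span_induction with
  | mem f hf =>
    obtain ⟨μ, rfl⟩ := hf
    exact Submodule.subset_span ⟨μ, rfl⟩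
  | zero => exact Submodule.zero_mem _
  | add f g hf hg hf' hg' => exact Submodule.add_mem _ hf' hg'
  | smul c f hf hf' => exact Submodule.smul_mem _ c hf'

/-- The basis of determinants of partitions. -/
def partBasis : Module.Basis YoungDiagram Ra partAlg :=
  Module.Basis.mk (v := fun μ => (⟨partDet μ, Submodule.subset_span ⟨μ, rfl⟩⟩ : partAlg))
    (LinearIndependent.of_comp partAlg.val.toLinearMap linearIndependent_partDet)
    fun f _ => mem_span_coe_partDet f.2

lemma coe_partBasis (μ : YoungDiagram) : (partBasis μ : Lam) = partDet μ := by
  rw [partBasis, Module.Basis.mk_apply]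

/-! ### Tensor powers of the span and the bialgebra structure -/

/-- Evaluation of elements of the subalgebra. -/
def evA (E : Point) : partAlg →ₐ[Ra] XA := ((ev E).restrictScalars Ra).comp partAlg.val

lemma evA_apply (E : Point) (f : partAlg) : evA E f = ev E f := rfl

/-- Evaluation of elements of the tensor square. -/
def evA₂ (E E' : Point) : partAlg ⊗[Ra] partAlg →ₐ[Ra] XA :=
  Algebra.TensorProduct.productMap (evA E) (evA E')

/-- Evaluation of elements of the tensor cube. -/
def evA₃ (E E' E'' : Point) : partAlg ⊗[Ra] (partAlg ⊗[Ra] partAlg) →ₐ[Ra] XA :=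
  Algebra.TensorProduct.productMap (evA E) (evA₂ E' E'')

/-- Triangularity is inherited by tensor products of bases with the product order, so this one
criterion serves the algebra, its tensor square and its tensor cube. -/
lemma eq_of_basis {M ι : Type*} [AddCommMonoid M] [Module Ra M] [PartialOrder ι]
    (b : Module.Basis ι Ra M) (φ : ι → M →ₗ[Ra] XA) (ha : ∀ i j, φ j (b i) ≠ 0 → i ≤ j)
    (hd : ∀ i, φ i (b i) ≠ 0) {z w : M} (hz : ∀ i, φ i z = φ i w) : z = w := by
  apply b.repr.injective
  rw [← sub_eq_zero]
  refine eq_zero_of_triangular _ (fun i j => φ j (b i)) ha hd fun j => ?_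
  have h : ∀ z, (b.repr z).sum (fun i t => algebraMap Ra XA t * φ j (b i)) = φ j z := by
    intro z
    conv_rhs => rw [← b.linearCombination_repr z, Finsupp.linearCombination_apply, Finsupp.sum,
      map_sum]
    simp only [map_smul, Algebra.smul_def]
    rfl
  rw [Finsupp.sum_sub_index fun i s t => by rw [map_sub, sub_mul], h, h, hz, sub_self]

lemma evA_partBasis_ne_zero {ν μ : YoungDiagram} (h : evA (locPoint μ) (partBasis ν) ≠ 0) :
    ν ≤ μ := le_of_ev_locPoint_ne_zero (by rwa [evA_apply, coe_partBasis] at h)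

lemma evA_partBasis_self (μ : YoungDiagram) : evA (locPoint μ) (partBasis μ) ≠ 0 := by
  rw [evA_apply, coe_partBasis]
  exact ev_locPoint_self_ne_zero μ

lemma eq_of_evA₂ {z w : partAlg ⊗[Ra] partAlg} (h : ∀ E E', evA₂ E E' z = evA₂ E E' w) : z = w := by
  have hb : ∀ i j : YoungDiagram × YoungDiagram, evA₂ (locPoint j.1) (locPoint j.2)
      (partBasis.tensorProduct partBasis i) =
        evA (locPoint j.1) (partBasis i.1) * evA (locPoint j.2) (partBasis i.2) := by
    intro i j
    rw [Module.Basis.tensorProduct_apply', evA₂, Algebra.TensorProduct.productMap_apply_tmul]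
  refine eq_of_basis (partBasis.tensorProduct partBasis)
    (fun j => (evA₂ (locPoint j.1) (locPoint j.2)).toLinearMap) (fun i j hij => ?_) (fun i => ?_)
    fun i => ?_
  · rw [AlgHom.toLinearMap_apply, hb] at hij
    exact ⟨evA_partBasis_ne_zero (left_ne_zero_of_mul hij),
      evA_partBasis_ne_zero (right_ne_zero_of_mul hij)⟩
  · rw [AlgHom.toLinearMap_apply, hb]
    exact mul_ne_zero (evA_partBasis_self _) (evA_partBasis_self _)
  · exact h _ _

lemma eq_of_evA₃ {z w : partAlg ⊗[Ra] (partAlg ⊗[Ra] partAlg)}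
    (h : ∀ E E' E'', evA₃ E E' E'' z = evA₃ E E' E'' w) : z = w := by
  have hb : ∀ i j : YoungDiagram × YoungDiagram × YoungDiagram,
      evA₃ (locPoint j.1) (locPoint j.2.1) (locPoint j.2.2)
        (partBasis.tensorProduct (partBasis.tensorProduct partBasis) i) =
        evA (locPoint j.1) (partBasis i.1) * (evA (locPoint j.2.1) (partBasis i.2.1) *
          evA (locPoint j.2.2) (partBasis i.2.2)) := by
    intro i j
    rw [Module.Basis.tensorProduct_apply', Module.Basis.tensorProduct_apply', evA₃, evA₂,
      Algebra.TensorProduct.productMap_apply_tmul, Algebra.TensorProduct.productMap_apply_tmul]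
  refine eq_of_basis (partBasis.tensorProduct (partBasis.tensorProduct partBasis))
    (fun j => (evA₃ (locPoint j.1) (locPoint j.2.1) (locPoint j.2.2)).toLinearMap)
    (fun i j hij => ?_) (fun i => ?_) fun i => ?_
  · rw [AlgHom.toLinearMap_apply, hb] at hij
    exact ⟨evA_partBasis_ne_zero (left_ne_zero_of_mul hij),
      evA_partBasis_ne_zero (left_ne_zero_of_mul (right_ne_zero_of_mul hij)),
      evA_partBasis_ne_zero (right_ne_zero_of_mul (right_ne_zero_of_mul hij))⟩
  · rw [AlgHom.toLinearMap_apply, hb]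
    exact mul_ne_zero (evA_partBasis_self _) (mul_ne_zero (evA_partBasis_self _)
      (evA_partBasis_self _))
  · exact h _ _ _

lemma ev₂_tensorIncl (E E' : Point) (z : partAlg ⊗[Ra] partAlg) :
    ev₂ E E' (tensorIncl partAlg z) = evA₂ E E' z := by
  have : ((ev₂ E E').restrictScalars Ra).comp (tensorIncl partAlg) = evA₂ E E' := by
    apply Algebra.TensorProduct.ext
    · ext f
      simp [tensorIncl, evA₂, evA_apply, ev₂_inclLeft]
    · ext f
      simp [tensorIncl, evA₂, evA_apply, ev₂_inclRight]
  exact DFunLike.congr_fun this z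

/-- Evaluation at pairs of points factors through `tensorIncl`, and pairs of localizations already
separate the tensor square. -/
theorem tensorIncl_partAlg_injective : Function.Injective (tensorIncl partAlg) := by
  intro z w h
  refine eq_of_evA₂ fun E E' => ?_
  rw [← ev₂_tensorIncl, ← ev₂_tensorIncl, h]

lemma Delta_mem_range {f : Lam} (hf : f ∈ partSpan) : Delta f ∈ (tensorIncl partAlg).range := by
  induction hf using Submodule.span_induction with
  | mem f hf =>
    obtain ⟨μ, rfl⟩ := hf
    obtain ⟨ι, t, g, h, hg, hh, heq⟩ := Delta_partDet μ
    rw [heq]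
    refine Subalgebra.sum_mem _ fun i _ => ⟨(⟨g i, hg i⟩ : partAlg) ⊗ₜ[Ra] (⟨h i, hh i⟩ : partAlg), ?_⟩
    exact Algebra.TensorProduct.productMap_apply_tmul _ _ _ _
  | zero => rw [map_zero]; exact Subalgebra.zero_mem _
  | add f g hf hg hf' hg' => rw [map_add]; exact Subalgebra.add_mem _ hf' hg'
  | smul c f hf hf' =>
    have : Delta (c • f) = c • Delta f := map_smul Delta (c : SS) f
    rw [this]
    exact Subalgebra.smul_mem _ hf' c

/-- The coproduct of the subalgebra. -/
def comulA : partAlg →ₐ[Ra] partAlg ⊗[Ra] partAlg :=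
  (AlgEquiv.ofInjective (tensorIncl partAlg) tensorIncl_partAlg_injective).symm.toAlgHom.comp
    (((Delta.restrictScalars Ra).comp partAlg.val).codRestrict _ fun f => Delta_mem_range f.2)

lemma tensorIncl_comulA (f : partAlg) : tensorIncl partAlg (comulA f) = Delta (f : Lam) := by
  have := AlgEquiv.apply_symm_apply
    (AlgEquiv.ofInjective (tensorIncl partAlg) tensorIncl_partAlg_injective)
    ((((Delta.restrictScalars Ra).comp partAlg.val).codRestrict _ fun f => Delta_mem_range f.2) f)
  exact congrArg Subtype.val this

lemma evA₂_comulA (E E' : Point) (f : partAlg) : evA₂ E E' (comulA f) = evA (E * E') f := by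
  rw [← ev₂_tensorIncl, tensorIncl_comulA, ev₂_Delta, evA_apply]

lemma locPoint_bot : locPoint ⊥ = 1 := by
  have h : (⊥ : YoungDiagram).colLen 0 = 0 := by
    by_contra h
    exact YoungDiagram.notMem_bot _ (YoungDiagram.mem_iff_lt_colLen.2 (Nat.pos_of_ne_zero h))
  rw [← superAlph_locTuple (n := 0) h.le]
  simp [superAlph, alph, initial]

lemma partDet_bot : partDet ⊥ = 1 := by
  have h : (⊥ : YoungDiagram).colLen 0 = 0 := by
    by_contra h
    exact YoungDiagram.notMem_bot _ (YoungDiagram.mem_iff_lt_colLen.2 (Nat.pos_of_ne_zero h))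
  have : IsEmpty (Fin ((⊥ : YoungDiagram).colLen 0)) := by
    rw [h]
    infer_instance
  exact det_isEmpty

/-- The counit is localization at the empty partition, where every determinant of a nonempty
partition vanishes by triangularity. -/
lemma counit_mem {f : Lam} (hf : f ∈ partSpan) : counit f ∈ Ra := by
  induction hf using Submodule.span_induction with
  | mem f hf =>
    obtain ⟨μ, rfl⟩ := hf
    by_cases h : μ = ⊥
    · rw [h, partDet_bot, map_one]
      exact Subalgebra.one_mem _
    · have h1 : ev 1 (partDet μ) = 0 := by
        by_contra hne
        rw [← locPoint_bot] at hne
        exact h (le_bot_iff.1 (le_of_ev_locPoint_ne_zero hne))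
      rw [ev_one] at h1
      have h2 : counit (partDet μ) = 0 :=
        MvPowerSeries.rename_injective (Function.Embedding.inr : ℤ ↪ ℤ ⊕ ℤ)
          (h1.trans (map_zero _).symm)
      rw [h2]
      exact Subalgebra.zero_mem _
  | zero => rw [map_zero]; exact Subalgebra.zero_mem _
  | add f g hf hg hf' hg' => rw [map_add]; exact Subalgebra.add_mem _ hf' hg'
  | smul c f hf hf' =>
    have : counit (c • f) = (c : SS) * counit f := by
      change MvPowerSeries.constantCoeff ((c : SS) • f) = _
      rw [MvPowerSeries.smul_eq_C_mul, map_mul, MvPowerSeries.constantCoeff_C]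
      rfl
    rw [this]
    exact Subalgebra.mul_mem _ c.2 hf'

/-- The counit of the subalgebra. -/
def couA : partAlg →ₐ[Ra] Ra where
  toFun f := ⟨counit f, counit_mem f.2⟩
  map_one' := Subtype.ext (map_one counit)
  map_mul' f g := Subtype.ext (map_mul counit (f : Lam) g)
  map_zero' := Subtype.ext (map_zero counit)
  map_add' f g := Subtype.ext (map_add counit (f : Lam) g)
  commutes' c := Subtype.ext (MvPowerSeries.constantCoeff_C (c : SS))

lemma algebraMap_couA (f : partAlg) : algebraMap Ra XA (couA f) = evA 1 f := (ev_one f).symm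

/-- Evaluated at a triple of points, both sides give the value of f at the product E E' E'', so
coassociativity is associativity in `Point`. -/
lemma coassocA : (Algebra.TensorProduct.assoc Ra Ra Ra partAlg partAlg partAlg).toAlgHom.comp
      ((Algebra.TensorProduct.map comulA (AlgHom.id Ra partAlg)).comp comulA) =
    (Algebra.TensorProduct.map (AlgHom.id Ra partAlg) comulA).comp comulA := by
  refine AlgHom.ext fun f => eq_of_evA₃ fun E E' E'' => ?_
  have h1 : ((evA₃ E E' E'').comp
      (Algebra.TensorProduct.assoc Ra Ra Ra partAlg partAlg partAlg).toAlgHom).comp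
      (Algebra.TensorProduct.map comulA (AlgHom.id Ra partAlg)) = evA₂ (E * E') E'' := by
    have h0 : (evA₃ E E' E'').comp
        (Algebra.TensorProduct.assoc Ra Ra Ra partAlg partAlg partAlg).toAlgHom =
        Algebra.TensorProduct.productMap (evA₂ E E') (evA E'') := by
      apply Algebra.TensorProduct.ext
      · apply Algebra.TensorProduct.ext
        · ext g
          simp [evA₃, evA₂]
        · ext g
          simp [evA₃, evA₂]
      · refine AlgHom.ext fun g => ?_
        simp [evA₃, evA₂, Algebra.TensorProduct.one_def]
    rw [h0]
    apply Algebra.TensorProduct.ext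
    · refine AlgHom.ext fun g => ?_
      simp [evA₂_comulA]
      simp [evA₂]
    · refine AlgHom.ext fun g => ?_
      simp
      simp [evA₂]
  have h2 : (evA₃ E E' E'').comp (Algebra.TensorProduct.map (AlgHom.id Ra partAlg) comulA) =
      evA₂ E (E' * E'') := by
    apply Algebra.TensorProduct.ext
    · refine AlgHom.ext fun g => ?_
      simp [evA₃, evA₂]
    · refine AlgHom.ext fun g => ?_
      simp [evA₃, evA₂_comulA]
      simp [evA₂]
  have h3 := DFunLike.congr_fun h1 (comulA f)
  have h4 := DFunLike.congr_fun h2 (comulA f)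
  rw [evA₂_comulA] at h3 h4
  rw [mul_assoc, ← h4] at h3
  exact h3

lemma eq_of_evA {f g : partAlg} (h : ∀ E, evA E f = evA E g) : f = g :=
  eq_of_basis partBasis (fun j => (evA (locPoint j)).toLinearMap)
    (fun _ _ hij => evA_partBasis_ne_zero hij) (fun i => evA_partBasis_self i) fun _ => h _

/-- The counit is evaluation at the unit of `Point`, so the law reduces to 1 · E = E. -/
lemma counitLeftA : (Algebra.TensorProduct.map couA (AlgHom.id Ra partAlg)).comp comulA =
    (Algebra.TensorProduct.lid Ra partAlg).symm.toAlgHom := by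
  refine AlgHom.ext fun f => (Algebra.TensorProduct.lid Ra partAlg).injective ?_
  refine eq_of_evA fun E => ?_
  have h : ((evA E).comp (Algebra.TensorProduct.lid Ra partAlg).toAlgHom).comp
      (Algebra.TensorProduct.map couA (AlgHom.id Ra partAlg)) = evA₂ 1 E := by
    apply Algebra.TensorProduct.ext
    · refine AlgHom.ext fun g => ?_
      simp [evA₂, ← algebraMap_couA, Algebra.algebraMap_eq_smul_one]
    · refine AlgHom.ext fun g => ?_
      simp [evA₂]
  have h1 := DFunLike.congr_fun h (comulA f)
  rw [evA₂_comulA, one_mul] at h1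
  refine h1.trans ?_
  exact congrArg _ (AlgEquiv.apply_symm_apply (Algebra.TensorProduct.lid Ra partAlg) f).symm

lemma counitRightA : (Algebra.TensorProduct.map (AlgHom.id Ra partAlg) couA).comp comulA =
    (Algebra.TensorProduct.rid Ra Ra partAlg).symm.toAlgHom := by
  refine AlgHom.ext fun f => (Algebra.TensorProduct.rid Ra Ra partAlg).injective ?_
  refine eq_of_evA fun E => ?_
  have h : ((evA E).comp (Algebra.TensorProduct.rid Ra Ra partAlg).toAlgHom).comp
      (Algebra.TensorProduct.map (AlgHom.id Ra partAlg) couA) = evA₂ E 1 := by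
    apply Algebra.TensorProduct.ext
    · refine AlgHom.ext fun g => ?_
      simp [evA₂]
    · refine AlgHom.ext fun g => ?_
      simp [evA₂, ← algebraMap_couA, Algebra.algebraMap_eq_smul_one]
  have h1 := DFunLike.congr_fun h (comulA f)
  rw [evA₂_comulA, mul_one] at h1
  refine h1.trans ?_
  exact congrArg _ (AlgEquiv.apply_symm_apply (Algebra.TensorProduct.rid Ra Ra partAlg) f).symm

end DoubleKStanley
end

noncomputable section
namespace DoubleKStanley

/-! ### The action of permutations and divided differences -/

/-- The polynomials in the variables `x_i` over `𝕊`. -/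
def polyX : Subalgebra SS XA := Algebra.adjoin SS (Set.range xVar)

lemma permX_xVar (w : Equiv.Perm ℤ) (i : ℤ) : permX w (xVar i) = xVar (w i) :=
  MvPowerSeries.rename_X _ _

lemma permX_algebraMap (w : Equiv.Perm ℤ) (c : SS) :
    permX w (algebraMap SS XA c) = algebraMap SS XA c := by
  change MvPowerSeries.rename _ (MvPowerSeries.rename _ c) = MvPowerSeries.rename _ c
  rw [MvPowerSeries.rename_rename]
  rfl

lemma permX_aVar (w : Equiv.Perm ℤ) (i : ℤ) : permX w (aVar i) = aVar i := by
  rw [← algebraMap_X, permX_algebraMap]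

lemma permX_mul_apply (v w : Equiv.Perm ℤ) (f : XA) : permX (v * w) f = permX v (permX w f) := by
  change _ = MvPowerSeries.rename _ (MvPowerSeries.rename _ f)
  rw [MvPowerSeries.rename_rename]
  have : (⇑(Equiv.sumCongr v (Equiv.refl ℤ)) ∘ ⇑(Equiv.sumCongr w (Equiv.refl ℤ))) =
      ⇑(Equiv.sumCongr (v * w) (Equiv.refl ℤ)) := by
    funext t
    cases t <;> rfl
  simp only [this]
  rfl

lemma permX_one_apply (f : XA) : permX 1 f = f := by
  have : ⇑(Equiv.sumCongr (1 : Equiv.Perm ℤ) (Equiv.refl ℤ)) = id := by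
    funext t
    cases t <;> rfl
  change MvPowerSeries.rename _ f = f
  simp only [this]
  exact MvPowerSeries.rename_id_apply f

lemma simpleRefl_left (i : ℤ) : simpleRefl i i = i + 1 := Equiv.swap_apply_left _ _

lemma simpleRefl_right (i : ℤ) : simpleRefl i (i + 1) = i := Equiv.swap_apply_right _ _

lemma simpleRefl_of_ne {i j : ℤ} (h : j ≠ i) (h' : j ≠ i + 1) : simpleRefl i j = j :=
  Equiv.swap_apply_of_ne_of_ne h h'

lemma simpleRefl_mul_self (i : ℤ) : simpleRefl i * simpleRefl i = 1 := Equiv.swap_mul_self _ _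

lemma simpleRefl_apply (i j : ℤ) :
    simpleRefl i j = if j = i then i + 1 else if j = i + 1 then i else j := Equiv.swap_apply_def _ _ _

lemma simpleRefl_simpleRefl (i j : ℤ) : simpleRefl i (simpleRefl i j) = j :=
  Equiv.swap_apply_self _ _ _

lemma permX_simpleRefl_self (i : ℤ) (f : XA) :
    permX (simpleRefl i) (permX (simpleRefl i) f) = f := by
  rw [← permX_mul_apply, simpleRefl_mul_self, permX_one_apply]

lemma permX_mem_polyX (w : Equiv.Perm ℤ) {f : XA} (hf : f ∈ polyX) : permX w f ∈ polyX := by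
  induction hf using Algebra.adjoin_induction with
  | mem f hf =>
    obtain ⟨i, rfl⟩ := hf
    rw [permX_xVar]
    exact Algebra.subset_adjoin ⟨_, rfl⟩
  | algebraMap c =>
    rw [permX_algebraMap]
    exact Subalgebra.algebraMap_mem _ c
  | add f g _ _ hf hg =>
    rw [map_add]
    exact Subalgebra.add_mem _ hf hg
  | mul f g _ _ hf hg =>
    rw [map_mul]
    exact Subalgebra.mul_mem _ hf hg

lemma xVar_mem_polyX (i : ℤ) : xVar i ∈ polyX := Algebra.subset_adjoin ⟨i, rfl⟩

lemma xVar_sub_ne_zero {i j : ℤ} (h : i ≠ j) : xVar i - xVar j ≠ 0 :=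
  sub_ne_zero.2 fun h' => h (xM_injective (Subtype.ext h'))

/-- Divisibility by x_i - x_{i+1} is clear on generators and passes to products by the twisted
Leibniz rule. Keeping the quotient in `polyX` permits iteration. -/
lemma exists_dividedDifference (i : ℤ) {f : XA} (hf : f ∈ polyX) :
    ∃ g ∈ polyX, (xVar i - xVar (i + 1)) * g = f - permX (simpleRefl i) f := by
  induction hf using Algebra.adjoin_induction with
  | mem f hf =>
    obtain ⟨j, rfl⟩ := hf
    rw [permX_xVar]
    by_cases h : j = i
    · refine ⟨1, Subalgebra.one_mem _, ?_⟩
      rw [h, simpleRefl_left, mul_one]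
    · by_cases h' : j = i + 1
      · refine ⟨-1, Subalgebra.neg_mem _ (Subalgebra.one_mem _), ?_⟩
        rw [h', simpleRefl_right]
        ring
      · refine ⟨0, Subalgebra.zero_mem _, ?_⟩
        rw [simpleRefl_of_ne h h', mul_zero, sub_self]
  | algebraMap c =>
    refine ⟨0, Subalgebra.zero_mem _, ?_⟩
    rw [permX_algebraMap, mul_zero, sub_self]
  | add f g _ _ hf hg =>
    obtain ⟨f', hf', hf⟩ := hf
    obtain ⟨g', hg', hg⟩ := hg
    refine ⟨f' + g', Subalgebra.add_mem _ hf' hg', ?_⟩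
    rw [mul_add, hf, hg, map_add]
    ring
  | mul f g hfm hgm hf hg =>
    obtain ⟨f', hf', hf⟩ := hf
    obtain ⟨g', hg', hg⟩ := hg
    refine ⟨f' * g + permX (simpleRefl i) f * g', Subalgebra.add_mem _
      (Subalgebra.mul_mem _ hf' hgm) (Subalgebra.mul_mem _ (permX_mem_polyX _ hfm) hg'), ?_⟩
    rw [map_mul]
    linear_combination g * hf + permX (simpleRefl i) f * hg

lemma exists_isDemazure (i : ℤ) {f : XA} (hf : f ∈ polyX) : ∃ g ∈ polyX, IsDemazure i f g :=
  exists_dividedDifference i (Subalgebra.mul_mem _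
    (Subalgebra.sub_mem _ (Subalgebra.one_mem _) (xVar_mem_polyX _)) hf)

lemma IsDemazure.unique {i : ℤ} {f g g' : XA} (h : IsDemazure i f g) (h' : IsDemazure i f g') :
    g = g' := mul_left_cancel₀ (xVar_sub_ne_zero (by omega)) (Eq.trans h (Eq.symm h'))

lemma IsDemazure.mem_polyX {i : ℤ} {f g : XA} (h : IsDemazure i f g) (hf : f ∈ polyX) :
    g ∈ polyX := by
  obtain ⟨g', hg', h'⟩ := exists_isDemazure i hf
  rwa [h.unique h']

lemma IsDemazure.permX_eq {i : ℤ} {f g : XA} (h : IsDemazure i f g) :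
    permX (simpleRefl i) g = g := by
  have h1 := congrArg (permX (simpleRefl i)) h
  rw [map_mul, map_sub, map_sub, permX_simpleRefl_self, permX_xVar, permX_xVar, simpleRefl_left,
    simpleRefl_right] at h1
  refine mul_left_cancel₀ (xVar_sub_ne_zero (i := i) (j := i + 1) (by omega)) ?_
  have h2 : (xVar i - xVar (i + 1)) * g = _ := h
  linear_combination -h1 - h2

/-- The defining equation of `π_i`, transformed by a permutation. -/
lemma IsDemazure.transform {i : ℤ} {f g : XA} (h : IsDemazure i f g) (w : Equiv.Perm ℤ) :
    (xVar (w i) - xVar (w (i + 1))) * permX w g = (1 - xVar (w (i + 1))) * permX w f -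
      (1 - xVar (w i)) * permX (w * simpleRefl i) f := by
  have h1 := congrArg (DoubleKStanley.permX w) h
  simp only [map_mul, map_sub, map_one, permX_xVar, simpleRefl_right] at h1
  rwa [permX_mul_apply]

lemma isDemazure_iff {i : ℤ} {f g : XA} : IsDemazure i f g ↔ (xVar i - xVar (i + 1)) * g =
    (1 - xVar (i + 1)) * f - (1 - xVar i) * permX (simpleRefl i) f := by
  rw [IsDemazure, map_mul, map_sub, map_one, permX_xVar, simpleRefl_right]

lemma commute_identity {R : Type*} [CommRing R] {x y z t h hi hj hij f f' k k' g g' : R}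
    (h1 : (z - t) * f = (1 - t) * h - (1 - z) * hj)
    (h2 : (z - t) * f' = (1 - t) * hi - (1 - z) * hij)
    (h3 : (x - y) * g = (1 - y) * f - (1 - x) * f')
    (h4 : (x - y) * k = (1 - y) * h - (1 - x) * hi)
    (h5 : (x - y) * k' = (1 - y) * hj - (1 - x) * hij)
    (h6 : (z - t) * g' = (1 - t) * k - (1 - z) * k') :
    (x - y) * (z - t) * g = (x - y) * (z - t) * g' := by
  linear_combination (z - t) * h3 + (1 - y) * h1 - (1 - x) * h2 -
    ((x - y) * h6 + (1 - t) * h4 - (1 - z) * h5)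

/-- The letters a and b in the names record the two reflections applied to a function. The
hypotheses are the defining equations of the divided differences and their transforms; the braid
relation enters through the common value `haba`. -/
lemma braid_identity {R : Type*} [CommRing R]
    {x y z h ha hb hab hba haba p pb pab q qa r k ka kba l lb m : R}
    (h1 : (x - y) * p = (1 - y) * h - (1 - x) * ha)
    (h2 : (x - z) * pb = (1 - z) * hb - (1 - x) * hba)
    (h3 : (y - z) * pab = (1 - z) * hab - (1 - y) * haba)
    (h4 : (y - z) * q = (1 - z) * p - (1 - y) * pb)
    (h5 : (x - z) * qa = (1 - z) * p - (1 - x) * pab)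
    (h6 : (x - y) * r = (1 - y) * q - (1 - x) * qa)
    (h7 : (y - z) * k = (1 - z) * h - (1 - y) * hb)
    (h8 : (x - z) * ka = (1 - z) * ha - (1 - x) * hab)
    (h9 : (x - y) * kba = (1 - y) * hba - (1 - x) * haba)
    (h10 : (x - y) * l = (1 - y) * k - (1 - x) * ka)
    (h11 : (x - z) * lb = (1 - z) * k - (1 - x) * kba)
    (h12 : (y - z) * m = (1 - z) * l - (1 - y) * lb) :
    (x - y) * (x - z) * (y - z) * r = (x - y) * (x - z) * (y - z) * m := by
  linear_combination (x - z) * (y - z) * h6 + (1 - y) * (x - z) * h4 - (1 - x) * (y - z) * h5 +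
    (1 - z) ^ 2 * h1 - (1 - y) ^ 2 * h2 + (1 - x) ^ 2 * h3 -
    ((x - y) * (x - z) * h12 + (1 - z) * (x - z) * h10 - (1 - y) * (x - y) * h11 +
      (1 - y) * (1 - z) * h7 - (1 - x) * (1 - z) * h8 + (1 - x) * (1 - y) * h9)

lemma simpleRefl_comm {i j : ℤ} (hij : i + 1 < j) :
    simpleRefl i * simpleRefl j = simpleRefl j * simpleRefl i := by
  ext t
  simp only [Equiv.Perm.mul_apply, simpleRefl_apply]
  split_ifs <;> omega

lemma simpleRefl_braid (i : ℤ) : simpleRefl i * simpleRefl (i + 1) * simpleRefl i =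
    simpleRefl (i + 1) * simpleRefl i * simpleRefl (i + 1) := by
  ext t
  simp only [Equiv.Perm.mul_apply, simpleRefl_apply]
  split_ifs <;> omega

/-- Divided differences at distant positions commute. -/
lemma IsDemazure.comm {i j : ℤ} (hij : i + 1 < j) {h f k g g' : XA} (h1 : IsDemazure j h f)
    (h2 : IsDemazure i f g) (h3 : IsDemazure i h k) (h4 : IsDemazure j k g') : g = g' := by
  have e1 := isDemazure_iff.1 h1
  have e2 := h1.transform (simpleRefl i)
  have e3 := isDemazure_iff.1 h2
  have e4 := isDemazure_iff.1 h3
  have e5 := h3.transform (simpleRefl j)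
  have e6 := isDemazure_iff.1 h4
  rw [simpleRefl_of_ne (i := i) (j := j) (by omega) (by omega),
    simpleRefl_of_ne (i := i) (j := j + 1) (by omega) (by omega)] at e2
  rw [simpleRefl_of_ne (i := j) (j := i) (by omega) (by omega),
    simpleRefl_of_ne (i := j) (j := i + 1) (by omega) (by omega), ← simpleRefl_comm hij] at e5
  refine mul_left_cancel₀ (mul_ne_zero (xVar_sub_ne_zero ?_) (xVar_sub_ne_zero ?_))
    (commute_identity e1 e2 e3 e4 e5 e6) <;> omega

/-- The braid relation for divided differences. -/
lemma IsDemazure.braid {i : ℤ} {h p q r k l m : XA} (h1 : IsDemazure i h p)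
    (h2 : IsDemazure (i + 1) p q) (h3 : IsDemazure i q r) (h4 : IsDemazure (i + 1) h k)
    (h5 : IsDemazure i k l) (h6 : IsDemazure (i + 1) l m) : r = m := by
  have s1 : simpleRefl i (i + 1 + 1) = i + 1 + 1 := simpleRefl_of_ne (by omega) (by omega)
  have s2 : simpleRefl (i + 1) i = i := simpleRefl_of_ne (by omega) (by omega)
  have e1 := isDemazure_iff.1 h1
  have e2 := h1.transform (simpleRefl (i + 1))
  have e3 := h1.transform (simpleRefl i * simpleRefl (i + 1))
  have e4 := isDemazure_iff.1 h2
  have e5 := h2.transform (simpleRefl i)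
  have e6 := isDemazure_iff.1 h3
  have e7 := isDemazure_iff.1 h4
  have e8 := h4.transform (simpleRefl i)
  have e9 := h4.transform (simpleRefl (i + 1) * simpleRefl i)
  have e10 := isDemazure_iff.1 h5
  have e11 := h5.transform (simpleRefl (i + 1))
  have e12 := isDemazure_iff.1 h6
  simp only [Equiv.Perm.mul_apply, simpleRefl_left, simpleRefl_right, s1, s2] at e2 e3 e5 e8 e9 e11
  rw [h1.permX_eq] at e5
  rw [h4.permX_eq] at e11
  rw [← simpleRefl_braid] at e9
  refine mul_left_cancel₀ (mul_ne_zero (mul_ne_zero (xVar_sub_ne_zero ?_) (xVar_sub_ne_zero ?_))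
    (xVar_sub_ne_zero ?_)) (braid_identity e1 e2 e3 e4 e5 e6 e7 e8 e9 e10 e11 e12) <;> omega

/-! ### Finite permutations -/

/-- The permutation fixes all integers outside `[1, n]`. -/
def InS (n : ℕ) (w : Equiv.Perm ℤ) : Prop := ∀ j : ℤ, ¬(1 ≤ j ∧ j ≤ n) → w j = j

lemma InS.mapsTo {n : ℕ} {w : Equiv.Perm ℤ} (hw : InS n w) {j : ℤ} (h1 : 1 ≤ j) (hn : j ≤ n) :
    1 ≤ w j ∧ w j ≤ n := by
  by_contra h
  have := w.injective (hw (w j) h)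
  rw [this] at h
  exact h ⟨h1, hn⟩

lemma InS.mul {n : ℕ} {v w : Equiv.Perm ℤ} (hv : InS n v) (hw : InS n w) : InS n (v * w) := by
  intro j hj
  rw [Equiv.Perm.mul_apply, hw j hj, hv j hj]

lemma InS.mono {m n : ℕ} (h : m ≤ n) {w : Equiv.Perm ℤ} (hw : InS m w) : InS n w := fun j hj =>
  hw j (by omega)

lemma inS_one (n : ℕ) : InS n 1 := fun _ _ => rfl

lemma inS_simpleRefl {n : ℕ} {i : ℤ} (h1 : 1 ≤ i) (hn : i < n) : InS n (simpleRefl i) := fun j hj =>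
  simpleRefl_of_ne (by omega) (by omega)

lemma longest_apply (n : ℕ) (i : ℤ) : longest n i = if 1 ≤ i ∧ i ≤ n then n + 1 - i else i := rfl

lemma inS_longest (n : ℕ) : InS n (longest n) := fun j hj => by rw [longest_apply, if_neg hj]

lemma IsDoubleGroth.inS {n : ℕ} {w : Equiv.Perm ℤ} {g : XA} (h : IsDoubleGroth n w g) :
    InS n w := by
  induction h with
  | top => exact inS_longest n
  | step w i f g h1 hn hw hf hg ih =>
    have := ih.mul (inS_simpleRefl h1 hn)
    rwa [mul_assoc, simpleRefl_mul_self, mul_one] at this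

lemma eq_longest {n : ℕ} {w : Equiv.Perm ℤ} (hw : InS n w)
    (h : ∀ i : ℤ, 1 ≤ i → i < n → w (i + 1) < w i) : w = longest n := by
  have h1 : ∀ k : ℕ, (k : ℤ) + 1 ≤ n → w (k + 1) ≤ n - k := by
    intro k
    induction k with
    | zero => intro hk; simpa using (hw.mapsTo (j := 1) (by omega) (by omega)).2
    | succ k ih =>
      intro hk
      push_cast at hk ⊢
      have h1 := ih (by omega)
      have h2 := h (k + 1) (by omega) (by omega)
      omega
  have h2 : ∀ k : ℕ, (k : ℤ) < n → k + 1 ≤ w (n - k) := by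
    intro k
    induction k with
    | zero => intro hk; simpa using (hw.mapsTo (j := n) (by omega) (by omega)).1
    | succ k ih =>
      intro hk
      push_cast at hk ⊢
      have h1 := ih (by omega)
      have h2 := h (n - (k + 1)) (by omega) (by omega)
      rw [show (n : ℤ) - (k + 1) + 1 = n - k by ring] at h2
      omega
  ext j
  rw [longest_apply]
  split_ifs with hj
  · have h3 := h1 (j - 1).toNat (by omega)
    have h4 := h2 (n - j).toNat (by omega)
    rw [show ((j - 1).toNat : ℤ) = j - 1 by omega, sub_add_cancel] at h3
    rw [show ((n - j : ℤ).toNat : ℤ) = n - j by omega, sub_sub_cancel] at h4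
    omega
  · exact hw j hj

/-- A statistic that decreases when the length increases. -/
def colength (n : ℕ) (w : Equiv.Perm ℤ) : ℕ := (∑ i ∈ Finset.Icc (1 : ℤ) n, i * w i).toNat

lemma sum_simpleRefl {M : Type*} [AddCommMonoid M] {a b i : ℤ} (h1 : a ≤ i) (hn : i + 1 ≤ b)
    (f : ℤ → M) : ∑ j ∈ Finset.Icc a b, f (simpleRefl i j) = ∑ j ∈ Finset.Icc a b, f j := by
  refine Finset.sum_equiv (simpleRefl i) (fun j => ?_) fun _ _ => rfl
  simp only [Finset.mem_Icc, simpleRefl_apply]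
  split_ifs <;> omega

/-- Exchanging the values at an ascent changes ∑ j w(j) by w(i) - w(i+1) < 0. The sum is positive,
so passing to natural numbers loses nothing. -/
lemma colength_lt {n : ℕ} {w : Equiv.Perm ℤ} (hw : InS n w) {i : ℤ} (h1 : 1 ≤ i) (hn : i < n)
    (hi : w i < w (i + 1)) : colength n (w * simpleRefl i) < colength n w := by
  have h2 : ∑ j ∈ Finset.Icc (1 : ℤ) n, j * (w * simpleRefl i) j =
      ∑ j ∈ Finset.Icc (1 : ℤ) n, simpleRefl i j * w j := by
    rw [← sum_simpleRefl h1 (by omega : i + 1 ≤ n)]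
    simp only [Equiv.Perm.mul_apply, simpleRefl_simpleRefl]
  have h3 : ∑ j ∈ Finset.Icc (1 : ℤ) n, simpleRefl i j * w j - ∑ j ∈ Finset.Icc (1 : ℤ) n, j * w j =
      w i - w (i + 1) := by
    rw [← Finset.sum_sub_distrib]
    have hsub : ({i, i + 1} : Finset ℤ) ⊆ Finset.Icc (1 : ℤ) n := by
      intro j hj
      simp only [Finset.mem_insert, Finset.mem_singleton] at hj
      rw [Finset.mem_Icc]
      omega
    rw [← Finset.sum_subset hsub, Finset.sum_pair (by omega), simpleRefl_left, simpleRefl_right]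
    · ring
    · intro j _ hj
      simp only [Finset.mem_insert, Finset.mem_singleton, not_or] at hj
      rw [simpleRefl_of_ne hj.1 hj.2, sub_self]
  have h4 : 0 < ∑ j ∈ Finset.Icc (1 : ℤ) n, j * w j := by
    refine Finset.sum_pos (fun j hj => ?_) ⟨i, Finset.mem_Icc.2 ⟨h1, hn.le⟩⟩
    rw [Finset.mem_Icc] at hj
    have := (hw.mapsTo hj.1 hj.2).1
    exact mul_pos (by omega) (by omega)
  rw [colength, colength, h2]
  omega

/-! ### Double Grothendieck polynomials are well defined -/

lemma one_sub_mul_ominus (f : XA) (j : ℤ) : (1 - aVar j) * ominus f (aVar j) = f - aVar j := by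
  have h : (1 - aVar j) * MvPowerSeries.invOfUnit (1 - aVar j) 1 = 1 :=
    MvPowerSeries.mul_invOfUnit _ _ (by
      rw [map_sub, map_one, aVar, MvPowerSeries.constantCoeff_X, sub_zero]; rfl)
  rw [ominus, mul_left_comm, h, mul_one]

lemma ominus_eq_evalU (x : MaxId) (j : ℤ) : ominus x.1 (aVar j) = evalU x (linPoly j) := by
  refine mul_left_cancel₀ (one_sub_ne_zero (aM j)) ?_
  rw [mul_evalU_linPoly]
  refine (one_sub_mul_ominus _ j).trans ?_
  rw [sub_sub_sub_cancel_left]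
  rfl

lemma map_ominus (φ : XA →ₐ[ℤ] XA) (f : XA) {j k : ℤ} (h : φ (aVar j) = aVar k) :
    φ (ominus f (aVar j)) = ominus (φ f) (aVar k) := by
  refine mul_left_cancel₀ (one_sub_ne_zero (aM k)) ?_
  have h1 := congrArg φ (one_sub_mul_ominus f j)
  rw [map_mul, map_sub, map_sub, map_one, h] at h1
  exact h1.trans (one_sub_mul_ominus _ k).symm

lemma ominus_mem_polyX (i j : ℤ) : ominus (xVar i) (aVar j) ∈ polyX := by
  have h : ominus (xVar i) (aVar j) =
      (xVar i - algebraMap SS XA (MvPowerSeries.X j)) * algebraMap SS XA ((vRa j)⁻¹ : Raˣ).1.1 := by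
    refine mul_left_cancel₀ (one_sub_ne_zero (aM j)) ?_
    refine (one_sub_mul_ominus _ j).trans ?_
    have : algebraMap SS XA ((vRa j)⁻¹ : Raˣ).1.1 * (1 - (aM j).1) = 1 := algebraMap_vRa_mul_inv j
    rw [algebraMap_X]
    linear_combination (-(xVar i - aVar j)) * this
  rw [h]
  exact Subalgebra.mul_mem _ (Subalgebra.sub_mem _ (xVar_mem_polyX i) (Subalgebra.algebraMap_mem _ _))
    (Subalgebra.algebraMap_mem _ _)

lemma IsDoubleGroth.mem_polyX {n : ℕ} {w : Equiv.Perm ℤ} {g : XA} (h : IsDoubleGroth n w g) :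
    g ∈ polyX := by
  induction h with
  | top => exact Subalgebra.prod_mem _ fun i _ => Subalgebra.prod_mem _ fun j _ => ominus_mem_polyX i j
  | step w i f g h1 hn hw hf hg ih => exact hg.mem_polyX ih

lemma exists_isDoubleGroth {n : ℕ} {w : Equiv.Perm ℤ} (hw : InS n w) :
    ∃ g, IsDoubleGroth n w g := by
  induction hm : colength n w using Nat.strong_induction_on generalizing w with
  | _ m ih =>
    by_cases h : ∃ i : ℤ, 1 ≤ i ∧ i < n ∧ w i < w (i + 1)
    · obtain ⟨i, h1, hn, hi⟩ := h
      obtain ⟨f, hf⟩ := ih _ (hm ▸ colength_lt hw h1 hn hi) (hw.mul (inS_simpleRefl h1 hn)) rfl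
      obtain ⟨g, -, hg⟩ := exists_isDemazure i hf.mem_polyX
      exact ⟨g, .step w i f g h1 hn hi hf hg⟩
    · push Not at h
      rw [eq_longest hw fun i h1 hn => lt_of_le_of_ne (h i h1 hn) (w.injective.ne (by omega))]
      exact ⟨_, .top⟩

lemma IsDoubleGroth.eq_or_descent {n : ℕ} {w : Equiv.Perm ℤ} {g : XA} (h : IsDoubleGroth n w g) :
    (w = longest n ∧ g = ∏ i ∈ Finset.Icc (1 : ℤ) n, ∏ j ∈ Finset.Icc (1 : ℤ) (n - i),
      ominus (xVar i) (aVar j)) ∨ ∃ (i : ℤ) (f : XA), 1 ≤ i ∧ i < n ∧ w i < w (i + 1) ∧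
        IsDoubleGroth n (w * simpleRefl i) f ∧ IsDemazure i f g := by
  cases h with
  | top => exact Or.inl ⟨rfl, rfl⟩
  | step _ i f _ h1 hn hw hf hg => exact Or.inr ⟨i, f, h1, hn, hw, hf, hg⟩

lemma not_ascent_longest {n : ℕ} {i : ℤ} (h1 : 1 ≤ i) (hn : i < n) :
    ¬ longest n i < longest n (i + 1) := by
  rw [longest_apply, longest_apply, if_pos (by omega), if_pos (by omega)]
  omega

/-- The double Grothendieck polynomial does not depend on the choice of reduced words. -/
theorem IsDoubleGroth.unique {n : ℕ} {w : Equiv.Perm ℤ} {g g' : XA} (h : IsDoubleGroth n w g)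
    (h' : IsDoubleGroth n w g') : g = g' := by
  induction hm : colength n w using Nat.strong_induction_on generalizing w g g' with
  | _ m ih =>
    have hS := h.inS
    rcases h.eq_or_descent with ⟨h1, h2⟩ | ⟨i, f, hi1, hin, hi, hf, hg⟩
    · rcases h'.eq_or_descent with ⟨h1', h2'⟩ | ⟨i, f, hi1, hin, hi, -, -⟩
      · rw [h2, h2']
      · rw [h1] at hi
        exact absurd hi (not_ascent_longest hi1 hin)
    rcases h'.eq_or_descent with ⟨h1', h2'⟩ | ⟨j, f', hj1, hjn, hj, hf', hg'⟩
    · rw [h1'] at hi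
      exact absurd hi (not_ascent_longest hi1 hin)
    -- Diamond argument: the two ascents are continued to a common permutation of smaller colength.
    -- By induction the intermediate polynomials agree with those built along the two sides, and the
    -- braid or commutation relation compares the results.
    have key : ∀ {i j : ℤ} {f f' g g' : XA}, i < j → 1 ≤ i → j < n → w i < w (i + 1) →
        w j < w (j + 1) → IsDoubleGroth n (w * simpleRefl i) f →
        IsDoubleGroth n (w * simpleRefl j) f' → IsDemazure i f g → IsDemazure j f' g' → g = g' := by
      intro i j f f' g g' hij hi1 hjn hi hj hf hf' hg hg'
      have hiS := hS.mul (inS_simpleRefl hi1 (hij.trans hjn))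
      have hjS := hS.mul (inS_simpleRefl (hi1.trans hij.le) hjn)
      have hil := colength_lt hS hi1 (hij.trans hjn) hi
      have hjl := colength_lt hS (hi1.trans hij.le) hjn hj
      rcases eq_or_lt_of_le (show i + 1 ≤ j by omega) with rfl | hij'
      · have v1 : simpleRefl i (i + 1 + 1) = i + 1 + 1 := simpleRefl_of_ne (by omega) (by omega)
        have v2 : simpleRefl (i + 1) i = i := simpleRefl_of_ne (by omega) (by omega)
        obtain ⟨e, he⟩ := exists_isDoubleGroth
          ((hiS.mul (inS_simpleRefl (i := i + 1) (by omega) hjn)).mul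
            (inS_simpleRefl hi1 (hij.trans hjn)))
        have he' := he
        rw [mul_assoc, mul_assoc, ← mul_assoc (simpleRefl i), simpleRefl_braid, ← mul_assoc,
          ← mul_assoc] at he'
        obtain ⟨p, -, hp⟩ := exists_isDemazure i he.mem_polyX
        have gp := IsDoubleGroth.step (w * simpleRefl i * simpleRefl (i + 1)) i e p hi1
          (hij.trans hjn) (by
            simpa only [Equiv.Perm.mul_apply, simpleRefl_left, simpleRefl_right, v1, v2] using hj)
          he hp
        obtain ⟨q, -, hq⟩ := exists_isDemazure (i + 1) gp.mem_polyX
        have gq := IsDoubleGroth.step (w * simpleRefl i) (i + 1) p q (by omega) hjn (by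
            simpa only [Equiv.Perm.mul_apply, simpleRefl_left, simpleRefl_right, v1, v2] using
              hi.trans hj) gp hq
        obtain ⟨k, -, hk⟩ := exists_isDemazure (i + 1) he.mem_polyX
        have gk := IsDoubleGroth.step (w * simpleRefl (i + 1) * simpleRefl i) (i + 1) e k (by omega)
          hjn (by
            simpa only [Equiv.Perm.mul_apply, simpleRefl_left, simpleRefl_right, v1, v2] using hi)
          he' hk
        obtain ⟨l, -, hl⟩ := exists_isDemazure i gk.mem_polyX
        have gl := IsDoubleGroth.step (w * simpleRefl (i + 1)) i k l hi1 (hij.trans hjn) (by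
            simpa only [Equiv.Perm.mul_apply, simpleRefl_left, simpleRefl_right, v1, v2] using
              hi.trans hj) gk hl
        rw [ih _ (hm ▸ hil) hf gq rfl] at hg
        rw [ih _ (hm ▸ hjl) hf' gl rfl] at hg'
        exact hp.braid hq hg hk hl hg'
      · obtain ⟨e, he⟩ := exists_isDoubleGroth (hiS.mul (inS_simpleRefl (hi1.trans hij.le) hjn))
        have he' := he
        rw [mul_assoc, simpleRefl_comm hij', ← mul_assoc] at he'
        obtain ⟨p, -, hp⟩ := exists_isDemazure j he.mem_polyX
        have gp := IsDoubleGroth.step (w * simpleRefl i) j e p (hi1.trans hij.le) hjn (by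
          rwa [Equiv.Perm.mul_apply, Equiv.Perm.mul_apply, simpleRefl_of_ne (by omega) (by omega),
            simpleRefl_of_ne (by omega) (by omega)]) he hp
        obtain ⟨k, -, hk⟩ := exists_isDemazure i he.mem_polyX
        have gk := IsDoubleGroth.step (w * simpleRefl j) i e k hi1 (hij.trans hjn) (by
          rwa [Equiv.Perm.mul_apply, Equiv.Perm.mul_apply, simpleRefl_of_ne (by omega) (by omega),
            simpleRefl_of_ne (by omega) (by omega)]) he' hk
        rw [ih _ (hm ▸ hil) hf gp rfl] at hg
        rw [ih _ (hm ▸ hjl) hf' gk rfl] at hg'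
        exact hp.comm hij' hg hk hg'
    rcases lt_trichotomy i j with hij | rfl | hij
    · exact key hij hi1 hjn hi hj hf hf' hg hg'
    · rw [ih _ (hm ▸ colength_lt hS hi1 hin hi) hf hf' rfl] at hg
      exact hg.unique hg'
    · exact (key hij hj1 hin hj hi hf' hf hg' hg).symm

end DoubleKStanley
end

noncomputable section
namespace DoubleKStanley

/-! ### Dominant permutations -/

/-- The `i`-th entry of the code of a permutation of `{1, 2, …}`. -/
def code (w : Equiv.Perm ℤ) (i : ℤ) : ℤ :=
  w i - 1 - ∑ j ∈ Finset.Icc 1 (i - 1), if w j < w i then 1 else 0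

/-- The product of the `x_i ⊖ a_j` with `1 ≤ j ≤ c`. -/
def rowProd (i c : ℤ) : XA := ∏ j ∈ Finset.Icc 1 c, ominus (xVar i) (aVar j)

/-- The product of the `x_i ⊖ a_j` over the diagram of the code. -/
def codeProd (n : ℕ) (w : Equiv.Perm ℤ) : XA := ∏ i ∈ Finset.Icc (1 : ℤ) n, rowProd i (code w i)

lemma code_of_le {w : Equiv.Perm ℤ} {i : ℤ} (h : ∀ j, 1 ≤ j → j < i → w i ≤ w j) :
    code w i = w i - 1 := by
  rw [code, Finset.sum_eq_zero, sub_zero]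
  intro j hj
  rw [Finset.mem_Icc] at hj
  rw [if_neg (not_lt.2 (h j hj.1 (by omega)))]

lemma Icc_succ_right {a b : ℤ} (h : a ≤ b + 1) :
    Finset.Icc a (b + 1) = insert (b + 1) (Finset.Icc a b) := by
  ext j
  simp only [Finset.mem_insert, Finset.mem_Icc]
  omega

lemma code_mul_simpleRefl_left {w : Equiv.Perm ℤ} {k : ℤ} (h1 : 1 ≤ k) (hk : w k < w (k + 1)) :
    code (w * simpleRefl k) k = code w (k + 1) + 1 := by
  have h2 : Finset.Icc 1 k = insert k (Finset.Icc 1 (k - 1)) := by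
    have := Icc_succ_right (a := 1) (b := k - 1) (by omega)
    rwa [sub_add_cancel] at this
  rw [code, code, add_sub_cancel_right, h2, Finset.sum_insert (by simp), if_pos hk,
    Equiv.Perm.mul_apply, simpleRefl_left]
  have h3 : ∑ j ∈ Finset.Icc 1 (k - 1), (if (w * simpleRefl k) j < w (k + 1) then (1 : ℤ) else 0) =
      ∑ j ∈ Finset.Icc 1 (k - 1), if w j < w (k + 1) then 1 else 0 := by
    refine Finset.sum_congr rfl fun j hj => ?_
    rw [Finset.mem_Icc] at hj
    rw [Equiv.Perm.mul_apply, simpleRefl_of_ne (by omega) (by omega)]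
  rw [h3]
  ring

lemma code_mul_simpleRefl_right {w : Equiv.Perm ℤ} {k : ℤ} (h1 : 1 ≤ k) (hk : w k < w (k + 1)) :
    code (w * simpleRefl k) (k + 1) = code w k := by
  have h2 : Finset.Icc 1 k = insert k (Finset.Icc 1 (k - 1)) := by
    have := Icc_succ_right (a := 1) (b := k - 1) (by omega)
    rwa [sub_add_cancel] at this
  rw [code, code, add_sub_cancel_right, h2, Finset.sum_insert (by simp), Equiv.Perm.mul_apply,
    Equiv.Perm.mul_apply, simpleRefl_left, simpleRefl_right, if_neg (not_lt.2 hk.le), zero_add]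
  have h3 : ∑ j ∈ Finset.Icc 1 (k - 1), (if (w * simpleRefl k) j < w k then (1 : ℤ) else 0) =
      ∑ j ∈ Finset.Icc 1 (k - 1), if w j < w k then 1 else 0 := by
    refine Finset.sum_congr rfl fun j hj => ?_
    rw [Finset.mem_Icc] at hj
    rw [Equiv.Perm.mul_apply, simpleRefl_of_ne (by omega) (by omega)]
  rw [h3]

lemma code_mul_simpleRefl_of_ne {w : Equiv.Perm ℤ} {k i : ℤ} (h1 : 1 ≤ k) (hi : i ≠ k)
    (hi' : i ≠ k + 1) : code (w * simpleRefl k) i = code w i := by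
  rw [code, code, Equiv.Perm.mul_apply, simpleRefl_of_ne hi hi']
  rcases lt_or_gt_of_ne hi with h | h
  · have h3 : ∑ j ∈ Finset.Icc 1 (i - 1), (if (w * simpleRefl k) j < w i then (1 : ℤ) else 0) =
        ∑ j ∈ Finset.Icc 1 (i - 1), if w j < w i then 1 else 0 := by
      refine Finset.sum_congr rfl fun j hj => ?_
      rw [Finset.mem_Icc] at hj
      rw [Equiv.Perm.mul_apply, simpleRefl_of_ne (by omega) (by omega)]
    rw [h3]
  · have h3 := sum_simpleRefl h1 (show k + 1 ≤ i - 1 by omega)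
      fun j => if w j < w i then (1 : ℤ) else 0
    exact congrArg (w i - 1 - ·) h3

/-- The earlier values smaller than w(k+1) are distinct and lie in [w(k), w(k+1)), so they number at
most w(k+1) - w(k). -/
lemma sub_one_le_code_succ {w : Equiv.Perm ℤ} {k : ℤ} (h : ∀ j, 1 ≤ j → j ≤ k → w k ≤ w j)
    (hk : w k < w (k + 1)) : w k - 1 ≤ code w (k + 1) := by
  rw [code, add_sub_cancel_right, Finset.sum_boole]
  have h1 : (Finset.filter (fun j => w j < w (k + 1)) (Finset.Icc 1 k)).card ≤
      (Finset.Ico (w k) (w (k + 1))).card := by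
    refine Finset.card_le_card_of_injOn w (fun j hj => ?_) w.injective.injOn
    simp only [Finset.coe_filter, Finset.mem_Icc, Set.mem_ofPred_eq] at hj
    simp only [Finset.coe_Ico, Set.mem_Ico]
    exact ⟨h j hj.1.1 hj.1.2, hj.2⟩
  rw [Int.card_Ico] at h1
  omega

lemma rowProd_succ (i : ℤ) {c : ℤ} (hc : 0 ≤ c) :
    rowProd i (c + 1) = rowProd i c * ominus (xVar i) (aVar (c + 1)) := by
  rw [rowProd, Icc_succ_right (by omega), Finset.prod_insert (by simp), mul_comm, rowProd]

lemma permX_rowProd (w : Equiv.Perm ℤ) (i c : ℤ) : permX w (rowProd i c) = rowProd (w i) c := by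
  rw [rowProd, map_prod]
  refine Finset.prod_congr rfl fun j _ => ?_
  rw [map_ominus _ _ (permX_aVar w j), permX_xVar]

/-- With f symmetric, it comes down to (1 - x_{k+1})(x_k - a) - (1 - x_k)(x_{k+1} - a) = (1 - a)(x_k
- x_{k+1}). -/
lemma isDemazure_mul_ominus {k : ℤ} (j : ℤ) {f : XA} (hf : permX (simpleRefl k) f = f) :
    IsDemazure k (f * ominus (xVar k) (aVar j)) f := by
  rw [isDemazure_iff, map_mul, hf, map_ominus _ _ (permX_aVar _ j), permX_xVar, simpleRefl_left]
  refine mul_left_cancel₀ (one_sub_ne_zero (aM j)) ?_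
  change (1 - aVar j) * _ = (1 - aVar j) * _
  have h1 := one_sub_mul_ominus (xVar k) j
  have h2 := one_sub_mul_ominus (xVar (k + 1)) j
  linear_combination (-(1 - xVar (k + 1)) * f) * h1 + ((1 - xVar k) * f) * h2

lemma prod_simpleRefl {M : Type*} [CommMonoid M] {a b i : ℤ} (h1 : a ≤ i) (hn : i + 1 ≤ b)
    (f : ℤ → M) : ∏ j ∈ Finset.Icc a b, f (simpleRefl i j) = ∏ j ∈ Finset.Icc a b, f j :=
  sum_simpleRefl (M := Additive M) h1 hn f

/-- The double Grothendieck polynomial of a dominant permutation is a product. -/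
theorem isDoubleGroth_codeProd {n : ℕ} {w : Equiv.Perm ℤ} (hw : InS n w)
    (hc : ∀ i : ℤ, 1 ≤ i → i < n → code w (i + 1) ≤ code w i) : IsDoubleGroth n w (codeProd n w) := by
  induction hm : colength n w using Nat.strong_induction_on generalizing w with
  | _ m ih =>
    by_cases h : ∃ i : ℤ, 1 ≤ i ∧ i < n ∧ w i < w (i + 1)
    -- At the first ascent k the values before it decrease, so code w k = w k - 1. Dominance then
    -- forces code w (k+1) = code w k, and w s_k is again dominant with exactly one more box, in row
    -- k.
    · obtain ⟨k, hk, hmin⟩ := Finset.exists_min_image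
        ((Finset.Icc (1 : ℤ) (n - 1)).filter fun i => w i < w (i + 1)) id (by
          obtain ⟨i, h1, hn, hi⟩ := h
          exact ⟨i, Finset.mem_filter.2 ⟨Finset.mem_Icc.2 ⟨h1, by omega⟩, hi⟩⟩)
      rw [Finset.mem_filter, Finset.mem_Icc] at hk
      obtain ⟨⟨h1, hkn⟩, hk⟩ := hk
      have hdesc : ∀ d : ℕ, ∀ j, 1 ≤ j → j + d ≤ k → w (j + d) ≤ w j := by
        intro d
        induction d with
        | zero => intro j _ _; simp
        | succ d ihd =>
          intro j hj hjd
          push_cast at hjd ⊢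
          refine le_trans ?_ (ihd j hj (by omega))
          by_contra hcon
          have hcon' : w (j + d) < w (j + d + 1) := by
            rw [add_assoc]
            exact not_le.1 hcon
          have := hmin (j + d) (Finset.mem_filter.2 ⟨Finset.mem_Icc.2 ⟨by omega, by omega⟩, hcon'⟩)
          simp only [id] at this
          omega
      have hle : ∀ i j, 1 ≤ j → j ≤ i → i ≤ k → w i ≤ w j := by
        intro i j hj hji hi
        have := hdesc (i - j).toNat j hj (by omega)
        rwa [show j + ((i - j).toNat : ℤ) = i by omega] at this
      have hcode : ∀ i, 1 ≤ i → i ≤ k → code w i = w i - 1 := fun i _ hik =>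
        code_of_le fun j hj hji => hle i j hj hji.le hik
      have hkc := hcode k h1 le_rfl
      have hkc' : code w (k + 1) = code w k := by
        refine le_antisymm (hc k h1 (by omega)) ?_
        rw [hkc]
        exact sub_one_le_code_succ (fun j hj hjk => hle k j hj hjk le_rfl) hk
      have hS : InS n (w * simpleRefl k) := hw.mul (inS_simpleRefl h1 (by omega))
      have c1 := code_mul_simpleRefl_left h1 hk
      have c2 := code_mul_simpleRefl_right h1 hk
      have c3 : ∀ {i}, i ≠ k → i ≠ k + 1 → code (w * simpleRefl k) i = code w i :=
        fun {i} => code_mul_simpleRefl_of_ne h1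
      have hg := ih _ (hm ▸ colength_lt hw h1 (by omega) hk) hS (by
        intro i hi1 hin
        by_cases e1 : i = k
        · subst e1
          rw [c1, c2]
          omega
        by_cases e2 : i = k + 1
        · subst e2
          rw [c2, c3 (by omega) (by omega), ← hkc']
          exact hc _ hi1 hin
        by_cases e3 : i = k - 1
        · subst e3
          rw [sub_add_cancel, c1, c3 (by omega) (by omega), hkc', hkc, hcode _ hi1 (by omega)]
          have := hle k (k - 1) hi1 (by omega) le_rfl
          have := w.injective.ne (show k ≠ k - 1 by omega)
          omega
        · rw [c3 e1 e2, c3 (by omega) (by omega)]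
          exact hc _ hi1 hin) rfl
      refine .step w k _ _ h1 (by omega) hk hg ?_
      have hprod : codeProd n (w * simpleRefl k) =
          codeProd n w * ominus (xVar k) (aVar (code w k + 1)) := by
        have : ∀ i ∈ Finset.Icc (1 : ℤ) n, rowProd i (code (w * simpleRefl k) i) =
            rowProd i (code w i) * if k = i then ominus (xVar k) (aVar (code w k + 1)) else 1 := by
          intro i _
          by_cases e1 : k = i
          · subst e1
            rw [if_pos rfl, c1, hkc', rowProd_succ]
            have := (hw.mapsTo h1 (by omega)).1
            omega
          rw [if_neg e1, mul_one]
          by_cases e2 : i = k + 1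
          · subst e2
            rw [c2, hkc']
          · rw [c3 (Ne.symm e1) e2]
        rw [codeProd, Finset.prod_congr rfl this, Finset.prod_mul_distrib, Finset.prod_ite_eq,
          if_pos (Finset.mem_Icc.2 ⟨h1, by omega⟩), codeProd]
      rw [hprod]
      refine isDemazure_mul_ominus _ ?_
      rw [codeProd, map_prod, ← prod_simpleRefl h1 (show k + 1 ≤ (n : ℤ) by omega)]
      refine Finset.prod_congr rfl fun i _ => ?_
      rw [permX_rowProd, simpleRefl_simpleRefl]
      congr 1
      rw [simpleRefl_apply]
      split_ifs with e1 e2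
      · rw [e1, hkc']
      · rw [e2, hkc']
      · rfl
    · push Not at h
      have hw' := eq_longest hw fun i h1 hn => lt_of_le_of_ne (h i h1 hn) (w.injective.ne (by omega))
      rw [hw']
      have : codeProd n (longest n) = ∏ i ∈ Finset.Icc (1 : ℤ) n, ∏ j ∈ Finset.Icc (1 : ℤ) (n - i),
          ominus (xVar i) (aVar j) := by
        refine Finset.prod_congr rfl fun i hi => ?_
        rw [Finset.mem_Icc] at hi
        rw [rowProd, code_of_le, longest_apply, if_pos hi, show (n : ℤ) + 1 - i - 1 = n - i by ring]
        intro j hj hji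
        rw [longest_apply, longest_apply, if_pos hi, if_pos (by omega)]
        omega
      rw [this]
      exact .top

/-! ### Alternating sums over the first variables -/

/-- The permutations of the variables `x_1, …, x_N`. -/
def extPerm (N : ℕ) : Equiv.Perm (Fin N) →* Equiv.Perm ℤ :=
  Equiv.Perm.viaEmbeddingHom ⟨fun l : Fin N => ((l : ℕ) : ℤ) + 1, fun l m h => by
    apply Fin.ext
    simpa using h⟩

lemma extPerm_apply {N : ℕ} (σ : Equiv.Perm (Fin N)) (l : Fin N) :
    extPerm N σ ((l : ℕ) + 1) = ((σ l : Fin N) : ℕ) + 1 :=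
  Equiv.Perm.viaEmbedding_apply σ _ l

lemma extPerm_swap {m : ℕ} (i : Fin m) :
    extPerm (m + 1) (Equiv.swap i.castSucc i.succ) = simpleRefl (((i : ℕ) : ℤ) + 1) := by
  ext j
  by_cases hj : 1 ≤ j ∧ j ≤ m + 1
  · obtain ⟨l, hl⟩ : ∃ l : Fin (m + 1), j = (l : ℕ) + 1 :=
      ⟨⟨(j - 1).toNat, by omega⟩, by simp only; omega⟩
    rw [hl, extPerm_apply, simpleRefl_apply, Equiv.swap_apply_def]
    split_ifs with h1 h2 h3 h4 h5 h6 <;>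
      simp only [Fin.ext_iff, Fin.val_castSucc, Fin.val_succ] at * <;> push_cast at * <;> omega
  · have h1 : extPerm (m + 1) (Equiv.swap i.castSucc i.succ) j = j := by
      refine Equiv.Perm.viaEmbedding_apply_of_notMem _ _ _ ?_
      rintro ⟨l, rfl⟩
      apply hj
      have := l.2
      change 1 ≤ ((l : ℕ) : ℤ) + 1 ∧ ((l : ℕ) : ℤ) + 1 ≤ m + 1
      omega
    have := i.2
    rw [h1, simpleRefl_of_ne (by omega) (by omega)]

/-- The alternating sum over all permutations of `x_1, …, x_N`. -/
def altX (N : ℕ) (f : XA) : XA :=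
  ∑ σ : Equiv.Perm (Fin N), Equiv.Perm.sign σ • permX (extPerm N σ) f

lemma altX_sub (N : ℕ) (f g : XA) : altX N (f - g) = altX N f - altX N g := by
  simp only [altX, map_sub, smul_sub, Finset.sum_sub_distrib]

lemma altX_permX {N : ℕ} (τ : Equiv.Perm (Fin N)) (f : XA) :
    altX N (permX (extPerm N τ) f) = Equiv.Perm.sign τ • altX N f := by
  rw [altX, altX, Finset.smul_sum]
  refine Finset.sum_equiv (Equiv.mulRight τ) (by simp) fun σ _ => ?_
  rw [smul_smul]
  change Equiv.Perm.sign σ • permX (extPerm N σ) (permX (extPerm N τ) f) =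
    (Equiv.Perm.sign τ * Equiv.Perm.sign (σ * τ)) • permX (extPerm N (σ * τ)) f
  rw [← permX_mul_apply, ← map_mul, map_mul Equiv.Perm.sign, mul_left_comm, Int.units_mul_self,
    mul_one]

lemma altX_mul {N : ℕ} {g : XA} (hg : ∀ σ : Equiv.Perm (Fin N), permX (extPerm N σ) g = g) (f : XA) :
    altX N (g * f) = g * altX N f := by
  rw [altX, altX, Finset.mul_sum]
  refine Finset.sum_congr rfl fun σ _ => ?_
  rw [map_mul, hg, mul_smul_comm]

/-- The monomial whose alternating sum is the Vandermonde determinant. -/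
def rhoX (N : ℕ) : XA := ∏ l ∈ Finset.range N, (1 - xVar ((l : ℤ) + 1)) ^ l

lemma two_ne_zero_XA : (2 : XA) ≠ 0 := by
  intro h
  have := congrArg MvPowerSeries.constantCoeff h
  rw [map_ofNat, map_zero] at this
  exact absurd this (by norm_num)

lemma altX_sub_permX {m : ℕ} (i : Fin m) (f : XA) :
    altX (m + 1) (f - permX (simpleRefl (((i : ℕ) : ℤ) + 1)) f) = 2 * altX (m + 1) f := by
  rw [altX_sub, ← extPerm_swap, altX_permX, Equiv.Perm.sign_swap (Fin.castSucc_lt_succ).ne,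
    Units.neg_smul, one_smul]
  ring

/-- The alternating sum is invariant under divided differences. -/
lemma IsDemazure.altX_eq {m : ℕ} (i : Fin m) {f g : XA}
    (h : IsDemazure (((i : ℕ) : ℤ) + 1) f g) :
    altX (m + 1) (f * rhoX (m + 1)) = altX (m + 1) (g * rhoX (m + 1)) := by
  set k : ℤ := ((i : ℕ) : ℤ) + 1 with hk
  have hi := i.2
  -- The exponent of 1 - x_{k+1} in `rhoX` is lowered from k to k - 1, the exponent of 1 - x_k. The
  -- remaining product M is then symmetric, and the split factor 1 - x_{k+1} is the one in π_k.
  set e : ℤ → ℕ := fun j => if j = k + 1 then (k - 1).toNat else (j - 1).toNat with he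
  set M : XA := ∏ j ∈ Finset.Icc (1 : ℤ) (m + 1), (1 - xVar j) ^ e j with hM
  have hIcc : ∀ F : ℤ → XA, ∏ j ∈ Finset.Icc (1 : ℤ) (m + 1), F j =
      ∏ l ∈ Finset.range (m + 1), F ((l : ℤ) + 1) := by
    intro F
    symm
    refine Finset.prod_nbij (fun l : ℕ => (l : ℤ) + 1) (fun l hl => ?_) (fun a _ b _ hab => ?_)
      (fun j hj => ?_) fun _ _ => rfl
    · rw [Finset.mem_range] at hl
      rw [Finset.mem_Icc]
      omega
    · simpa using hab
    · simp only [Finset.coe_Icc, Set.mem_Icc] at hj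
      exact ⟨(j - 1).toNat, by simp only [Finset.coe_range, Set.mem_Iio]; omega, by simp only; omega⟩
  have hrho : rhoX (m + 1) = M * (1 - xVar (k + 1)) := by
    have h1 : rhoX (m + 1) = ∏ j ∈ Finset.Icc (1 : ℤ) (m + 1), (1 - xVar j) ^ (j - 1).toNat := by
      rw [hIcc, rhoX]
      refine Finset.prod_congr rfl fun l _ => ?_
      rw [add_sub_cancel_right, Int.toNat_natCast]
    have h2 : ∀ j ∈ Finset.Icc (1 : ℤ) (m + 1), (1 - xVar j) ^ (j - 1).toNat =
        (1 - xVar j) ^ e j * if k + 1 = j then 1 - xVar (k + 1) else 1 := by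
      intro j _
      by_cases hj : k + 1 = j
      · rw [if_pos hj, ← hj]
        simp only [he, if_true]
        rw [← pow_succ]
        congr 1
        omega
      · rw [if_neg hj, mul_one]
        simp only [he]
        rw [if_neg (Ne.symm hj)]
    rw [h1, Finset.prod_congr rfl h2, Finset.prod_mul_distrib, Finset.prod_ite_eq,
      if_pos (Finset.mem_Icc.2 ⟨by omega, by omega⟩)]
  have hMs : permX (simpleRefl k) M = M := by
    rw [hM, map_prod, ← prod_simpleRefl (i := k) (by omega) (by omega)]
    refine Finset.prod_congr rfl fun j _ => ?_
    rw [map_pow, map_sub, map_one, permX_xVar, simpleRefl_simpleRefl]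
    congr 1
    simp only [he, simpleRefl_apply]
    split_ifs <;> omega
  have h1 : f * rhoX (m + 1) - permX (simpleRefl k) (f * rhoX (m + 1)) =
      g * rhoX (m + 1) - permX (simpleRefl k) (g * rhoX (m + 1)) := by
    have h2 := isDemazure_iff.1 h
    rw [hrho]
    simp only [map_mul, hMs, map_sub, map_one, permX_xVar, simpleRefl_right, h.permX_eq]
    linear_combination (-M) * h2
  have h3 := congrArg (altX (m + 1)) h1
  rw [altX_sub_permX, altX_sub_permX] at h3
  exact mul_left_cancel₀ two_ne_zero_XA h3

lemma permX_extPerm_eq {m : ℕ} {g : XA}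
    (hg : ∀ i : Fin m, permX (simpleRefl (((i : ℕ) : ℤ) + 1)) g = g)
    (σ : Equiv.Perm (Fin (m + 1))) : permX (extPerm (m + 1) σ) g = g := by
  have h : σ ∈ Submonoid.closure (Set.range fun i : Fin m => Equiv.swap i.castSucc i.succ) := by
    rw [Equiv.Perm.mclosure_swap_castSucc_succ]
    trivial
  induction h using Submonoid.closure_induction with
  | mem σ hσ =>
    obtain ⟨i, rfl⟩ := hσ
    rw [extPerm_swap, hg]
  | one => rw [map_one, permX_one_apply]
  | mul σ τ _ _ hσ hτ => rw [map_mul, permX_mul_apply, hτ, hσ]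

lemma altX_prod {N : ℕ} (F : Fin N → ℤ → XA)
    (hF : ∀ (w : Equiv.Perm ℤ) i j, permX w (F i j) = F i (w j)) :
    altX N (∏ i : Fin N, F i (((i : ℕ) : ℤ) + 1)) =
      Matrix.det (Matrix.of fun i l : Fin N => F i (((l : ℕ) : ℤ) + 1)) := by
  rw [← Matrix.det_transpose, Matrix.det_apply, altX]
  refine Finset.sum_congr rfl fun σ _ => ?_
  congr 1
  rw [map_prod]
  refine Finset.prod_congr rfl fun i _ => ?_
  rw [hF, extPerm_apply]
  rfl

/-! ### Grassmannian permutations -/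

/-- The chain from w · σ to v uses only reflections of the first m + 1 positions. Since w is
increasing there, each ascent of σ is an ascent of wσ, and each divided difference preserves the
weighted alternating sum. -/
lemma altX_isDoubleGroth {n m : ℕ} (hmn : m + 1 ≤ n) {w v : Equiv.Perm ℤ} (hw : InS n w)
    (hinc : ∀ i j : ℤ, 1 ≤ i → i < j → j ≤ m + 1 → w i < w j) (hv : v = w * longest (m + 1))
    {f : XA} (hf : IsDoubleGroth n v f) {σ : Equiv.Perm ℤ} (hσ : InS (m + 1) σ) :
    ∃ g, IsDoubleGroth n (w * σ) g ∧
      altX (m + 1) (g * rhoX (m + 1)) = altX (m + 1) (f * rhoX (m + 1)) := by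
  induction hm : colength n (w * σ) using Nat.strong_induction_on generalizing σ with
  | _ d ih =>
    by_cases h : ∃ i : ℤ, 1 ≤ i ∧ i < m + 1 ∧ σ i < σ (i + 1)
    · obtain ⟨i, h1, hi, hlt⟩ := h
      have hlt' : (w * σ) i < (w * σ) (i + 1) :=
        hinc _ _ (hσ.mapsTo h1 (by push_cast; omega)).1 hlt
          (by exact_mod_cast (hσ.mapsTo (j := i + 1) (by omega) (by push_cast; omega)).2)
      obtain ⟨g, hg, hg'⟩ := ih _ (hm ▸ colength_lt (hw.mul (hσ.mono hmn)) h1 (by omega) hlt')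
        (hσ.mul (inS_simpleRefl h1 (by push_cast; omega))) (by rw [mul_assoc])
      rw [← mul_assoc] at hg
      obtain ⟨k, -, hk⟩ := exists_isDemazure i hg.mem_polyX
      refine ⟨k, .step _ i _ _ h1 (by omega) hlt' hg hk, ?_⟩
      rw [← hg']
      have e : (((⟨(i - 1).toNat, by omega⟩ : Fin m) : ℕ) : ℤ) + 1 = i := by simp only; omega
      rw [← e] at hk
      exact hk.altX_eq.symm
    · push Not at h
      have := eq_longest hσ fun i h1 hi =>
        lt_of_le_of_ne (h i h1 (by push_cast at hi; omega)) (σ.injective.ne (by omega))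
      rw [this, ← hv]
      exact ⟨f, hf, rfl⟩

/-- The determinantal formula for the double Grothendieck polynomial of a Grassmannian
permutation. -/
theorem IsDoubleGroth.mul_det {n m : ℕ} (hmn : m + 1 ≤ n) {w : Equiv.Perm ℤ} {g : XA}
    (hg : IsDoubleGroth n w g) (hinc : ∀ i j : ℤ, 1 ≤ i → i < j → j ≤ m + 1 → w i < w j)
    (hinc' : ∀ i j : ℤ, (m : ℤ) + 1 < i → i < j → w i < w j) :
    g * Matrix.det (Matrix.of fun i l : Fin (m + 1) => (1 - xVar (((l : ℕ) : ℤ) + 1)) ^ (i : ℕ)) =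
      Matrix.det (Matrix.of fun i l : Fin (m + 1) =>
        rowProd (((l : ℕ) : ℤ) + 1) (w ((m : ℤ) + 1 - (i : ℕ)) - 1) *
          (1 - xVar (((l : ℕ) : ℤ) + 1)) ^ (i : ℕ)) := by
  have hw := hg.inS
  set v := w * longest (m + 1) with hv
  have hvS : InS n v := hw.mul ((inS_longest _).mono hmn)
  have hv1 : ∀ i : ℤ, 1 ≤ i → i ≤ m + 1 → v i = w (m + 2 - i) := by
    intro i h1 hi
    rw [hv, Equiv.Perm.mul_apply, longest_apply, if_pos (by push_cast; omega),
      show ((m + 1 : ℕ) : ℤ) + 1 - i = m + 2 - i by push_cast; ring]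
  have hv2 : ∀ i : ℤ, (m : ℤ) + 1 < i → v i = w i := by
    intro i hi
    rw [hv, Equiv.Perm.mul_apply, longest_apply, if_neg (by push_cast; omega)]
  have hc1 : ∀ i : ℤ, 1 ≤ i → i ≤ m + 1 → code v i = w (m + 2 - i) - 1 := by
    intro i h1 hi
    rw [code_of_le, hv1 i h1 hi]
    intro j hj hji
    rw [hv1 i h1 hi, hv1 j hj (by omega)]
    exact (hinc _ _ (by omega) (by omega) (by omega)).le
  -- Beyond position m + 1 the values increase, so all the smaller positive values occur at earlier
  -- positions and the code vanishes. This makes v dominant.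
  have hc2 : ∀ i : ℤ, (m : ℤ) + 1 < i → i ≤ n → code v i = 0 := by
    intro i hi hin
    have h1 := hvS.mapsTo (j := i) (by omega) hin
    rw [code, Finset.sum_boole]
    have : (Finset.filter (fun j => v j < v i) (Finset.Icc 1 (i - 1))).card =
        (Finset.Icc 1 (v i - 1)).card := by
      refine Finset.card_nbij v (fun j hj => ?_) v.injective.injOn fun y hy => ?_
      · simp only [Finset.coe_filter, Finset.mem_Icc, Set.mem_ofPred_eq] at hj
        simp only [Finset.coe_Icc, Set.mem_Icc]
        have := hvS.mapsTo (j := j) (by omega) (by omega)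
        omega
      · simp only [Finset.coe_Icc, Set.mem_Icc] at hy
        obtain ⟨j, rfl⟩ := v.surjective y
        have hj : 1 ≤ j ∧ j ≤ n := by
          by_contra hcon
          have := hvS j hcon
          omega
        refine ⟨j, ?_, rfl⟩
        simp only [Finset.coe_filter, Finset.mem_Icc, Set.mem_ofPred_eq]
        refine ⟨⟨hj.1, ?_⟩, by omega⟩
        by_contra hcon
        rcases eq_or_lt_of_le (show i ≤ j by omega) with rfl | hij
        · omega
        · have := hinc' i j hi hij
          rw [← hv2 i hi, ← hv2 j (by omega)] at this
          omega
    rw [this, Int.card_Icc]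
    omega
  have hdom : IsDoubleGroth n v (codeProd n v) := by
    refine isDoubleGroth_codeProd hvS fun i h1 hin => ?_
    by_cases hi : i + 1 ≤ m + 1
    · rw [hc1 i h1 (by omega), hc1 (i + 1) (by omega) hi]
      have := hinc (m + 2 - (i + 1)) (m + 2 - i) (by omega) (by omega) (by omega)
      omega
    · rw [hc2 (i + 1) (by omega) (by omega)]
      by_cases hi' : i ≤ m + 1
      · rw [hc1 i h1 hi']
        have := (hw.mapsTo (j := (m : ℤ) + 2 - i) (by omega) (by omega)).1
        omega
      · rw [hc2 i (by omega) (by omega)]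
  have hprod : codeProd n v = ∏ i : Fin (m + 1),
      rowProd (((i : ℕ) : ℤ) + 1) (w ((m : ℤ) + 1 - (i : ℕ)) - 1) := by
    rw [Fin.prod_univ_eq_prod_range
      (fun i : ℕ => rowProd ((i : ℤ) + 1) (w ((m : ℤ) + 1 - (i : ℕ)) - 1)), codeProd,
      ← Finset.prod_subset (s₁ := Finset.Icc (1 : ℤ) (m + 1))
        (Finset.Icc_subset_Icc_right (by exact_mod_cast hmn))]
    · symm
      refine Finset.prod_nbij (fun l : ℕ => (l : ℤ) + 1) (fun l hl => ?_) (fun a _ b _ hab => ?_)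
        (fun j hj => ?_) fun l hl => ?_
      · rw [Finset.mem_range] at hl
        rw [Finset.mem_Icc]
        omega
      · simpa using hab
      · simp only [Finset.coe_Icc, Set.mem_Icc] at hj
        exact ⟨(j - 1).toNat, by simp only [Finset.coe_range, Set.mem_Iio]; omega,
          by simp only; omega⟩
      · rw [Finset.mem_range] at hl
        rw [hc1 _ (by omega) (by omega)]
        congr 3
        ring
    · intro i hi hi'
      rw [Finset.mem_Icc] at hi hi'
      rw [hc2 i (by omega) hi.2, rowProd, Finset.Icc_eq_empty (by omega), Finset.prod_empty]
  obtain ⟨g', hg', halt⟩ := altX_isDoubleGroth hmn hw hinc hv hdom (inS_one _)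
  rw [mul_one] at hg'
  rw [hg'.unique hg] at halt
  -- Every position up to m is an ascent of w, so by uniqueness g is in the image of each π_i and
  -- hence symmetric. It can then be taken out of the alternating sum.
  have hsym : ∀ σ, permX (extPerm (m + 1) σ) g = g := by
    refine permX_extPerm_eq fun i => ?_
    have hi := i.2
    obtain ⟨f, hf⟩ := exists_isDoubleGroth (hw.mul
      (inS_simpleRefl (n := n) (i := ((i : ℕ) : ℤ) + 1) (by omega) (by omega)))
    obtain ⟨k, -, hk⟩ := exists_isDemazure (((i : ℕ) : ℤ) + 1) hf.mem_polyX
    have hk' := IsDoubleGroth.step w _ f k (by omega) (by omega)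
      (hinc _ _ (by omega) (by omega) (by omega)) hf hk
    rw [hg.unique hk']
    exact hk.permX_eq
  have hrho : rhoX (m + 1) = ∏ i : Fin (m + 1), (1 - xVar (((i : ℕ) : ℤ) + 1)) ^ (i : ℕ) :=
    (Fin.prod_univ_eq_prod_range (fun i : ℕ => (1 - xVar ((i : ℤ) + 1)) ^ i) _).symm
  rw [altX_mul hsym, hprod, hrho, ← Finset.prod_mul_distrib] at halt
  rw [altX_prod (fun i j => (1 - xVar j) ^ (i : ℕ)) fun w i j => by
      rw [map_pow, map_sub, map_one, permX_xVar]] at halt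
  rw [altX_prod (fun i j => rowProd j (w ((m : ℤ) + 1 - (i : ℕ)) - 1) * (1 - xVar j) ^ (i : ℕ))
    fun w i j => by rw [map_mul, permX_rowProd, map_pow, map_sub (permX w), map_one, permX_xVar]] at halt
  exact halt

end DoubleKStanley
end

noncomputable section
namespace DoubleKStanley

/-! ### Grassmannian permutations of partitions -/

lemma reverse_range_prod_succ (f : ℕ → Equiv.Perm ℤ) (k : ℕ) :
    ((List.range (k + 1)).reverse.map f).prod = f k * ((List.range k).reverse.map f).prod := by
  rw [List.range_succ, List.reverse_append, List.reverse_singleton, List.singleton_append,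
    List.map_cons, List.prod_cons]

lemma rowCycle_apply (i k : ℕ) (t : ℤ) :
    ((List.range k).reverse.map fun j : ℕ => simpleRefl ((j : ℤ) - (i : ℤ))).prod t =
      if t = -i then (k : ℤ) - i else if -i < t ∧ t ≤ (k : ℤ) - i then t - 1 else t := by
  induction k with
  | zero =>
    rw [List.range_zero, List.reverse_nil, List.map_nil, List.prod_nil, Equiv.Perm.one_apply]
    split_ifs <;> omega
  | succ k ih =>
    rw [reverse_range_prod_succ (fun j : ℕ => simpleRefl ((j : ℤ) - (i : ℤ))), Equiv.Perm.mul_apply, ih,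
      simpleRefl_apply]
    push_cast
    split_ifs <;> omega

/-- The part of the permutation of a partition coming from its first rows. -/
def rowsPerm (μ : YoungDiagram) (c : ℕ) : Equiv.Perm ℤ :=
  ((List.range c).reverse.map fun i =>
    ((List.range (μ.rowLen i)).reverse.map fun j : ℕ => simpleRefl ((j : ℤ) - (i : ℤ))).prod).prod

lemma rowsPerm_succ_apply (μ : YoungDiagram) (c : ℕ) (t : ℤ) : rowsPerm μ (c + 1) t =
    if rowsPerm μ c t = -c then (μ.rowLen c : ℤ) - c else
      if -c < rowsPerm μ c t ∧ rowsPerm μ c t ≤ (μ.rowLen c : ℤ) - c then rowsPerm μ c t - 1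
      else rowsPerm μ c t := by
  rw [rowsPerm, reverse_range_prod_succ (fun i =>
    ((List.range (μ.rowLen i)).reverse.map fun j : ℕ => simpleRefl ((j : ℤ) - (i : ℤ))).prod),
    Equiv.Perm.mul_apply, rowCycle_apply]
  rfl

lemma rowsPerm_neg (μ : YoungDiagram) (c i : ℕ) :
    rowsPerm μ c (-i) = if i < c then (μ.rowLen i : ℤ) - i else -i := by
  induction c with
  | zero => rfl
  | succ c ih =>
    rw [rowsPerm_succ_apply, ih]
    rcases lt_trichotomy i c with h | rfl | h
    · have := μ.rowLen_anti i c h.le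
      rw [if_pos h, if_pos (show i < c + 1 by omega)]
      split_ifs <;> omega
    · simp
    · rw [if_neg (show ¬i < c by omega), if_neg (show ¬i < c + 1 by omega)]
      split_ifs <;> omega

lemma rowsPerm_pos (μ : YoungDiagram) (c j : ℕ) :
    rowsPerm μ c (j + 1) = j + 1 - (min c (μ.colLen j) : ℕ) := by
  induction c with
  | zero => simp [rowsPerm]
  | succ c ih =>
    rw [rowsPerm_succ_apply, ih]
    have h : j < μ.rowLen c ↔ c < μ.colLen j := by
      rw [← YoungDiagram.mem_iff_lt_rowLen, YoungDiagram.mem_iff_lt_colLen]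
    by_cases hc : c < μ.colLen j
    · have := h.2 hc
      rw [min_eq_left hc.le, min_eq_left (Nat.succ_le_iff.2 hc)]
      push_cast
      split_ifs <;> omega
    · have := mt h.1 hc
      rw [min_eq_right (not_lt.1 hc), min_eq_right (by omega)]
      split_ifs <;> omega

lemma grassmannianPerm_eq_rowsPerm (μ : YoungDiagram) :
    grassmannianPerm μ = rowsPerm μ (μ.colLen 0) := by
  simp only [grassmannianPerm, rowsPerm, bind_pure_comp, List.map_eq_map, List.map_map]
  rfl

lemma grassmannianPerm_neg (μ : YoungDiagram) (i : ℕ) :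
    grassmannianPerm μ (-i) = (μ.rowLen i : ℤ) - i := by
  rw [grassmannianPerm_eq_rowsPerm, rowsPerm_neg]
  split_ifs with h
  · rfl
  · rw [rowLen_eq_zero (not_lt.1 h)]
    simp

lemma grassmannianPerm_pos (μ : YoungDiagram) (j : ℕ) :
    grassmannianPerm μ (j + 1) = j + 1 - μ.colLen j := by
  rw [grassmannianPerm_eq_rowsPerm, rowsPerm_pos, min_eq_right (μ.colLen_anti 0 j (Nat.zero_le j))]

lemma shiftPerm_apply (m : ℤ) (w : Equiv.Perm ℤ) (t : ℤ) : shiftPerm m w t = w (t - m) + m := rfl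

/-! ### The polynomials of Grassmannian permutations -/

lemma shift_xVar (m i : ℤ) : shift m (xVar i) = xVar (i + m) := MvPowerSeries.rename_X _ _

lemma shift_aVar (m i : ℤ) : shift m (aVar i) = aVar (i + m) := MvPowerSeries.rename_X _ _

lemma shift_rowProd (m i : ℤ) (k : ℕ) : shift m (rowProd i k) =
    ∏ t ∈ Finset.range k, ominus (xVar (i + m)) (aVar (1 + t + m)) := by
  have h : rowProd i k = ∏ t ∈ Finset.range k, ominus (xVar i) (aVar (1 + t)) := by
    induction k with
    | zero => rfl
    | succ k ih =>
      rw [Finset.prod_range_succ, ← ih, Nat.cast_succ, rowProd_succ i (Nat.cast_nonneg k),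
        add_comm 1 (k : ℤ)]
  rw [h, map_prod]
  refine Finset.prod_congr rfl fun t _ => ?_
  rw [map_ominus _ _ (shift_aVar m _), shift_xVar]

lemma inS_shiftPerm_grassmannianPerm {μ : YoungDiagram} {m : ℕ} (h : μ.colLen 0 ≤ m + 1) :
    InS (m + 1 + μ.rowLen 0) (shiftPerm (1 + m) (grassmannianPerm μ)) := by
  intro t ht
  rw [shiftPerm_apply]
  by_cases h0 : t ≤ 0
  · obtain ⟨i, hi⟩ : ∃ i : ℕ, t - (1 + m) = -i := ⟨(1 + m - t).toNat, by omega⟩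
    rw [hi, grassmannianPerm_neg, rowLen_eq_zero (by omega)]
    push_cast
    omega
  · obtain ⟨j, hj⟩ : ∃ j : ℕ, t - (1 + m) = j + 1 := ⟨(t - (1 + m) - 1).toNat, by omega⟩
    have : μ.colLen j = 0 := by
      by_contra hne
      have := YoungDiagram.mem_iff_lt_colLen.2 (Nat.pos_of_ne_zero hne)
      rw [YoungDiagram.mem_iff_lt_rowLen] at this
      omega
    rw [hj, grassmannianPerm_pos, this]
    push_cast
    omega

/-- The ambient symmetric group of the chosen polynomial is not controlled, so subsequent arguments
have to work for whichever n is returned. -/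
lemma exists_isDoubleGroth_doubleGroth {n : ℕ} {w : Equiv.Perm ℤ} (hw : InS n w) :
    ∃ n, IsDoubleGroth n w (doubleGroth w) := by
  obtain ⟨g, hg⟩ := exists_isDoubleGroth hw
  exact Classical.epsilon_spec (p := fun g => ∃ n, IsDoubleGroth n w g) ⟨g, n, hg⟩

lemma doubleGroth_one : doubleGroth 1 = 1 := by
  obtain ⟨n, hn⟩ := exists_isDoubleGroth_doubleGroth (inS_one 0)
  have hc : ∀ i : ℤ, 1 ≤ i → code 1 i = 0 := by
    intro i hi
    rw [code, Finset.sum_congr rfl (g := fun _ => 1), Finset.sum_const, Int.card_Icc]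
    · simp only [Equiv.Perm.one_apply, nsmul_eq_mul, mul_one]
      omega
    · intro j hj
      rw [Finset.mem_Icc] at hj
      rw [Equiv.Perm.one_apply, Equiv.Perm.one_apply, if_pos (by omega)]
  have h := isDoubleGroth_codeProd (inS_one n) fun i h1 _ => by
    rw [hc i h1, hc (i + 1) (by omega)]
  rw [hn.unique h, codeProd]
  refine Finset.prod_eq_one fun i hi => ?_
  rw [Finset.mem_Icc] at hi
  rw [hc i hi.1]
  rfl

/-- The variables `x_{-m}, …, x_0`. -/
def negVars (m : ℕ) (l : Fin (m + 1)) : MaxId := xM ((l : ℕ) - m)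

lemma negVars_injective (m : ℕ) : Function.Injective (negVars m) := fun l l' h => by
  have := xM_injective h
  exact Fin.ext (by omega)

/-- After the shift, the determinantal formula for the Grassmannian permutation has exactly the rows
of `rowPoly μ (m + 1)` at the letters x_{-m}, …, x_0, so both sides agree after multiplication by
the Vandermonde determinant. -/
theorem intervalGroth_grassmannianPerm {μ : YoungDiagram} {m : ℕ} (hμ : μ.colLen 0 ≤ m + 1) :
    intervalGroth (-m) (grassmannianPerm μ) = ev (superAlph (negVars m)) (partDet μ) := by
  rw [intervalGroth, sub_neg_eq_add]
  obtain ⟨n, hn⟩ := exists_isDoubleGroth_doubleGroth (inS_shiftPerm_grassmannianPerm hμ)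
  by_cases hmn : m + 1 ≤ n
  · have hneg : ∀ i : ℕ, shiftPerm (1 + m) (grassmannianPerm μ) ((m : ℤ) + 1 - i) =
        μ.rowLen i - i + (1 + m) := by
      intro i
      rw [shiftPerm_apply, show (m : ℤ) + 1 - i - (1 + m) = -i by ring, grassmannianPerm_neg]
    have h := hn.mul_det hmn (fun i j h1 hij hj => by
      obtain ⟨a, rfl⟩ : ∃ a : ℕ, i = m + 1 - a := ⟨(m + 1 - i).toNat, by omega⟩
      obtain ⟨b, rfl⟩ : ∃ b : ℕ, j = m + 1 - b := ⟨(m + 1 - j).toNat, by omega⟩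
      rw [hneg, hneg]
      have := μ.rowLen_anti b a (by omega)
      omega) (fun i j hi hij => by
      rw [shiftPerm_apply, shiftPerm_apply]
      obtain ⟨a, ha⟩ : ∃ a : ℕ, i - (1 + m) = a + 1 := ⟨(i - (1 + m) - 1).toNat, by omega⟩
      obtain ⟨b, hb⟩ : ∃ b : ℕ, j - (1 + m) = b + 1 := ⟨(j - (1 + m) - 1).toNat, by omega⟩
      rw [ha, hb, grassmannianPerm_pos, grassmannianPerm_pos]
      have := μ.colLen_anti a b (by omega)
      omega)
    have h := congrArg (shift (-m - 1)) h
    have hx := negVars_injective m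
    refine mul_right_cancel₀ (alternant_vanRows_ne_zero hx) ?_
    rw [ev_superAlph_partDet hx μ hμ]
    rw [map_mul, AlgHom.map_det, AlgHom.map_det] at h
    have hu : ∀ l : Fin (m + 1), shift (-m - 1) (1 - xVar (((l : ℕ) : ℤ) + 1)) =
        uVar (negVars m) l := by
      intro l
      rw [map_sub, map_one, shift_xVar, show ((l : ℕ) : ℤ) + 1 + (-m - 1) = (l : ℕ) - m by ring]
      rfl
    rw [alternant_apply, alternant_apply]
    convert h using 2
    · congr 1
      refine Matrix.ext fun i l => ?_
      simp only [Matrix.of_apply, AlgHom.mapMatrix_apply, Matrix.map_apply, map_pow, hu, vanRows,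
        Polynomial.aeval_X]
    · refine Matrix.ext fun i l => ?_
      simp only [Matrix.of_apply, AlgHom.mapMatrix_apply, Matrix.map_apply, map_pow, map_mul, hu,
        rowPoly, Polynomial.aeval_X]
      have hi := i.2
      rw [hneg, show (μ.rowLen i : ℤ) - ((i : ℕ) : ℤ) + (1 + m) - 1 =
        ((μ.rowLen i + (m + 1 - 1 - i) : ℕ) : ℤ) by omega, shift_rowProd, mul_comm]
      refine congrArg (· * uVar (negVars m) l ^ (i : ℕ)) ?_
      change evalU (negVars m l) (bracket _ _) = _
      rw [bracket, map_prod]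
      refine Finset.prod_congr rfl fun t _ => ?_
      rw [show ((l : ℕ) : ℤ) + 1 + (-m - 1) = (l : ℕ) - m by ring,
        show (1 : ℤ) + t + (-m - 1) = 1 - (m + 1 : ℕ) + t by push_cast; ring]
      exact (ominus_eq_evalU (negVars m l) _).symm
  -- If the chosen n is at most m, the shifted permutation fixes m + 1; since w_μ(0) = μ_0, the
  -- partition is then empty.
  · have hS := hn.inS
    have h0 : μ.rowLen 0 = 0 := by
      have h1 := hS (m + 1) (by omega)
      rw [shiftPerm_apply, show (m : ℤ) + 1 - (1 + m) = -(0 : ℕ) by push_cast; ring,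
        grassmannianPerm_neg] at h1
      push_cast at h1
      omega
    have hbot : μ = ⊥ := by
      refine le_bot_iff.1 ?_
      rintro ⟨i, j⟩ hij
      have h1 := YoungDiagram.mem_iff_lt_rowLen.1 hij
      have h2 := μ.rowLen_anti 0 i (Nat.zero_le i)
      omega
    have h : (⊥ : YoungDiagram).colLen 0 = 0 := by
      by_contra h
      exact YoungDiagram.notMem_bot _ (YoungDiagram.mem_iff_lt_colLen.2 (Nat.pos_of_ne_zero h))
    have hone : shiftPerm (1 + m) (grassmannianPerm ⊥) = 1 := by
      rw [grassmannianPerm, h]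
      ext t
      simp [shiftPerm_apply]
    rw [hbot, hone, doubleGroth_one, partDet_bot, map_one, map_one]

/-! ### Back stable limits -/

lemma coeff_sum_monomial {τ : Type*} (T : Finset τ) (D : τ → ℤ ⊕ ℤ →₀ ℕ) (hD : Set.InjOn D T)
    (d : ℤ ⊕ ℤ →₀ ℕ) [Decidable (∃ t ∈ T, D t = d)] :
    MvPowerSeries.coeff d (∑ t ∈ T, MvPowerSeries.monomial (D t) (1 : ℤ)) =
      if ∃ t ∈ T, D t = d then 1 else 0 := by
  classical
  rw [map_sum]
  simp only [MvPowerSeries.coeff_monomial]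
  split_ifs with h
  · obtain ⟨t, ht, rfl⟩ := h
    rw [Finset.sum_eq_single_of_mem t ht fun t' ht' hne => if_neg fun he => hne (hD ht' ht he.symm),
      if_pos rfl]
  · exact Finset.sum_eq_zero fun t ht => if_neg fun he => h ⟨t, ht, he.symm⟩

lemma prod_X_pow {σ : Type} (s : Finset ℕ) (e : ℕ → σ) (l : ℕ → ℕ) :
    ∏ i ∈ s, (MvPowerSeries.X (e i) : MvPowerSeries σ ℤ) ^ l i =
      MvPowerSeries.monomial (∑ i ∈ s, Finsupp.single (e i) (l i)) 1 := by
  classical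
  induction s using Finset.induction_on with
  | empty => rfl
  | insert i s hi ih =>
    rw [Finset.prod_insert hi, Finset.sum_insert hi, ih, MvPowerSeries.X_pow_eq,
      MvPowerSeries.monomial_mul_monomial, one_mul]

lemma sum_single_apply {σ : Type} (s : Finset ℕ) {e : ℕ → σ} (he : Function.Injective e) (l : ℕ → ℕ)
    (j : ℕ) : (∑ i ∈ s, Finsupp.single (e i) (l i)) (e j) = if j ∈ s then l j else 0 := by
  classical
  rw [Finsupp.finsetSum_apply]
  simp only [Finsupp.single_apply, he.eq_iff]
  rw [Finset.sum_ite_eq']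

lemma sum_single_apply_of_notMem {σ : Type} (s : Finset ℕ) {e : ℕ → σ} (l : ℕ → ℕ) {t : σ}
    (ht : ∀ i, e i ≠ t) : (∑ i ∈ s, Finsupp.single (e i) (l i)) t = 0 := by
  classical
  rw [Finsupp.finsetSum_apply]
  exact Finset.sum_eq_zero fun i _ => Finsupp.single_eq_of_ne (ht i).symm

lemma exists_vanish_of_ge (d : ℤ ⊕ ℤ →₀ ℕ) :
    ∃ M₀ : ℕ, ∀ i, M₀ ≤ i → d (Sum.inl (negIdx i)) = 0 ∧ d (Sum.inr (negIdx i)) = 0 := by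
  refine ⟨∑ t ∈ d.support, (Sum.elim id id t).natAbs + 1, fun i hi => ?_⟩
  have h : ∀ t, (Sum.elim id id t).natAbs = i → d t = 0 := by
    intro t ht
    by_contra hne
    have := Finset.single_le_sum (f := fun t : ℤ ⊕ ℤ => (Sum.elim id id t).natAbs)
      (fun _ _ => Nat.zero_le _) (Finsupp.mem_support_iff.2 hne)
    omega
  exact ⟨h _ (by simp [negIdx]), h _ (by simp [negIdx])⟩

/-- Monomials dividing d involve no x_{-i} with i ≥ M, so at these monomials the infinite alphabet
cannot be distinguished from x_0, …, x_{1-M}. Square-free monomials of degree k correspond to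
k-subsets. -/
lemma eX_sub_mem {d : ℤ ⊕ ℤ →₀ ℕ} {M : ℕ} (hM : ∀ i, M ≤ i → d (Sum.inl (negIdx i)) = 0) (k : ℕ) :
    eX k - PowerSeries.coeff k (∏ i ∈ Finset.range M, pt (xM (negIdx i))).ser ∈ truncIdeal d := by
  classical
  intro d' hd'
  set e : ℕ → ℤ ⊕ ℤ := fun i => Sum.inl (negIdx i) with he
  have hei : Function.Injective e := Sum.inl_injective.comp negIdx_injective
  have hM' : ∀ i, M ≤ i → d' (e i) = 0 := fun i hi => Nat.le_zero.1 ((hM i hi) ▸ hd' _)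
  set D : Finset ℕ → ℤ ⊕ ℤ →₀ ℕ := fun t => ∑ i ∈ t, Finsupp.single (e i) 1 with hD
  have hDe : ∀ t i, D t (e i) = if i ∈ t then 1 else 0 := fun t i => sum_single_apply t hei _ i
  have h1 : PowerSeries.coeff k (∏ i ∈ Finset.range M, pt (xM (negIdx i))).ser =
      ∑ t ∈ (Finset.range M).powersetCard k, MvPowerSeries.monomial (D t) (1 : ℤ) := by
    rw [coeff_prod_pt]
    refine Finset.sum_congr rfl fun t _ => ?_
    rw [← prod_X_pow]
    simp only [pow_one]
    rfl
  rw [map_sub, h1, coeff_sum_monomial _ _ (fun t _ t' _ h => by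
    ext i
    have := DFunLike.congr_fun h (e i)
    rw [hDe, hDe] at this
    by_cases h1 : i ∈ t <;> by_cases h2 : i ∈ t' <;> simp_all), sub_eq_zero]
  change (if _ then _ else _) = _
  refine if_congr ?_ rfl rfl
  constructor
  · rintro ⟨ha, hx, hle, hdeg⟩
    set t := (Finset.range M).filter fun i => d' (e i) = 1 with ht
    have hDt : D t = d' := by
      ext s
      by_cases hs : ∃ i, e i = s
      · obtain ⟨i, rfl⟩ := hs
        rw [hDe]
        have h1 := hle (negIdx i)
        by_cases hi : M ≤ i
        · rw [hM' i hi, if_neg]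
          simp [ht, hi]
        · simp only [ht, Finset.mem_filter, Finset.mem_range, not_le.1 hi, true_and]
          change d' (e i) ≤ 1 at h1
          split_ifs with h2 <;> omega
      · rw [hD, sum_single_apply_of_notMem _ _ fun i hi => hs ⟨i, hi⟩]
        rcases s with i | i
        · refine (hx i ?_).symm
          by_contra hi
          exact hs ⟨(-i).toNat, congrArg Sum.inl (by simp only [negIdx]; omega)⟩
        · exact (ha i).symm
    refine ⟨t, Finset.mem_powersetCard.2 ⟨Finset.filter_subset _ _, ?_⟩, hDt⟩
    rw [← hdeg, ← hDt, hD, map_sum]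
    simp
  · rintro ⟨t, ht, rfl⟩
    rw [Finset.mem_powersetCard] at ht
    refine ⟨fun i => sum_single_apply_of_notMem _ _ fun j => by simp [he], fun i hi =>
      sum_single_apply_of_notMem _ _ fun j hj => ?_, fun i => ?_, ?_⟩
    · have := Sum.inl_injective hj
      simp only [negIdx] at this
      omega
    · by_cases hs : ∃ j, e j = Sum.inl i
      · obtain ⟨j, hj⟩ := hs
        rw [← hj, hDe]
        split_ifs <;> omega
      · rw [hD, sum_single_apply_of_notMem _ _ fun j hj => hs ⟨j, hj⟩]
        omega
    · rw [hD, map_sum]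
      simp [ht.2]

/-- The same truncation for the denominators: monomials of degree k correspond to exponent vectors
of sum k, with sign (-1)^k coming from 1/(1 + a_i t). -/
lemma hA_sub_mem {d : ℤ ⊕ ℤ →₀ ℕ} {M : ℕ} (hM : ∀ i, M ≤ i → d (Sum.inr (negIdx i)) = 0) (k : ℕ) :
    (-1) ^ k * hA k - PowerSeries.coeff k (∏ i ∈ Finset.range M, (pt (aM (negIdx i)))⁻¹).ser ∈
      truncIdeal d := by
  classical
  set e : ℕ → ℤ ⊕ ℤ := fun i => Sum.inr (negIdx i) with he
  have hei : Function.Injective e := Sum.inr_injective.comp negIdx_injective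
  set D : (ℕ →₀ ℕ) → ℤ ⊕ ℤ →₀ ℕ := fun l => ∑ i ∈ Finset.range M, Finsupp.single (e i) (l i) with hD
  have hDe : ∀ l i, D l (e i) = if i ∈ Finset.range M then l i else 0 :=
    fun l i => sum_single_apply _ hei _ i
  have h1 : PowerSeries.coeff k (∏ i ∈ Finset.range M, (pt (aM (negIdx i)))⁻¹).ser =
      (-1) ^ k * ∑ l ∈ (Finset.range M).finsuppAntidiag k, MvPowerSeries.monomial (D l) (1 : ℤ) := by
    rw [ser_prod, PowerSeries.coeff_prod, Finset.mul_sum]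
    refine Finset.sum_congr rfl fun l hl => ?_
    rw [← prod_X_pow, ← (Finset.mem_finsuppAntidiag.1 hl).1, ← Finset.prod_pow_eq_pow_sum,
      ← Finset.prod_mul_distrib]
    refine Finset.prod_congr rfl fun i _ => ?_
    rw [pt_inv_ser, PowerSeries.coeff_mk, neg_pow]
    rfl
  rw [h1, ← mul_sub]
  refine Ideal.mul_mem_left _ _ fun d' hd' => ?_
  have hM' : ∀ i, M ≤ i → d' (e i) = 0 := fun i hi => Nat.le_zero.1 ((hM i hi) ▸ hd' _)
  rw [map_sub, coeff_sum_monomial _ _ (fun l hl l' hl' h => by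
    ext i
    have h2 := DFunLike.congr_fun h (e i)
    rw [hDe, hDe] at h2
    by_cases hi : i ∈ Finset.range M
    · rwa [if_pos hi, if_pos hi] at h2
    · rw [Finset.mem_coe, Finset.mem_finsuppAntidiag] at hl hl'
      rw [Finsupp.notMem_support_iff.1 fun h => hi (hl.2 h),
        Finsupp.notMem_support_iff.1 fun h => hi (hl'.2 h)]), sub_eq_zero]
  change (if _ then _ else _) = _
  refine if_congr ?_ rfl rfl
  have hdeg : ∀ l, (D l).degree = ∑ i ∈ Finset.range M, l i := by
    intro l
    rw [hD, map_sum]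
    simp
  constructor
  · rintro ⟨hx, ha, hk⟩
    set l : ℕ →₀ ℕ := Finsupp.onFinset (Finset.range M) (fun i => if i < M then d' (e i) else 0)
      (fun i hi => by
        rw [Finset.mem_range]
        by_contra h
        exact hi (if_neg h)) with hl
    have hDl : D l = d' := by
      ext s
      by_cases hs : ∃ i, e i = s
      · obtain ⟨i, rfl⟩ := hs
        rw [hDe]
        by_cases hi : M ≤ i
        · rw [hM' i hi, if_neg (by simpa using hi)]
        · rw [if_pos (by simpa using hi), hl, Finsupp.onFinset_apply, if_pos (not_le.1 hi)]
      · rw [hD, sum_single_apply_of_notMem _ _ fun i hi => hs ⟨i, hi⟩]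
        rcases s with i | i
        · exact (hx i).symm
        · refine (ha i ?_).symm
          by_contra hi
          exact hs ⟨(-i).toNat, congrArg Sum.inr (by simp only [negIdx]; omega)⟩
    refine ⟨l, Finset.mem_finsuppAntidiag.2 ⟨?_, Finsupp.support_onFinset_subset⟩, hDl⟩
    rw [← hdeg, hDl, hk]
  · rintro ⟨l, hl, rfl⟩
    rw [Finset.mem_finsuppAntidiag] at hl
    refine ⟨fun i => sum_single_apply_of_notMem _ _ fun j => by simp [he], fun i hi =>
      sum_single_apply_of_notMem _ _ fun j hj => ?_, ?_⟩
    · have := Sum.inr_injective hj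
      simp only [negIdx] at this
      omega
    · rw [hdeg, hl.1]

/-- The super elementary symmetric series are approximated by those of finite alphabets. -/
lemma superE_sub_mem {d : ℤ ⊕ ℤ →₀ ℕ} {M : ℕ}
    (hM : ∀ i, M ≤ i → d (Sum.inl (negIdx i)) = 0 ∧ d (Sum.inr (negIdx i)) = 0) (k : ℕ) :
    superE k - PowerSeries.coeff k
      (∏ i ∈ Finset.range M, (pt (xM (negIdx i)) * (pt (aM (negIdx i)))⁻¹)).ser ∈ truncIdeal d := by
  rw [Finset.prod_mul_distrib, Point.ser_mul, PowerSeries.coeff_mul, superE, ← Finset.sum_sub_distrib]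
  refine Ideal.sum_mem _ fun ij _ => ?_
  have h1 := eX_sub_mem (fun i hi => (hM i hi).1) ij.1
  have h2 := hA_sub_mem (fun i hi => (hM i hi).2) ij.2
  have h3 := Ideal.add_mem _ (Ideal.mul_mem_left _ (eX ij.1) h2) (Ideal.mul_mem_right
    (PowerSeries.coeff ij.2 (∏ i ∈ Finset.range M, (pt (aM (negIdx i)))⁻¹).ser) _ h1)
  convert h3 using 1
  ring

lemma superAlph_negVars (m : ℕ) : superAlph (negVars m) =
    ∏ i ∈ Finset.range (m + 1), (pt (xM (negIdx i)) * (pt (aM (negIdx i)))⁻¹) := by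
  rw [Finset.prod_mul_distrib, Finset.prod_inv_distrib, superAlph, alph]
  congr 1
  refine (Fin.prod_univ_eq_prod_range (fun l : ℕ => pt (xM ((l : ℤ) - m))) (m + 1)).trans ?_
  rw [← Finset.prod_range_reflect]
  refine Finset.prod_congr rfl fun i hi => ?_
  rw [Finset.mem_range] at hi
  congr 2
  simp only [negIdx]
  omega

/-- The realized generating series agrees with that of (x_{-m}, …, x_0 / a_{-m}, …, a_0) on all
monomials dividing d once m is large, and congruence of points gives congruence of values. -/
theorem isBackStableLimit_partDet (μ : YoungDiagram) :
    IsBackStableLimit (grassmannianPerm μ) (partDet μ ⊗ₜ 1) := by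
  intro d
  obtain ⟨M₀, hM₀⟩ := exists_vanish_of_ge d
  filter_upwards [Filter.eventually_le_atBot (-((max M₀ (μ.colLen 0) : ℕ) : ℤ))] with p hp
  obtain ⟨m, rfl⟩ : ∃ m : ℕ, p = -m := ⟨(-p).toNat, by omega⟩
  rw [intervalGroth_grassmannianPerm (by omega)]
  have h := realizeLam_congr (E := superAlph (negVars m)) (d := d) (fun k => by
    rw [superAlph_negVars]
    exact superE_sub_mem (fun i hi => hM₀ i (by omega)) k) (partDet μ)
  have h1 := h d le_rfl
  rw [map_sub, sub_eq_zero] at h1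
  rw [← h1, realize, Algebra.TensorProduct.lift_tmul, map_one, mul_one]

end DoubleKStanley
end

noncomputable section
namespace DoubleKStanley

open scoped MvPowerSeries.WithPiTopology

/-! ### The realization is injective -/

lemma continuous_rename_int {σ τ : Type} (g : σ → τ) [Filter.TendstoCofinite g] :
    Continuous (MvPowerSeries.rename (R := ℤ) g) := by
  rw [continuous_iff_continuousAt]
  intro f
  unfold ContinuousAt
  rw [MvPowerSeries.WithPiTopology.tendsto_iff_coeff_tendsto]
  intro d
  simp only [MvPowerSeries.coeff_rename]
  exact tendsto_finsetSum _ fun i _ => (MvPowerSeries.WithPiTopology.continuous_coeff ℤ i).tendsto f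

/-! ### Substitutions that fix the variables a_i -/

section Rename

variable (g : ℤ ⊕ ℤ → ℤ ⊕ ℤ) [Filter.TendstoCofinite g]

/-- A substitution that fixes the variables `a_i`, as a homomorphism of `𝕊`-algebras. -/
def renameOver (hg : ∀ i, g (Sum.inr i) = Sum.inr i) : XA →ₐ[SS] XA where
  toRingHom := (MvPowerSeries.rename (R := ℤ) g).toRingHom
  commutes' c := by
    change MvPowerSeries.rename _ (MvPowerSeries.rename _ c) = MvPowerSeries.rename _ c
    rw [MvPowerSeries.rename_rename]
    have : g ∘ (Function.Embedding.inr : ℤ ↪ ℤ ⊕ ℤ) = (Function.Embedding.inr : ℤ ↪ ℤ ⊕ ℤ) :=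
      funext hg
    simp only [this]

variable {g} (hg : ∀ i, g (Sum.inr i) = Sum.inr i)

lemma renameOver_apply (f : XA) : renameOver g hg f = MvPowerSeries.rename g f := rfl

lemma renameOver_X (t : ℤ ⊕ ℤ) :
    renameOver g hg (MvPowerSeries.X t) = MvPowerSeries.X (g t) := MvPowerSeries.rename_X _ _

lemma renameOver_realizeLam {φ : Lam →ₐ[SS] XA} (hφ : Continuous φ)
    (h : ∀ k, renameOver g hg (superE (k + 1)) = φ (MvPowerSeries.X k)) (f : Lam) :
    renameOver g hg (realizeLam f) = φ f := by
  have : (renameOver g hg).comp realizeLam = φ := by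
    have hc : Continuous (renameOver g hg) := continuous_rename_int g
    refine algHom_eq_of_continuous (hc.comp continuous_realizeLam) hφ fun i => ?_
    rw [AlgHom.comp_apply, realizeLam_X, h]
  exact DFunLike.congr_fun this f

/-- Finitely many monomials map into the divisors of d, so one bound d₀ dominates them all. -/
lemma exists_renameOver_sub_mem (d : ℤ ⊕ ℤ →₀ ℕ) : ∃ d₀, ∀ f ∈ truncIdeal d₀,
    renameOver g hg f ∈ truncIdeal d := by
  classical
  refine ⟨∑ d' ∈ Finset.Iic d, ∑ m ∈ (Filter.TendstoCofinite.finite_preimage_singleton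
    (Finsupp.mapDomain g) d').toFinset, m, fun f hf d' hd' => ?_⟩
  rw [renameOver_apply, MvPowerSeries.coeff_rename]
  refine Finset.sum_eq_zero fun m hm => hf m ?_
  exact (Finset.single_le_sum (f := fun m : ℤ ⊕ ℤ →₀ ℕ => m) (fun _ _ => zero_le) hm).trans
    (Finset.single_le_sum (f := fun d' => ∑ m ∈ (Filter.TendstoCofinite.finite_preimage_singleton
      (Finsupp.mapDomain g) d').toFinset, m) (fun _ _ => zero_le) (Finset.mem_Iic.2 hd'))

lemma renameOver_coeff_prod (M : ℕ) (y : ℕ → MaxId)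
    (hy : ∀ i, renameOver g hg (xVar (negIdx i)) = (y i).1) (k : ℕ) :
    renameOver g hg (PowerSeries.coeff k
      (∏ i ∈ Finset.range M, (pt (xM (negIdx i)) * (pt (aM (negIdx i)))⁻¹)).ser) =
    PowerSeries.coeff k (∏ i ∈ Finset.range M, (pt (y i) * (pt (aM (negIdx i)))⁻¹)).ser := by
  rw [← AlgHom.coe_toRingHom, ← PowerSeries.coeff_map, ser_prod, ser_prod, map_prod]
  congr 1
  refine Finset.prod_congr rfl fun i _ => ?_
  have ha : renameOver g hg (aM (negIdx i)).1 = (aM (negIdx i)).1 :=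
    (renameOver_X hg _).trans (congrArg MvPowerSeries.X (hg _))
  rw [Point.ser_mul, Point.ser_mul, map_mul, pt_ser, pt_ser, pt_inv_ser, map_add, map_one, map_mul,
    PowerSeries.map_C, PowerSeries.map_X]
  refine congrArg₂ (fun a b => (1 + PowerSeries.C a * PowerSeries.X) * b) (hy i) ?_
  ext1 n
  rw [PowerSeries.coeff_map, PowerSeries.coeff_mk, map_pow, map_neg]
  exact congrArg (fun a => (-a) ^ n) ha

end Rename

/-- The substitution `x_{-i} ↦ x_{e(i)}` for `i < N` and `x_{-i} ↦ a_{N-i}` otherwise. -/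
def truncVars {N : ℕ} (e : Fin N → ℤ) : ℤ ⊕ ℤ → ℤ ⊕ ℤ :=
  Sum.elim (fun j => if h : 0 ≤ -j ∧ -j < N then Sum.inl (e ⟨(-j).toNat, by omega⟩)
    else Sum.inr (j + N)) Sum.inr

instance {N : ℕ} (e : Fin N → ℤ) : Filter.TendstoCofinite (truncVars e) := by
  rw [Filter.tendstoCofinite_iff_finite_preimage_singleton]
  intro t
  refine ((Finset.Ioc (-(N : ℤ)) 0).finite_toSet.image (Sum.inl : ℤ → ℤ ⊕ ℤ) |>.union
    (Set.toFinite {t, Sum.inl (Sum.elim id id t - N)})).subset ?_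
  rintro (j | j) h
  · by_cases hj : 0 ≤ -j ∧ -j < N
    · exact Or.inl ⟨j, by simp only [Finset.coe_Ioc, Set.mem_Ioc]; omega, rfl⟩
    · have h : (truncVars e (Sum.inl j)) = t := h
      simp only [truncVars, Sum.elim_inl, dif_neg hj] at h
      refine Or.inr (Or.inr ?_)
      rw [← h]
      simp
  · exact Or.inr (Or.inl h)

/-- The letters x_{-N}, x_{-N-1}, … become a_0, a_{-1}, … and cancel the denominators in the limit,
leaving a finite alphabet in the x variables. -/
lemma renameOver_truncVars_superE {N : ℕ} (e : Fin N → ℤ) (k : ℕ) :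
    renameOver (truncVars e) (fun _ => rfl) (superE k) =
      PowerSeries.coeff k (alph fun i => xM (e i)).ser := by
  rw [← sub_eq_zero]
  refine eq_zero_of_mem_truncIdeal fun d => ?_
  obtain ⟨d₀, hd₀⟩ := exists_renameOver_sub_mem (g := truncVars e) (fun _ => rfl) d
  obtain ⟨M₀, hM₀⟩ := exists_vanish_of_ge d₀
  obtain ⟨n₀, hn₀⟩ := exists_redPoint_eq (vanishing_aM negIdx_injective) (fun i => xM (e i)) d
  have h1 := hd₀ _ (superE_sub_mem (M := N + (M₀ + n₀)) (fun i hi => hM₀ i (by omega)) k)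
  have h2 := coeff_sub_mem_of_redPoint_eq (hn₀ (M₀ + n₀) (by omega)) k
  set y : ℕ → MaxId := fun i => if h : i < N then xM (e ⟨i, h⟩) else aM (negIdx (i - N)) with hy
  rw [map_sub, renameOver_coeff_prod (g := truncVars e) (fun _ => rfl) _ y] at h1
  · have h3 : ∏ i ∈ Finset.range (N + (M₀ + n₀)), (pt (y i) * (pt (aM (negIdx i)))⁻¹) =
        alph (Fin.append (fun i => xM (e i)) fun i : Fin (M₀ + n₀) => aM (negIdx i)) *
          (initial (fun n => aM (negIdx n)) (N + (M₀ + n₀)))⁻¹ := by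
      rw [Finset.prod_mul_distrib, Finset.prod_inv_distrib, Finset.prod_range_add, alph_append]
      refine congrArg₂ (· * ·) (congrArg₂ (· * ·) ?_ ?_) rfl
      · rw [alph, ← Fin.prod_univ_eq_prod_range (fun i => pt (y i))]
        refine Finset.prod_congr rfl fun i _ => ?_
        simp only [hy, dif_pos i.2]
      · rw [alph, ← Fin.prod_univ_eq_prod_range (fun i => pt (y (N + i)))]
        refine Finset.prod_congr rfl fun i _ => ?_
        simp only [hy, dif_neg (show ¬ N + (i : ℕ) < N by omega), Nat.add_sub_cancel_left]
    rw [h3] at h1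
    have h4 := Ideal.add_mem _ h1 h2
    rwa [sub_add_sub_cancel] at h4
  · intro i
    refine (renameOver_X _ _).trans ?_
    by_cases hi : i < N
    · have hc : 0 ≤ -negIdx i ∧ -negIdx i < N := by simp only [negIdx]; omega
      have h1 : (⟨(-negIdx i).toNat, by omega⟩ : Fin N) = ⟨i, hi⟩ :=
        Fin.ext (by simp only [negIdx]; omega)
      simp only [truncVars, Sum.elim_inl, dif_pos hc, hy, dif_pos hi, h1]
      rfl
    · have hc : ¬(0 ≤ -negIdx i ∧ -negIdx i < N) := by simp only [negIdx]; omega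
      simp only [truncVars, Sum.elim_inl, dif_neg hc, hy, dif_neg hi]
      have : negIdx i + N = negIdx (i - N) := by simp only [negIdx]; omega
      rw [this]
      rfl

/-- Substitutions turn the realization of f into its value at any finite alphabet of distinct
variables x_i, and these values determine f. -/
theorem realizeLam_injective : Function.Injective realizeLam := by
  rw [injective_iff_map_eq_zero]
  intro f hf
  have h0 : inclLeft f = 0 := by
    refine eq_zero_of_ev₂_alph_xM fun N e => ?_
    rw [ev₂_inclLeft, ← renameOver_realizeLam (g := truncVars fun i => e (Sum.inl i))
      (fun _ => rfl) (continuous_ev _) (fun k => ?_), hf, map_zero]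
    rw [renameOver_truncVars_superE, ev_X]
  exact (MvPowerSeries.rename_injective (R := SS) (Function.Embedding.inl : ℕ ↪ ℕ ⊕ ℕ))
    (h0.trans (map_zero _).symm)

/-! ### Algebraic independence of the x_i over the realization of Λ̂(x‖a) -/

lemma exists_eq_mapDomain (v : Equiv.Perm (ℤ ⊕ ℤ)) (d : ℤ ⊕ ℤ →₀ ℕ) :
    ∃ d', d = Finsupp.embDomain v.toEmbedding d' := by
  refine ⟨Finsupp.embDomain v.symm.toEmbedding d, ?_⟩
  ext t
  obtain ⟨s, rfl⟩ := v.surjective t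
  obtain ⟨r, rfl⟩ := v.symm.surjective s
  have h1 := Finsupp.embDomain_apply_self v.toEmbedding (Finsupp.embDomain v.symm.toEmbedding d)
    (v.symm r)
  have h2 := Finsupp.embDomain_apply_self v.symm.toEmbedding d r
  simp only [Equiv.coe_toEmbedding] at h1 h2
  rw [h1, h2, Equiv.apply_symm_apply]

/-- The series depends only on the set of variables with nonpositive index, which w preserves. -/
lemma permX_superE {w : Equiv.Perm ℤ} (hw : ∀ i, 0 < w i ↔ 0 < i) (k : ℕ) :
    permX w (superE k) = superE k := by
  classical
  set v : Equiv.Perm (ℤ ⊕ ℤ) := Equiv.sumCongr w (Equiv.refl ℤ) with hv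
  have hcoeff : ∀ (f : XA) d, MvPowerSeries.coeff (Finsupp.embDomain v.toEmbedding d) (permX w f) =
      MvPowerSeries.coeff d f := fun f d =>
    MvPowerSeries.coeff_embDomain_rename v.toEmbedding f d
  have hl : ∀ (d : ℤ ⊕ ℤ →₀ ℕ) i, Finsupp.embDomain v.toEmbedding d (Sum.inl (w i)) = d (Sum.inl i) :=
    fun d i => Finsupp.embDomain_apply_self v.toEmbedding d (Sum.inl i)
  have hr : ∀ (d : ℤ ⊕ ℤ →₀ ℕ) i, Finsupp.embDomain v.toEmbedding d (Sum.inr i) = d (Sum.inr i) :=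
    fun d i => Finsupp.embDomain_apply_self v.toEmbedding d (Sum.inr i)
  have hdeg : ∀ d : ℤ ⊕ ℤ →₀ ℕ, (Finsupp.embDomain v.toEmbedding d).degree = d.degree := by
    intro d
    rw [Finsupp.embDomain_eq_mapDomain, Finsupp.degree_mapDomain]
  have hX : ∀ k, permX w (eX k) = eX k := by
    intro k
    ext d
    obtain ⟨d, rfl⟩ := exists_eq_mapDomain v d
    rw [hcoeff]
    change (if _ then _ else _) = (if _ then _ else _)
    refine if_congr ?_ rfl rfl
    rw [hdeg]
    simp only [hr]
    refine and_congr_right fun _ => and_congr ?_ (and_congr_left fun _ => ?_)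
    · rw [← w.forall_congr_right (q := fun i => 0 < i →
        (Finsupp.embDomain v.toEmbedding d) (Sum.inl i) = 0)]
      simp only [hl, hw]
    · rw [← w.forall_congr_right (q := fun i =>
        (Finsupp.embDomain v.toEmbedding d) (Sum.inl i) ≤ 1)]
      simp only [hl]
  have hH : ∀ k, permX w (hA k) = hA k := by
    intro k
    ext d
    obtain ⟨d, rfl⟩ := exists_eq_mapDomain v d
    rw [hcoeff]
    change (if _ then _ else _) = (if _ then _ else _)
    refine if_congr ?_ rfl rfl
    rw [hdeg]
    simp only [hr]
    refine and_congr_left fun _ => ?_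
    rw [← w.forall_congr_right (q := fun i =>
        (Finsupp.embDomain v.toEmbedding d) (Sum.inl i) = 0)]
    simp only [hl]
  rw [superE, map_sum]
  refine Finset.sum_congr rfl fun ij _ => ?_
  rw [map_mul, map_mul, map_pow, map_neg, map_one, hX, hH]

lemma permX_realizeLam {w : Equiv.Perm ℤ} (hw : ∀ i, 0 < w i ↔ 0 < i) (f : Lam) :
    permX w (realizeLam f) = realizeLam f :=
  renameOver_realizeLam (g := Equiv.sumCongr w (Equiv.refl ℤ)) (fun _ => rfl) continuous_realizeLam
    (fun k => by rw [realizeLam_X]; exact permX_superE hw (k + 1)) f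

/-- Pairwise disjoint infinite families of integers, far from zero and of prescribed sign. -/
def farIdx (B : ℕ) (i : ℤ) (n : ℕ) : ℤ :=
  if 0 < i then ((B + 1 + Nat.pair i.natAbs n : ℕ) : ℤ) else -((B + 1 + Nat.pair i.natAbs n : ℕ) : ℤ)

lemma farIdx_pos_iff (B : ℕ) (i : ℤ) (n : ℕ) : 0 < farIdx B i n ↔ 0 < i := by
  rw [farIdx]
  split_ifs with h <;> simp only [h, iff_true, iff_false] <;> omega

lemma natAbs_farIdx (B : ℕ) (i : ℤ) (n : ℕ) :
    (farIdx B i n).natAbs = B + 1 + Nat.pair i.natAbs n := by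
  rw [farIdx]
  split_ifs <;> omega

lemma farIdx_inj {B : ℕ} {i j : ℤ} {m n : ℕ} (h : farIdx B i m = farIdx B j n) : i = j ∧ m = n := by
  have h1 := congrArg Int.natAbs h
  rw [natAbs_farIdx, natAbs_farIdx, Nat.add_left_cancel_iff, Nat.pair_eq_pair] at h1
  have h2 := farIdx_pos_iff B i m
  rw [h, farIdx_pos_iff] at h2
  exact ⟨by omega, h1.2⟩

/-- The involution exchanging each i with |i| ≤ B and its far index works: far indices have absolute
value above B, are pairwise distinct, and have the correct sign. -/
lemma exists_perm_farIdx (B : ℕ) (n : ℤ → ℕ) : ∃ w : Equiv.Perm ℤ, (∀ i, 0 < w i ↔ 0 < i) ∧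
    ∀ i : ℤ, i.natAbs ≤ B → w i = farIdx B i (n i) := by
  classical
  set F : ℤ → ℤ := fun j => if j.natAbs ≤ B then farIdx B j (n j) else
    if h : ∃ i : ℤ, i.natAbs ≤ B ∧ farIdx B i (n i) = j then h.choose else j with hF
  have h1 : ∀ i : ℤ, i.natAbs ≤ B → F i = farIdx B i (n i) := fun i hi => if_pos hi
  have h2 : ∀ i : ℤ, i.natAbs ≤ B → F (farIdx B i (n i)) = i := by
    intro i hi
    have hex : ∃ i' : ℤ, i'.natAbs ≤ B ∧ farIdx B i' (n i') = farIdx B i (n i) := ⟨i, hi, rfl⟩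
    simp only [hF]
    rw [if_neg (by rw [natAbs_farIdx]; omega), dif_pos hex]
    exact (farIdx_inj hex.choose_spec.2).1
  have h3 : ∀ j : ℤ, ¬j.natAbs ≤ B → (¬∃ i : ℤ, i.natAbs ≤ B ∧ farIdx B i (n i) = j) → F j = j := by
    intro j hj hj'
    simp only [hF]
    rw [if_neg hj, dif_neg hj']
  have hcases : ∀ j : ℤ, j.natAbs ≤ B ∨ (∃ i : ℤ, i.natAbs ≤ B ∧ farIdx B i (n i) = j) ∨ F j = j := by
    intro j
    by_cases hj : j.natAbs ≤ B
    · exact Or.inl hj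
    · by_cases hj' : ∃ i : ℤ, i.natAbs ≤ B ∧ farIdx B i (n i) = j
      · exact Or.inr (Or.inl hj')
      · exact Or.inr (Or.inr (h3 j hj hj'))
  have hinv : Function.Involutive F := by
    intro j
    rcases hcases j with hj | ⟨i, hi, rfl⟩ | hj
    · rw [h1 j hj, h2 j hj]
    · rw [h2 i hi, h1 i hi]
    · rw [hj, hj]
  refine ⟨hinv.toPerm, fun j => ?_, h1⟩
  change 0 < F j ↔ 0 < j
  rcases hcases j with hj | ⟨i, hi, rfl⟩ | hj
  · rw [h1 j hj, farIdx_pos_iff]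
  · rw [h2 i hi, farIdx_pos_iff]
  · rw [hj]

/-- The variables `x_i` are algebraically independent over the image of the realization. -/
theorem eq_zero_of_eval₂_realizeLam {P : MvPolynomial ℤ Lam}
    (hP : P.eval₂ (realizeLam : Lam →+* XA) xVar = 0) : P = 0 := by
  classical
  set B := ∑ i ∈ P.vars, i.natAbs with hB
  have hvars : ∀ i ∈ P.vars, i.natAbs ≤ B := fun i hi =>
    Finset.single_le_sum (f := fun i : ℤ => i.natAbs) (fun _ _ => Nat.zero_le _) hi
  have h : P.map (realizeLam : Lam →+* XA) = 0 := by
    -- Over a domain it suffices to test vanishing on a product of infinite sets; variable i is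
    -- tested at far variables x_j with j on the same side of zero.
    refine MvPolynomial.funext_set (fun i => Set.range fun n => xVar (farIdx B i n))
      (fun i => Set.infinite_range_of_injective fun m n h =>
        (farIdx_inj (xM_injective (Subtype.ext h))).2) fun y hy => ?_
    choose n hn using fun i => hy i (Set.mem_univ i)
    -- Permuting the x variables by w fixes the realized coefficients and carries the relation at
    -- the x_i to the chosen test point.
    obtain ⟨w, hw, hwn⟩ := exists_perm_farIdx B n
    have h1 := congrArg (permX w) hP
    rw [← AlgHom.coe_toRingHom, MvPolynomial.hom_eval₂, map_zero] at h1
    rw [map_zero, MvPolynomial.eval_map, ← h1]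
    refine MvPolynomial.eval₂Hom_congr' ?_ (fun i hi _ => ?_) rfl
    · exact RingHom.ext fun f => (permX_realizeLam hw f).symm
    · rw [← hn]
      exact ((permX_xVar w i).trans (congrArg xVar (hwn i (hvars i hi)))).symm
  exact MvPolynomial.map_injective _ realizeLam_injective (h.trans (map_zero _).symm)

/-- The element `x_i` of `R(x;a)`. -/
def xRxa (i : ℤ) : Rxa := ⟨xVar i, by
  have h := Rxa.sub_mem Rxa.one_mem (Algebra.subset_adjoin (R := Ra) (s := {f | ∃ i : ℤ, f = 1 - xVar i ∨
    f * (1 - xVar i) = 1}) ⟨i, Or.inl rfl⟩)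
  rwa [sub_sub_cancel] at h⟩

/-! ### Tensor products with rings of fractions -/

section Fractions

open MvPolynomial

variable {R A B X ι : Type*} [CommRing R] [CommRing A] [CommRing B] [CommRing X] [Algebra R A]
  [Algebra R B]

/-- Polynomials over `A` in elements of `B`, as elements of the tensor product. -/
def tensorPoly (A : Type*) [CommRing A] [Algebra R A] (y : ι → B) :
    MvPolynomial ι A →ₐ[A] A ⊗[R] B := aeval fun i => 1 ⊗ₜ y i

lemma tensorPoly_C (y : ι → B) (a : A) : tensorPoly (R := R) A y (C a) = a ⊗ₜ 1 := aeval_C _ _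

lemma tensorPoly_map (y : ι → B) (P : MvPolynomial ι R) :
    tensorPoly A y (P.map (algebraMap R A)) = 1 ⊗ₜ[R] aeval y P := by
  induction P using MvPolynomial.induction_on with
  | C c =>
    rw [map_C, tensorPoly_C, aeval_C, Algebra.algebraMap_eq_smul_one, Algebra.algebraMap_eq_smul_one,
      TensorProduct.smul_tmul]
  | add P Q hP hQ => rw [map_add, map_add, hP, hQ, map_add, TensorProduct.tmul_add]
  | mul_X P i hP =>
    rw [map_mul, map_mul, hP, map_X, map_mul, aeval_X, tensorPoly, aeval_X,
      Algebra.TensorProduct.tmul_mul_tmul, one_mul]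

lemma exists_tensorPoly_eq_mul {y : ι → B}
    (hy : ∀ b : B, ∃ P Q : MvPolynomial ι R, IsUnit (aeval y P) ∧ aeval y Q = b * aeval y P)
    (z : A ⊗[R] B) : ∃ P Q : MvPolynomial ι A, IsUnit (tensorPoly (R := R) A y P) ∧
      tensorPoly A y Q = z * tensorPoly A y P := by
  induction z using TensorProduct.induction_on with
  | zero => exact ⟨1, 0, by rw [map_one]; exact isUnit_one, by rw [map_zero, zero_mul]⟩
  | tmul a b =>
    obtain ⟨P, Q, hP, hQ⟩ := hy b
    refine ⟨P.map (algebraMap R A), C a * Q.map (algebraMap R A), ?_, ?_⟩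
    · rw [tensorPoly_map]
      exact hP.map (Algebra.TensorProduct.includeRight : B →ₐ[R] A ⊗[R] B)
    · rw [map_mul, tensorPoly_C, tensorPoly_map, tensorPoly_map, hQ,
        Algebra.TensorProduct.tmul_mul_tmul, Algebra.TensorProduct.tmul_mul_tmul, one_mul]
  | add z z' hz hz' =>
    obtain ⟨P, Q, hP, hQ⟩ := hz
    obtain ⟨P', Q', hP', hQ'⟩ := hz'
    refine ⟨P * P', Q * P' + Q' * P, ?_, ?_⟩
    · rw [map_mul]
      exact hP.mul hP'
    · rw [map_add, map_mul, map_mul, map_mul, hQ, hQ']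
      ring

/-- A homomorphism from a tensor product is injective if the second factor consists of fractions of
polynomials in elements whose images are algebraically independent over the first factor. -/
lemma tensor_injective {y : ι → B}
    (hy : ∀ b : B, ∃ P Q : MvPolynomial ι R, IsUnit (aeval y P) ∧ aeval y Q = b * aeval y P)
    (φ : A ⊗[R] B →+* X) (h : ∀ P : MvPolynomial ι A,
      P.eval₂ (φ.comp Algebra.TensorProduct.includeLeftRingHom) (fun i => φ (1 ⊗ₜ y i)) = 0 → P = 0) :
    Function.Injective φ := by
  rw [injective_iff_map_eq_zero]
  intro z hz
  obtain ⟨P, Q, hP, hQ⟩ := exists_tensorPoly_eq_mul hy z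
  have h1 : Q = 0 := by
    refine h Q ?_
    have h2 := congrArg φ hQ
    rw [map_mul, hz, zero_mul] at h2
    rw [← h2, tensorPoly, aeval_def, hom_eval₂]
    rfl
  rw [h1, map_zero] at hQ
  exact (hP.mul_left_eq_zero).1 hQ.symm

lemma exists_poly_eq_mul [Algebra R X] (v : ι → X) {f : X}
    (hf : f ∈ Algebra.adjoin R {f | ∃ i, f = 1 - v i ∨ f * (1 - v i) = 1}) :
    ∃ P Q : MvPolynomial ι R, (∃ u ∈ Algebra.adjoin R {f | ∃ i, f = 1 - v i ∨ f * (1 - v i) = 1},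
      aeval v P * u = 1) ∧ aeval v Q = f * aeval v P := by
  induction hf using Algebra.adjoin_induction with
  | mem f hf =>
    obtain ⟨i, rfl | h⟩ := hf
    · exact ⟨1, 1 - MvPolynomial.X i, ⟨1, Subalgebra.one_mem _, by rw [map_one, one_mul]⟩, by
        rw [map_sub, map_one, aeval_X, mul_one]⟩
    · refine ⟨1 - MvPolynomial.X i, 1, ⟨f, Algebra.subset_adjoin ⟨i, Or.inr h⟩, ?_⟩, ?_⟩
      · rw [map_sub, map_one, aeval_X, mul_comm, h]
      · rw [map_sub, map_one, aeval_X, h]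
  | algebraMap c =>
    exact ⟨1, C c, ⟨1, Subalgebra.one_mem _, by rw [map_one, one_mul]⟩, by
      rw [aeval_C, map_one, mul_one]⟩
  | add f g _ _ hf hg =>
    obtain ⟨P, Q, ⟨u, hu, hP⟩, hQ⟩ := hf
    obtain ⟨P', Q', ⟨u', hu', hP'⟩, hQ'⟩ := hg
    refine ⟨P * P', Q * P' + Q' * P, ⟨u * u', Subalgebra.mul_mem _ hu hu', ?_⟩, ?_⟩
    · rw [map_mul, mul_mul_mul_comm, hP, hP', one_mul]
    · rw [map_add, map_mul, map_mul, map_mul, hQ, hQ']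
      ring
  | mul f g _ _ hf hg =>
    obtain ⟨P, Q, ⟨u, hu, hP⟩, hQ⟩ := hf
    obtain ⟨P', Q', ⟨u', hu', hP'⟩, hQ'⟩ := hg
    refine ⟨P * P', Q * Q', ⟨u * u', Subalgebra.mul_mem _ hu hu', ?_⟩, ?_⟩
    · rw [map_mul, mul_mul_mul_comm, hP, hP', one_mul]
    · rw [map_mul, map_mul, hQ, hQ']
      ring

end Fractions

lemma aeval_xRxa (P : MvPolynomial ℤ Ra) :
    (MvPolynomial.aeval xRxa P : XA) = MvPolynomial.aeval xVar P :=
  (MvPolynomial.comp_aeval_apply xRxa Rxa.val P)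

/-- Elements of R(x;a) are fractions of polynomials in the x_i with invertible denominators.
Injectivity thus reduces to algebraic independence of the x_i over the realization of Λ̂(x‖a). -/
theorem realize_injective : Function.Injective realize := by
  refine tensor_injective (y := xRxa) (fun b => ?_) realize.toRingHom fun P hP =>
    eq_zero_of_eval₂_realizeLam ?_
  · obtain ⟨P, Q, ⟨u, hu, hP⟩, hQ⟩ := exists_poly_eq_mul xVar b.2
    refine ⟨P, Q, IsUnit.of_mul_eq_one (⟨u, hu⟩ : Rxa) (Subtype.ext ?_), Subtype.ext ?_⟩
    · exact (congrArg (· * u) (aeval_xRxa P)).trans hP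
    · rw [aeval_xRxa, hQ]
      exact congrArg (b.1 * ·) (aeval_xRxa P).symm
  · rw [← hP]
    have h1 : (realizeLam : Lam →+* XA) =
        realize.toRingHom.comp Algebra.TensorProduct.includeLeftRingHom := by
      refine RingHom.ext fun f => ?_
      change realizeLam f = realize (f ⊗ₜ 1)
      rw [realize, Algebra.TensorProduct.lift_tmul, map_one, mul_one]
    have h2 : xVar = fun i => realize.toRingHom ((1 : Lam) ⊗ₜ[Ra] xRxa i) := by
      funext i
      change _ = realize ((1 : Lam) ⊗ₜ[Ra] xRxa i)
      rw [realize, Algebra.TensorProduct.lift_tmul, map_one, one_mul]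
      rfl
    rw [h1, ← h2]

/-! ### The Grassmannian double K-Stanley functions -/

lemma IsBackStableLimit.unique {w : Equiv.Perm ℤ} {F F' : BackStable} (h : IsBackStableLimit w F)
    (h' : IsBackStableLimit w F') : F = F' := by
  refine realize_injective (MvPowerSeries.ext fun d => ?_)
  obtain ⟨p, hp, hp'⟩ := ((h d).and (h' d)).exists
  rw [← hp, hp']

/-- By uniqueness the chosen back stable limit is `partDet μ ⊗ 1`. Its second factor is 1, so η_a
returns the first factor unchanged. -/
theorem grassKStanley_eq_partDet (μ : YoungDiagram) : grassKStanley μ = partDet μ := by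
  have h := Classical.epsilon_spec ⟨_, isBackStableLimit_partDet μ⟩
  rw [grassKStanley, doubleKStanley, backStableGroth, h.unique (isBackStableLimit_partDet μ), eta,
    Algebra.TensorProduct.lift_tmul, map_one, mul_one]
  rfl

end DoubleKStanley
end

theorem theoremT :
    -- the objects are well defined: the back stable limits exist in the back stable ring
    (∀ μ : YoungDiagram, ∃! F : BackStable, IsBackStableLimit (grassmannianPerm μ) F) ∧
    -- the functions `G_λ(x‖a)` form an `R(a)`-basis of their span `Γ(x‖a)`
    LinearIndependent Ra grassKStanley ∧
    -- `Γ(x‖a)` is an `R(a)`-subalgebra `A`, and `A ⊗ A` is a submodule of the completed tensor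
    -- product of `Λ̂(x‖a)` with itself
    ∃ A : Subalgebra Ra Lam, Subalgebra.toSubmodule A = Gam ∧
      Function.Injective (tensorIncl A) ∧
      -- the coproduct and the counit of `Λ̂(x‖a)` restrict to `A` and make it a bialgebra
      ∃ (comul : A →ₐ[Ra] A ⊗[Ra] A) (cou : A →ₐ[Ra] Ra),
        (∀ f : A, tensorIncl A (comul f) = Delta (f : Lam)) ∧
        (∀ f : A, (cou f : SS) = counit (f : Lam)) ∧
        (Algebra.TensorProduct.assoc Ra Ra Ra A A A).toAlgHom.comp
            ((Algebra.TensorProduct.map comul (AlgHom.id Ra A)).comp comul) =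
          (Algebra.TensorProduct.map (AlgHom.id Ra A) comul).comp comul ∧
        (Algebra.TensorProduct.map cou (AlgHom.id Ra A)).comp comul =
          (Algebra.TensorProduct.lid Ra A).symm.toAlgHom ∧
        (Algebra.TensorProduct.map (AlgHom.id Ra A) cou).comp comul =
          (Algebra.TensorProduct.rid Ra Ra A).symm.toAlgHom := by
  have hfun : grassKStanley = partDet := funext grassKStanley_eq_partDet
  refine ⟨fun μ => ⟨_, isBackStableLimit_partDet μ, fun F hF => hF.unique
    (isBackStableLimit_partDet μ)⟩, ?_, partAlg, ?_, tensorIncl_partAlg_injective, comulA, couA,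
    tensorIncl_comulA, fun _ => rfl, coassocA, counitLeftA, counitRightA⟩
  · rw [hfun]
    exact linearIndependent_partDet
  · rw [Gam, hfun]
    rfl
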